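/- Let $U(\phi)=\phi^2(1-\phi^2)^2$ and, for $\phi=\phi(t,x)$, let $\Lambda(\phi)=\partial_t^2\phi-\partial_x^2\phi+\dot U(\phi)$. Let $$H_{0,1}(x)=\frac{e^{\sqrt2x}}{\sqrt{1+e^{2\sqrt2x}}},\quad H_{-1,0}(x)=-H_{0,1}(-x),\quad \mathcal G(x)=e^{-\sqrt2x}-\frac{e^{-\sqrt2x}}{(1+e^{2\sqrt2x})^{3/2}}+\frac{(2\sqrt2x+k_1)e^{\sqrt2x}}{(1+e^{2\sqrt2x})^{3/2}},$$ where $k_1\in\mathbb R$ is the unique number with $\langle\mathcal G,\dot H_{0,1}\rangle=0$ ($\langle\cdot,\cdot\rangle$ and $\|\cdot\|$ without index refer to $L^2(\mathbb R)$). For $0<v<1$ put $$d_v(t)=\tfrac1{\sqrt2}\ln\Big(\tfrac8{v^2}\cosh^2(\sqrt2vt)\Big),\qquad \gamma_v(t)=\Big(1-\tfrac{\dot d_v(t)^2}4\Big)^{-1/2},\qquad w_0(t,x)=\gamma_v(t)\Big(x-\tfrac{d_v(t)}2\Big),$$ and, for $r:\mathbb R\to\mathbb R$, $$\varphi_{v,r}(t,x)=H_{0,1}(w_0(t,x+r(t)))-H_{0,1}(w_0(t,-x+r(t)))+e^{-\sqrt2d_v(t)}\big[\mathcal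 G(w_0(t,x+r(t)))-\mathcal G(w_0(t,-x+r(t)))\big].$$ **The linear equation.** Define $R_{1,v},R_{2,v}$ by $$\Lambda(H_{0,1}(w_0))=-8\sqrt2\,\gamma_ve^{-\sqrt2d_v}\dot H_{0,1}(w_0)+R_{1,v}(t,w_0),$$ $$\big[\partial_t^2-\partial_x^2+\ddot U(H_{0,1}(w_0))\big]\big(e^{-\sqrt2d_v}\mathcal G(w_0)\big)=\big[8\sqrt2\dot H_{0,1}(w_0)-(24H_{0,1}(w_0)^2-30H_{0,1}(w_0)^4)e^{-\sqrt2w_0}\big]e^{-\sqrt2d_v}+R_{2,v}(t,w_0),$$ with $w_0=w_0(t,x)$, and put $V=H_{0,1}/(1+\sqrt{1+e^{2\sqrt2x}})$, $$A=-2U^{(3)}(H_{0,1})e^{-\sqrt2x}\dot H_{0,1},\qquad B=2\sqrt2(\ddot U(H_{0,1})-2)e^{-\sqrt2x},$$ $$C=-U^{(3)}(H_{0,1})e^{-\sqrt2x}(\mathcal G-2x\dot H_{0,1}),\qquad D=(\tfrac32+k_1)(\ddot U(H_{0,1})-2)e^{-\sqrt2x}.$$ The equation for $r$ is $$\|\dot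 H_{0,1}\|^2\ddot r=-32e^{-\sqrt2d_v}\|\dot H_{0,1}\|^2r-\langle\dot H_{0,1},R_{1,v}+R_{2,v}\rangle-\Big[\langle\dot H_{0,1},xA+xB+C-D\rangle+d_v\langle\dot H_{0,1},B\rangle+\tfrac12\langle\dot H_{0,1},U^{(3)}(H_{0,1})\mathcal G^2\rangle+15+24\langle V,\dot H_{0,1}\rangle\Big]e^{-2\sqrt2d_v}-4\Big[\gamma_v^{-1}e^{-\sqrt2\gamma_vd_v}-e^{-\sqrt2d_v}\Big].\tag{$*$}$$ **Theorem.** There are $\delta\in(0,1)$, $K>0$, an integer $n\ge1$, functions $r_v:\mathbb R\to\mathbb R$ and numbers $e(v),e_v\in\mathbb R$ such that the following holds for all $0<v<\delta$, with $\phi_2(v,t,x)=\varphi_{v,r_v}(t+e(v),x)$. 1. $r_v$ is smooth and even, solves $(*)$ on $\mathbb R$, and $|r_v(t)|\le Kv^2\ln(1/v)$ for all $t$. 2. As $t\to+\infty$, $$\Big\|\phi_2(v,t,\cdot)-H_{0,1}\Big(\tfrac{x-vt}{\sqrt{1-v^2}}\Big)-H_{-1,0}\Big(\tfrac{x+vt}{\sqrt{1-v^2}}\Big)\Big\|_{H^1_x}\to0,$$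 $$\Big\|\partial_t\phi_2(v,t,\cdot)+\tfrac v{\sqrt{1-v^2}}\dot H_{0,1}\Big(\tfrac{x-vt}{\sqrt{1-v^2}}\Big)-\tfrac v{\sqrt{1-v^2}}\dot H_{-1,0}\Big(\tfrac{x+vt}{\sqrt{1-v^2}}\Big)\Big\|_{L^2_x}\to0,$$ and as $t\to-\infty$, $$\Big\|\phi_2(v,t,\cdot)-H_{0,1}\Big(\tfrac{x+vt-e_v}{\sqrt{1-v^2}}\Big)-H_{-1,0}\Big(\tfrac{x-vt+e_v}{\sqrt{1-v^2}}\Big)\Big\|_{H^1_x}\to0,$$ $$\Big\|\partial_t\phi_2(v,t,\cdot)-\tfrac v{\sqrt{1-v^2}}\dot H_{0,1}\Big(\tfrac{x+vt-e_v}{\sqrt{1-v^2}}\Big)+\tfrac v{\sqrt{1-v^2}}\dot H_{-1,0}\Big(\tfrac{x-vt+e_v}{\sqrt{1-v^2}}\Big)\Big\|_{L^2_x}\to0.$$ 3. $\displaystyle\lim_{v\to0^+}\frac{\big|e_v-\frac1{\sqrt2}\ln(2/v^2)\big|}{v|\ln v|^3}=0.$ 4. For every real $s\ge0$ and every integer $l\ge0$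 there is $C(s,l)>0$ such that for all $0<v<\delta$ and $t\in\mathbb R$ $$\Big\|\frac{\partial^l}{\partial t^l}\Lambda(\phi_2)(v,t,\cdot)\Big\|_{H^s_x(\mathbb R)}\le C(s,l)\,v^{4+l}\Big(|t+e(v)|v+\ln\frac1{v^2}\Big)^{n}e^{-2\sqrt2|t+e(v)|v}.$$ -/

import Mathlib

open MeasureTheory Filter Topology Set
open scoped ENNReal ContDiff FourierTransform

noncomputable section

namespace PhiSix

/-- The potential `U(φ) = φ² (1 - φ²)²` of the φ⁶ model. -/
def U (p : ℝ) : ℝ := p ^ 2 * (1 - p ^ 2) ^ 2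

/-- The linear part `∂ₜ² φ - ∂ₓ² φ` of the wave equation, at `(t, x)`. -/
def box (φ : ℝ → ℝ → ℝ) (t x : ℝ) : ℝ :=
  iteratedDeriv 2 (fun τ => φ τ x) t - iteratedDeriv 2 (fun y => φ t y) x

/-- The operator `Λ(φ) = ∂ₜ² φ - ∂ₓ² φ + U'(φ)`, at `(t, x)`. -/
def Lam (φ : ℝ → ℝ → ℝ) (t x : ℝ) : ℝ := box φ t x + deriv U (φ t x)

/-- The kink `H_{0,1}`, connecting `0` and `1`. -/
def H01 (x : ℝ) : ℝ := Real.exp (√2 * x) / √(1 + Real.exp (2 * √2 * x))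

/-- The kink `H_{-1,0}(x) = -H_{0,1}(-x)`, connecting `-1` and `0`. -/
def Hm10 (x : ℝ) : ℝ := -H01 (-x)

/-- `e^{√2 x} (1 + e^{2√2 x})^{-3/2}`, which is `H_{0,1}'(x) / √2`. -/
def bump (x : ℝ) : ℝ := Real.exp (√2 * x) / (1 + Real.exp (2 * √2 * x)) ^ (3 / 2 : ℝ)

/-- The part of `𝒢` that does not involve the constant `k₁`. -/
def G0 (x : ℝ) : ℝ :=
  Real.exp (-(√2 * x)) - Real.exp (-(√2 * x)) / (1 + Real.exp (2 * √2 * x)) ^ (3 / 2 : ℝ)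
    + 2 * √2 * x * bump x

/-- The unique real `k₁` for which `𝒢 = G0 + k₁ bump` is orthogonal to `H_{0,1}'` in `L²`
(see `integral_G_mul_deriv_H01`). -/
def k1 : ℝ := -(∫ x, G0 x * deriv H01 x) / ∫ x, bump x * deriv H01 x

/-- The correction profile `𝒢`. -/
def G (x : ℝ) : ℝ := G0 x + k1 * bump x

theorem deriv_H01 (x : ℝ) : deriv H01 x = √2 * bump x := by
  have hy : 0 < 1 + Real.exp (2 * √2 * x) := by positivity
  have h1 : HasDerivAt (fun x : ℝ => Real.exp (√2 * x)) (Real.exp (√2 * x) * √2) x := by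
    simpa using ((hasDerivAt_id x).const_mul √2).exp
  have h2 : HasDerivAt (fun x : ℝ => 1 + Real.exp (2 * √2 * x))
      (Real.exp (2 * √2 * x) * (2 * √2)) x := by
    simpa using (((hasDerivAt_id x).const_mul (2 * √2)).exp).const_add 1
  have h := (h1.div (h2.sqrt hy.ne') (by positivity)).deriv
  have h3 : (1 + Real.exp (2 * √2 * x)) ^ (3 / 2 : ℝ)
      = (1 + Real.exp (2 * √2 * x)) * √(1 + Real.exp (2 * √2 * x)) := by
    rw [show (3 / 2 : ℝ) = 1 + 1 / 2 by norm_num, Real.rpow_add hy, Real.rpow_one,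
      ← Real.sqrt_eq_rpow]
  have h4 : deriv H01 x = deriv ((fun x : ℝ => Real.exp (√2 * x)) /
      fun x => √(1 + Real.exp (2 * √2 * x))) x := rfl
  rw [h4, h, bump, h3]
  have hs := Real.sq_sqrt hy.le
  have hp : 0 < √(1 + Real.exp (2 * √2 * x)) := by positivity
  rw [hs]
  generalize Real.exp (2 * √2 * x) = y at *
  field_simp
  linear_combination hs

theorem bump_pos (x : ℝ) : 0 < bump x := by unfold bump; positivity

theorem continuous_bump : Continuous bump := by
  unfold bump
  refine Continuous.div (by fun_prop) ?_ (fun x => by positivity)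
  exact Continuous.rpow_const (by fun_prop) (fun x => Or.inl (by positivity))

theorem bump_le (x : ℝ) : bump x ≤ Real.exp (-√2 * |x|) := by
  have hy : 1 ≤ 1 + Real.exp (2 * √2 * x) := by linarith [Real.exp_pos (2 * √2 * x)]
  have h1 : 1 + Real.exp (2 * √2 * x) ≤ (1 + Real.exp (2 * √2 * x)) ^ (3 / 2 : ℝ) := by
    simpa using Real.rpow_le_rpow_of_exponent_le hy (show (1 : ℝ) ≤ 3 / 2 by norm_num)
  have he := Real.exp_pos (√2 * x)
  unfold bump
  rcases le_total 0 x with hx | hx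
  · rw [abs_of_nonneg hx, div_le_iff₀ (by positivity)]
    calc Real.exp (√2 * x) = Real.exp (-√2 * x) * Real.exp (2 * √2 * x) := by
          rw [← Real.exp_add]; ring_nf
      _ ≤ _ := by gcongr; linarith
  · rw [abs_of_nonpos hx, neg_mul_neg]
    exact div_le_self he.le (hy.trans h1)

theorem integrable_bump : Integrable bump := by
  have h : Integrable (fun x : ℝ => Real.exp (-√2 * |x|)) :=
    by
    have h2 : (0 : ℝ) < √2 := by positivity
    rw [← integrableOn_univ, ← Set.Iic_union_Ioi (a := (0 : ℝ))]
    refine IntegrableOn.union ?_ ?_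
    · refine (integrableOn_exp_mul_Iic h2 0).congr_fun (fun x hx => ?_) measurableSet_Iic
      rw [abs_of_nonpos (Set.mem_Iic.1 hx), neg_mul_neg]
    · refine (integrableOn_exp_mul_Ioi (neg_lt_zero.2 h2) 0).congr_fun (fun x hx => ?_)
        measurableSet_Ioi
      rw [abs_of_pos (Set.mem_Ioi.1 hx)]
  refine h.mono' continuous_bump.aestronglyMeasurable (ae_of_all _ fun x => ?_)
  rw [Real.norm_of_nonneg (bump_pos x).le]
  exact bump_le x

theorem continuous_G0 : Continuous G0 := by
  unfold G0
  have h : Continuous fun x : ℝ => (1 + Real.exp (2 * √2 * x)) ^ (3 / 2 : ℝ) :=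
    Continuous.rpow_const (by fun_prop) (fun x => Or.inl (by positivity))
  have h1 : Continuous fun x : ℝ =>
      Real.exp (-(√2 * x)) / (1 + Real.exp (2 * √2 * x)) ^ (3 / 2 : ℝ) :=
    Continuous.div (by fun_prop) h (fun x => by positivity)
  have := continuous_bump
  fun_prop

theorem abs_G0_le (x : ℝ) : |G0 x| ≤ 4 := by
  set y := Real.exp (2 * √2 * x) with hy
  have y0 : 0 < y := Real.exp_pos _
  have hq : (1 + y) ^ (3 / 2 : ℝ) ≤ (1 + y) ^ 2 := by
    have := Real.rpow_le_rpow_of_exponent_le (show 1 ≤ 1 + y by linarith)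
      (show (3 / 2 : ℝ) ≤ 2 by norm_num)
    exact_mod_cast this
  have hq1 : 1 ≤ (1 + y) ^ (3 / 2 : ℝ) := Real.one_le_rpow (by linarith) (by norm_num)
  set q := (1 + y) ^ (3 / 2 : ℝ) with hqd
  have hE := Real.exp_pos (-(√2 * x))
  have hyE : y * Real.exp (-(√2 * x)) = Real.exp (√2 * x) := by
    rw [hy, ← Real.exp_add]; ring_nf
  have i1 : 1 / q ≤ 1 := by rw [div_le_one (by linarith)]; exact hq1
  have i2 : 1 - 2 * y ≤ 1 / q := by
    rw [le_div_iff₀ (by linarith)]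
    rcases le_total (1 - 2 * y) 0 with h | h
    · nlinarith
    · calc (1 - 2 * y) * q ≤ (1 - 2 * y) * (1 + y) ^ 2 := by gcongr
        _ ≤ 1 := by nlinarith [sq_nonneg y, mul_pos y0 y0, mul_pos (mul_pos y0 y0) y0]
  have hfirst : Real.exp (-(√2 * x)) - Real.exp (-(√2 * x)) / q
      = Real.exp (-(√2 * x)) * (1 - 1 / q) := by ring
  have i0 : 0 < 1 / q := by positivity
  have b1 : |Real.exp (-(√2 * x)) - Real.exp (-(√2 * x)) / q| ≤ 2 := by
    rw [hfirst, abs_of_nonneg (mul_nonneg hE.le (by linarith))]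
    rcases le_total 0 x with hx | hx
    · have : Real.exp (-(√2 * x)) ≤ 1 := Real.exp_le_one_iff.2 (by simp; positivity)
      nlinarith
    · have : Real.exp (√2 * x) ≤ 1 :=
        Real.exp_le_one_iff.2 (mul_nonpos_of_nonneg_of_nonpos (by positivity) hx)
      nlinarith
  have b2 : |2 * √2 * x * bump x| ≤ 2 := by
    rw [abs_mul, abs_of_pos (bump_pos x), abs_mul, abs_of_pos (show (0 : ℝ) < 2 * √2 by positivity)]
    have h1 := bump_le x
    have h2 : √2 * |x| ≤ Real.exp (√2 * |x|) := by linarith [Real.add_one_le_exp (√2 * |x|)]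
    have h3 : Real.exp (√2 * |x|) * Real.exp (-√2 * |x|) = 1 := by
      rw [← Real.exp_add]; simp
    calc 2 * √2 * |x| * bump x ≤ 2 * √2 * |x| * Real.exp (-√2 * |x|) := by gcongr
      _ = 2 * (√2 * |x| * Real.exp (-√2 * |x|)) := by ring
      _ ≤ 2 * (Real.exp (√2 * |x|) * Real.exp (-√2 * |x|)) := by gcongr
      _ = 2 := by rw [h3]; norm_num
  calc |G0 x| ≤ _ + _ := abs_add_le _ _
    _ ≤ 2 + 2 := add_le_add b1 b2
    _ = 4 := by norm_num

/-- `⟨𝒢, H_{0,1}'⟩ = 0`. -/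
theorem integral_G_mul_deriv_H01 : ∫ x, G x * deriv H01 x = 0 := by
  have hd : (fun x => deriv H01 x) = fun x => √2 * bump x := funext deriv_H01
  have hi : Integrable (fun x => deriv H01 x) := by
    rw [hd]; exact integrable_bump.const_mul _
  have i1 : Integrable (fun x => G0 x * deriv H01 x) :=
    hi.bdd_mul continuous_G0.aestronglyMeasurable (ae_of_all _ abs_G0_le)
  have hb1 (x : ℝ) : ‖bump x‖ ≤ 1 := by
    rw [Real.norm_of_nonneg (bump_pos x).le]
    exact (bump_le x).trans (Real.exp_le_one_iff.2 (by simp))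
  have i2 : Integrable (fun x => bump x * deriv H01 x) :=
    hi.bdd_mul continuous_bump.aestronglyMeasurable (ae_of_all _ hb1)
  have hpos : 0 < ∫ x, bump x * deriv H01 x := by
    have hp (x : ℝ) : 0 < bump x * deriv H01 x := by
      rw [deriv_H01]; have := bump_pos x; positivity
    rw [integral_pos_iff_support_of_nonneg (fun x => (hp x).le) i2]
    rw [show Function.support (fun x => bump x * deriv H01 x) = Set.univ from
      Set.eq_univ_of_forall fun x => (hp x).ne']
    simp
  have : ∀ x, G x * deriv H01 x = G0 x * deriv H01 x + k1 * (bump x * deriv H01 x) := by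
    intro x; unfold G; ring
  simp_rw [this]
  rw [integral_add i1 (i2.const_mul _), integral_const_mul, k1]
  field_simp
  simp

/-- `d_v(t) = (1/√2) ln ((8/v²) cosh²(√2 v t))`. -/
def d (v t : ℝ) : ℝ := 1 / √2 * Real.log (8 / v ^ 2 * Real.cosh (√2 * v * t) ^ 2)

/-- The contraction factor `√(1 - d_v'(t)²/4)`. -/
def contr (v t : ℝ) : ℝ := √(1 - deriv (d v) t ^ 2 / 4)

/-- `w₀(t, x) = (x - d_v(t)/2) / √(1 - d_v'(t)²/4)`. -/
def w0 (v t x : ℝ) : ℝ := (x - d v t / 2) / contr v t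

/-- The ansatz `φ₂` built from the modulation `r = r_v`. -/
def ansatz (v : ℝ) (r : ℝ → ℝ) (t x : ℝ) : ℝ :=
  H01 (w0 v t (x + r t)) - H01 (w0 v t (-x + r t))
    + Real.exp (-(√2 * d v t)) * (G (w0 v t (x + r t)) - G (w0 v t (-x + r t)))

/-! ### The linear differential equation for `r_v` -/

/-- `R_{1,v}(t, y)`: the remainder with
`Λ(H_{0,1}(w₀(t,x))) = -8√2 e^{-√2 d} (1 - d'²/4)^{-1/2} H_{0,1}'(w₀(t,x)) + R_{1,v}(t, w₀(t,x))`.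
The point `x` with `w₀(t,x) = y` is `y √(1 - d'²/4) + d/2`. -/
def R1 (v t y : ℝ) : ℝ :=
  Lam (fun τ x => H01 (w0 v τ x)) t (y * contr v t + d v t / 2)
    + 8 * √2 * Real.exp (-(√2 * d v t)) / contr v t * deriv H01 y

/-- `R_{2,v}(t, y)`: the remainder with
`(∂ₜ² - ∂ₓ² + U''(H_{0,1}(w₀))) (e^{-√2 d} 𝒢(w₀)) = 8√2 H_{0,1}'(w₀) e^{-√2 d}
  - (24 H_{0,1}(w₀)² - 30 H_{0,1}(w₀)⁴) e^{-√2 w₀} e^{-√2 d} + R_{2,v}(t, w₀)`, `w₀ = w₀(t,x)`. -/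
def R2 (v t y : ℝ) : ℝ :=
  box (fun τ x => Real.exp (-(√2 * d v τ)) * G (w0 v τ x)) t (y * contr v t + d v t / 2)
    + iteratedDeriv 2 U (H01 y) * (Real.exp (-(√2 * d v t)) * G y)
    - 8 * √2 * deriv H01 y * Real.exp (-(√2 * d v t))
    + (24 * H01 y ^ 2 - 30 * H01 y ^ 4) * Real.exp (-(√2 * y)) * Real.exp (-(√2 * d v t))

/-- `V = H_{0,1} / (1 + √(1 + e^{2√2 x}))`. -/
def V (x : ℝ) : ℝ := H01 x / (1 + √(1 + Real.exp (2 * √2 * x)))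

/-! The functions `A, B, C, D` below are the leading coefficients, as `ζ → ∞`, of
`(U''(H_{0,1}(x - ζ) + H_{-1,0}(x)) - U''(H_{0,1}(x - ζ))) e^{-√2 ζ} 𝒢(x - ζ)
  = e^{-2√2 ζ} ((x - ζ) A(x - ζ) + (x - ζ) B(-x) + C(x - ζ) + D(-x)) + ⋯`.
Near the kink at `ζ` one uses `H_{-1,0}(x) ≈ -e^{-√2 ζ} e^{-√2 (x - ζ)}`, near the kink at `0`
one uses `𝒢(y) ≈ (2√2 y + 3/2 + k₁) e^{√2 y}` as `y → -∞`. -/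

/-- The coefficient `A`. -/
def cA (x : ℝ) : ℝ := -2 * iteratedDeriv 3 U (H01 x) * Real.exp (-(√2 * x)) * deriv H01 x

/-- The coefficient `B`. -/
def cB (x : ℝ) : ℝ := 2 * √2 * (iteratedDeriv 2 U (H01 x) - 2) * Real.exp (-(√2 * x))

/-- The coefficient `C`. -/
def cC (x : ℝ) : ℝ :=
  -iteratedDeriv 3 U (H01 x) * Real.exp (-(√2 * x)) * (G x - 2 * x * deriv H01 x)

/-- The coefficient `D`. -/
def cD (x : ℝ) : ℝ := (3 / 2 + k1) * (iteratedDeriv 2 U (H01 x) - 2) * Real.exp (-(√2 * x))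

/-- `⟨H_{0,1}', f⟩` in `L²(ℝ)`. -/
def proj (f : ℝ → ℝ) : ℝ := ∫ x, deriv H01 x * f x

/-- The inhomogeneity of the linear equation for `r_v`:
`‖H_{0,1}'‖² r'' = -32 e^{-√2 d} ‖H_{0,1}'‖² r + NL`. -/
def NL (v t : ℝ) : ℝ :=
  -proj (fun x => R1 v t x + R2 v t x)
    - proj (fun x => x * cA x + x * cB x + cC x - cD x) * Real.exp (-(2 * √2 * d v t))
    - proj cB * d v t * Real.exp (-(2 * √2 * d v t))
    - 1 / 2 * proj (fun x => iteratedDeriv 3 U (H01 x) * G x ^ 2) * Real.exp (-(2 * √2 * d v t))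
    - 4 * (Real.exp (-(√2 * d v t) / contr v t) * contr v t - Real.exp (-(√2 * d v t)))
    - 15 * Real.exp (-(2 * √2 * d v t))
    - 24 * Real.exp (-(2 * √2 * d v t)) * proj V

/-! ### Norms -/

/-- The norm `(‖f‖²_{L²} + ‖f'‖²_{L²})^{1/2}` of `H¹(ℝ)`, for a differentiable function `f`. -/
def normH1 (f : ℝ → ℝ) : ℝ≥0∞ :=
  (eLpNorm f 2 volume ^ 2 + eLpNorm (deriv f) 2 volume ^ 2) ^ (1 / 2 : ℝ)

open Classical in
/-- The norm of `H^s(ℝ)` for real `s ≥ 0`,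
`‖f‖² = ∫ (1 + |2πξ|²)^s |𝓕 f(ξ)|² dξ` with the Plancherel Fourier transform `𝓕` on `L²`
(kernel `e^{-2πixξ}`, so that `s = 1` gives `‖f‖²_{L²} + ‖f'‖²_{L²}`); it is `∞` for
`f ∉ L²`. -/
def normHs (s : ℝ) (f : ℝ → ℝ) : ℝ≥0∞ :=
  if h : MemLp (fun x => (f x : ℂ)) 2 (volume : Measure ℝ) then
    (∫⁻ ξ : ℝ, ENNReal.ofReal ((1 + (2 * Real.pi * ξ) ^ 2) ^ s)
      * ‖(𝓕 (h.toLp (fun x => (f x : ℂ))) : Lp ℂ 2 (volume : Measure ℝ)) ξ‖ₑ ^ 2) ^ (1 / 2 : ℝ)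
  else ∞

end PhiSix

end

noncomputable section

namespace PhiSix

/-! ### The kink profiles -/

/-! The trajectory makes everything explicit: `e^{-√2 d_v} = (v²/8) sech²(√2 v t)` and `d_v' = 2 v
tanh(√2 v t)`. All coefficients that occur are functions of `(v, t)` of size `v^p Lg^n ew^k` (`Lg`
the logarithmic factor, `ew` the exponential weight), and each time derivative gains one more factor
`v`. The classes `SB n k p` record this and are closed under sums, products and differentiation, so
all orders `l` are treated at once.

The modulation. Since `32 e^{-√2 d_v} = 4 v² sech²(√2 v t)`, the homogeneous equation has the
solutions `tanh(√2 v t)` and `√2 v t tanh(√2 v t) - 1`. The inhomogeneity is even and of order `v⁴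
Lg ew` (`SB_NL`). Variation of constants, integrating the coefficient of the growing solution from
infinity, then gives a bounded even solution of size `v² ln (1/v)`; its derivatives have size `v³ Lg
ew`, `v⁴ Lg ew` and so on (`SB_modul`). These sizes and the evenness of `r_v` are all that the rest
of the argument takes from the equation.

The error. Let `X`, `Y` be the coordinates centred at the two kinks. Their sum does not depend on
`x`, so `H_{0,1}(X) H_{0,1}(Y)` equals `e^{√2 (X + Y)}`, a quantity of order `v²`, times bounded
functions (`H01_Xc_mul_H01_Yc`). In `Λ` of the ansatz the terms of order `v²` are the acceleration
of the kinks and the first interaction term; the differential equation of `𝒢` (`hasDerivAt_G'`)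
cancels both. What is left (`Lam_ansatz_eq`) consists of one-kink remainders, products of two
interaction factors, the difference `e^{√2 (X + Y)} - e^{-√2 d_v} = O(v⁴ Lg ew)`, and terms
quadratic in the correction. All of them are finite sums `c(v,t) a(X) b(Y)` with `c` in `SB 1 1 4`,
both profiles bounded and at least one rapidly decreasing: the class `Tm 4` (`exists_Tm_Lam`). Time
derivatives map `Tm p` to `Tm (p + 1)`, space derivatives preserve it, and its members have uniform
`L¹` bounds. Applying `1 - ∂ₓ²` often enough turns these into pointwise decay of the Fourier
transform, hence into `H^s` bounds (`Tm.normHs_le`).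

The limits. As `t → ∞`, `d_v(t) - 2 v t` tends to `ln(2/v²)/√2` and `r_v` tends to a limit. A time
shift `e(v)` can therefore be chosen for which `X` becomes asymptotic to the Lorentz coordinate `(x
- v t)/√(1 - v²)` (`exists_affine_Xs`). The ansatz is odd in `x`, which gives the left kink, and
even in `t`, which gives `t → -∞` with `e_v = -2 v e(v) = ln(2/v²)/√2 - 2 lim r_v`. The phase
estimate is thus the bound on `r_v`. -/

/-- The profile `(1 + e^{2√2 x})^{-1/2} = H_{0,1}(-x)`. -/
def rho (x : ℝ) : ℝ := 1 / √(1 + Real.exp (2 * √2 * x))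

/-- The profile `1 / (1 + rho)`. -/
def om (x : ℝ) : ℝ := 1 / (1 + rho x)

theorem exp_two_sqrt_two (x : ℝ) : Real.exp (2 * √2 * x) = Real.exp (√2 * x) ^ 2 := by
  rw [← Real.exp_nat_mul]; congr 1; push_cast; ring

theorem rho_pos (x : ℝ) : 0 < rho x := by unfold rho; positivity

theorem rho_sq_mul (x : ℝ) : rho x ^ 2 * (1 + Real.exp (√2 * x) ^ 2) = 1 := by
  have h : (0 : ℝ) < 1 + Real.exp (2 * √2 * x) := by positivity
  rw [rho, div_pow, Real.sq_sqrt h.le, ← exp_two_sqrt_two]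
  field_simp

theorem H01_eq (x : ℝ) : H01 x = Real.exp (√2 * x) * rho x := by
  rw [H01, rho]; ring

theorem H01_pos (x : ℝ) : 0 < H01 x := by
  rw [H01_eq]; exact mul_pos (Real.exp_pos _) (rho_pos x)

theorem H01_sq_add (x : ℝ) : H01 x ^ 2 + rho x ^ 2 = 1 := by
  rw [H01_eq]; linear_combination rho_sq_mul x

theorem H01_sq (x : ℝ) : H01 x ^ 2 = 1 - rho x ^ 2 := by linear_combination H01_sq_add x

theorem rho_le_one (x : ℝ) : rho x ≤ 1 := by
  nlinarith [H01_sq_add x, sq_nonneg (H01 x), rho_pos x]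

theorem H01_le_one (x : ℝ) : H01 x ≤ 1 := by
  nlinarith [H01_sq_add x, sq_nonneg (rho x), H01_pos x]

theorem om_pos (x : ℝ) : 0 < om x := by
  have := rho_pos x
  unfold om; positivity

theorem om_le_one (x : ℝ) : om x ≤ 1 := by
  have := rho_pos x
  unfold om
  rw [div_le_one (by linarith)]; linarith

theorem om_mul (x : ℝ) : om x * (1 + rho x) = 1 := by
  have := rho_pos x
  unfold om; field_simp

/-- The reason for introducing `om`: `1 - rho` vanishes as `x → -∞`, and this makes the vanishing
visible as a factor `H01²` with a bounded cofactor. -/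
theorem one_sub_rho (x : ℝ) : 1 - rho x = H01 x ^ 2 * om x := by
  rw [H01_sq]; linear_combination (-(1 - rho x)) * om_mul x

theorem rpow_three_halves (x : ℝ) :
    1 / (1 + Real.exp (2 * √2 * x)) ^ (3 / 2 : ℝ) = rho x ^ 3 := by
  have hy : (0 : ℝ) < 1 + Real.exp (2 * √2 * x) := by positivity
  rw [show (3 / 2 : ℝ) = 1 / 2 * (3 : ℕ) by norm_num, Real.rpow_mul hy.le, Real.rpow_natCast,
    ← Real.sqrt_eq_rpow, rho, div_pow, one_pow]

theorem bump_eq (x : ℝ) : bump x = H01 x * rho x ^ 2 := by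
  rw [bump, div_eq_mul_one_div, rpow_three_halves, H01_eq]; ring

theorem hasDerivAt_H01 (x : ℝ) : HasDerivAt H01 (√2 * (H01 x * rho x ^ 2)) x := by
  have h : DifferentiableAt ℝ H01 x := by
    unfold H01
    have : (1 : ℝ) + Real.exp (2 * √2 * x) ≠ 0 := by positivity
    refine DifferentiableAt.div (by fun_prop) (DifferentiableAt.sqrt (by fun_prop) this) ?_
    positivity
  rw [← bump_eq, ← deriv_H01]; exact h.hasDerivAt

theorem hasDerivAt_expm (x : ℝ) :
    HasDerivAt (fun x : ℝ => Real.exp (√2 * x)) (√2 * Real.exp (√2 * x)) x := by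
  have := ((hasDerivAt_id x).const_mul √2).exp
  simpa [mul_comm] using this

theorem hasDerivAt_expm_neg (x : ℝ) :
    HasDerivAt (fun x : ℝ => Real.exp (-(√2 * x))) (-√2 * Real.exp (-(√2 * x))) x := by
  have := ((hasDerivAt_id x).const_mul √2).neg.exp
  simpa [mul_comm] using this

theorem hasDerivAt_rho (x : ℝ) : HasDerivAt rho (-√2 * (rho x * H01 x ^ 2)) x := by
  have h1 : rho = fun x => Real.exp (-(√2 * x)) * H01 x := by
    funext y; rw [H01_eq, ← mul_assoc, ← Real.exp_add]; simp
  have h2 := (hasDerivAt_expm_neg x).mul (hasDerivAt_H01 x)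
  have h3 : Real.exp (-(√2 * x)) * H01 x = rho x := (congrFun h1 x).symm
  rw [h1]
  refine h2.congr_deriv ?_
  simp only []
  rw [h3]
  linear_combination (√2 * rho x ^ 2 - √2) * h3 + √2 * rho x * H01_sq_add x

theorem hasDerivAt_om (x : ℝ) : HasDerivAt om (√2 * (rho x * H01 x ^ 2 * om x ^ 2)) x := by
  have h := (hasDerivAt_const x (1 : ℝ)).div ((hasDerivAt_rho x).const_add 1)
    (by have := rho_pos x; positivity)
  refine h.congr_deriv ?_
  rw [om, div_pow, one_pow]; ring

theorem G_eq (x : ℝ) : G x = Real.exp (-(√2 * x)) * (1 - rho x ^ 3)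
    + (2 * √2 * x + k1) * (Real.exp (√2 * x) * rho x ^ 3) := by
  rw [G, G0, div_eq_mul_one_div, rpow_three_halves, bump_eq, H01_eq]; ring

theorem expm_neg_mul_H01 (x : ℝ) : Real.exp (-(√2 * x)) * H01 x = rho x := by
  rw [H01_eq, ← mul_assoc, ← Real.exp_add]; simp

/-- The term `e^{-√2 x}` in `𝒢` is unbounded at `-∞`, but its cofactor `1 - rho³` contains `H01²`,
and `e^{-√2 x} H01 = rho`. The factor `H01 rho` that remains shows the decay on both sides. -/
theorem G_eq_profile (x : ℝ) : G x = H01 x * rho x * ((1 + rho x + rho x ^ 2) * om x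
    + (2 * √2 * x + k1) * rho x) := by
  rw [G_eq]
  have h1 : 1 - rho x ^ 3 = H01 x ^ 2 * ((1 + rho x + rho x ^ 2) * om x) := by
    linear_combination (1 + rho x + rho x ^ 2) * one_sub_rho x
  rw [h1]
  linear_combination H01 x * ((1 + rho x + rho x ^ 2) * om x) * expm_neg_mul_H01 x
    - (2 * √2 * x + k1) * rho x ^ 2 * H01_eq x

/-! ### The differential equation of the correction profile. -/

/-- The first derivative of `G`. -/
def G' (x : ℝ) : ℝ := -√2 * Real.exp (-(√2 * x)) * (1 - rho x ^ 3)
  + 3 * √2 * Real.exp (√2 * x) * rho x ^ 5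
  + 2 * √2 * (Real.exp (√2 * x) * rho x ^ 3)
  + (2 * √2 * x + k1) * (√2 * Real.exp (√2 * x) * (3 * rho x ^ 5 - 2 * rho x ^ 3))

theorem hasDerivAt_rho' (x : ℝ) :
    HasDerivAt rho (-√2 * (Real.exp (√2 * x) ^ 2 * rho x ^ 3)) x := by
  refine (hasDerivAt_rho x).congr_deriv ?_
  rw [H01_eq]; ring

theorem hasDerivAt_G (x : ℝ) : HasDerivAt G (G' x) x := by
  have h0 : G = fun x => Real.exp (-(√2 * x)) * (1 - rho x ^ 3)
    + (2 * √2 * x + k1) * (Real.exp (√2 * x) * rho x ^ 3) := funext G_eq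
  have hr3 := (hasDerivAt_rho' x).fun_pow 3
  have hl : HasDerivAt (fun x : ℝ => 2 * √2 * x + k1) (2 * √2) x := by
    simpa using ((hasDerivAt_id x).const_mul (2 * √2)).add_const k1
  have h := ((hasDerivAt_expm_neg x).fun_mul (hr3.const_sub 1)).fun_add
    (hl.fun_mul ((hasDerivAt_expm x).fun_mul hr3))
  rw [h0]
  refine h.congr_deriv ?_
  rw [G']
  have e : Real.exp (-(√2 * x)) * Real.exp (√2 * x) = 1 := by rw [← Real.exp_add]; simp
  have hw := rho_sq_mul x
  generalize Real.exp (√2 * x) = u at *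
  generalize Real.exp (-(√2 * x)) = w at *
  generalize rho x = ρ at *
  push_cast
  norm_num
  linear_combination 3 * √2 * u * ρ ^ 5 * e
    + (-(2 * √2 * x + k1)) * √2 * 3 * u * ρ ^ 3 * hw

theorem deriv_U (p : ℝ) : deriv U p = 2 * p - 8 * p ^ 3 + 6 * p ^ 5 := by
  have h : HasDerivAt U _ p := ((hasDerivAt_id p).fun_pow 2).fun_mul
    ((((hasDerivAt_id p).fun_pow 2).const_sub 1).fun_pow 2)
  rw [h.deriv]; norm_num; ring

theorem deriv_deriv_U (p : ℝ) : deriv (deriv U) p = 2 - 24 * p ^ 2 + 30 * p ^ 4 := by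
  have h := (((hasDerivAt_id p).const_mul 2).fun_sub (((hasDerivAt_id p).fun_pow 3).const_mul 8)).fun_add
    (((hasDerivAt_id p).fun_pow 5).const_mul 6)
  rw [funext deriv_U]
  refine HasDerivAt.deriv (h.congr_deriv ?_)
  norm_num; ring

theorem iteratedDeriv_two_U (p : ℝ) : iteratedDeriv 2 U p = 2 - 24 * p ^ 2 + 30 * p ^ 4 := by
  rw [iteratedDeriv_succ, iteratedDeriv_one, deriv_deriv_U]

/-- The equation for which `𝒢` is designed: its source terms are the acceleration of the kink and
the force of the other kink. The part of `𝒢` containing `k1` is a multiple of `H_{0,1}'`, which the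
linearised operator annihilates, so the value of `k1` does not matter. -/
theorem hasDerivAt_G' (x : ℝ) : HasDerivAt G' (iteratedDeriv 2 U (H01 x) * G x
    - 8 * √2 * deriv H01 x
    + (24 * H01 x ^ 2 - 30 * H01 x ^ 4) * Real.exp (-(√2 * x))) x := by
  have hr3 := (hasDerivAt_rho' x).fun_pow 3
  have hr5 := (hasDerivAt_rho' x).fun_pow 5
  have hl : HasDerivAt (fun x : ℝ => 2 * √2 * x + k1) (2 * √2) x := by
    simpa using ((hasDerivAt_id x).const_mul (2 * √2)).add_const k1
  have hu := hasDerivAt_expm x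
  have h := (((((hasDerivAt_expm_neg x).const_mul (-√2)).fun_mul (hr3.const_sub 1)).fun_add
    ((hu.const_mul (3 * √2)).fun_mul hr5)).fun_add ((hu.fun_mul hr3).const_mul (2 * √2))).fun_add
    (hl.fun_mul ((hu.const_mul √2).fun_mul ((hr5.const_mul 3).fun_sub (hr3.const_mul 2))))
  refine h.congr_deriv ?_
  rw [iteratedDeriv_two_U, deriv_H01, bump_eq, G_eq, H01_eq]
  have e : Real.exp (-(√2 * x)) * Real.exp (√2 * x) = 1 := by rw [← Real.exp_add]; simp
  have hw := rho_sq_mul x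
  have h2 : √2 ^ 2 = (2 : ℝ) := Real.sq_sqrt (by norm_num)
  -- With `M`, `u = e^{√2 x}`, `w = e^{-√2 x}` and `ρ` as indeterminates, the claim is a polynomial
  -- identity modulo `w u = 1`, `ρ² (1 + u²) = 1` and `s² = 2`.
  generalize 2 * √2 * x + k1 = M at *
  generalize √2 * x = y at *
  generalize Real.exp y = u at *
  generalize Real.exp (-y) = w at *
  generalize rho x = ρ at *
  generalize (√2 : ℝ) = s at *
  push_cast
  norm_num
  grind

/-! ### Bounded and rapidly decreasing profiles -/

/-- The algebra of bounded profiles generated by `H01`, `rho`, `om` and `x^i H01 rho`. -/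
inductive Sy : (ℝ → ℝ) → Prop
  | const (c : ℝ) : Sy fun _ => c
  | H01 : Sy H01
  | rho : Sy rho
  | om : Sy om
  | powHr (i : ℕ) : Sy fun x => x ^ i * (PhiSix.H01 x * PhiSix.rho x)
  | add {a b : ℝ → ℝ} : Sy a → Sy b → Sy fun x => a x + b x
  | mul {a b : ℝ → ℝ} : Sy a → Sy b → Sy fun x => a x * b x

/-- The rapidly decreasing profiles: the `ℝ[x]`-module generated by `H01 rho Sy`. -/
inductive De : (ℝ → ℝ) → Prop
  | base (i : ℕ) {a : ℝ → ℝ} : Sy a → De fun x => x ^ i * (H01 x * rho x) * a x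
  | add {a b : ℝ → ℝ} : De a → De b → De fun x => a x + b x

theorem Sy.of_eq {a b : ℝ → ℝ} (h : Sy a) (e : ∀ x, b x = a x) : Sy b := by
  rwa [show b = a from funext e]

theorem De.of_eq {a b : ℝ → ℝ} (h : De a) (e : ∀ x, b x = a x) : De b := by
  rwa [show b = a from funext e]

theorem Sy.const_mul {a : ℝ → ℝ} (h : Sy a) (c : ℝ) : Sy fun x => c * a x := (Sy.const c).mul h

theorem Sy.sub {a b : ℝ → ℝ} (h : Sy a) (h' : Sy b) : Sy fun x => a x - b x :=
  (h.add (h'.const_mul (-1))).of_eq fun x => by ring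

theorem Sy.pow {a : ℝ → ℝ} (h : Sy a) : ∀ n : ℕ, Sy fun x => a x ^ n
  | 0 => (Sy.const 1).of_eq fun x => by simp
  | n + 1 => ((Sy.pow h n).mul h).of_eq fun x => by ring

theorem De.mul_sy {a b : ℝ → ℝ} (h : De a) (hb : Sy b) : De fun x => a x * b x := by
  induction h with
  | base i ha => exact (De.base i (ha.mul hb)).of_eq fun x => by ring
  | add _ _ h1 h2 => exact (h1.add h2).of_eq fun x => by ring

theorem De.const_mul {a : ℝ → ℝ} (h : De a) (c : ℝ) : De fun x => c * a x :=
  (h.mul_sy (Sy.const c)).of_eq fun x => by ring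

theorem De.pow_mul {a : ℝ → ℝ} (h : De a) (n : ℕ) : De fun x => x ^ n * a x := by
  induction h with
  | base i ha => exact (De.base (n + i) ha).of_eq fun x => by ring
  | add _ _ h1 h2 => exact (h1.add h2).of_eq fun x => by ring

theorem De.id_mul {a : ℝ → ℝ} (h : De a) : De fun x => x * a x :=
  (h.pow_mul 1).of_eq fun x => by simp

theorem De.Hr : De fun x => H01 x * rho x :=
  (De.base 0 (Sy.const 1)).of_eq fun x => by simp

theorem H01_mul_rho_le (x : ℝ) : H01 x * rho x ≤ Real.exp (-√2 * |x|) := by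
  have h1 := rho_pos x
  have h2 := H01_pos x
  rcases le_total 0 x with hx | hx
  · rw [abs_of_nonneg hx, neg_mul, ← expm_neg_mul_H01, ← mul_assoc, mul_comm (H01 x), mul_assoc]
    have := H01_le_one x
    have := Real.exp_pos (-(√2 * x))
    calc _ ≤ Real.exp (-(√2 * x)) * (1 * 1) := by gcongr
      _ = _ := by ring
  · rw [abs_of_nonpos hx, neg_mul_neg, H01_eq, mul_assoc]
    have := rho_le_one x
    calc _ ≤ Real.exp (√2 * x) * (1 * 1) := by gcongr
      _ = _ := by ring

theorem sqrt_two_lb : (7 / 5 : ℝ) ≤ √2 := Real.le_sqrt_of_sq_le (by norm_num)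

theorem sqrt_two_ub : √2 ≤ (3 / 2 : ℝ) := Real.sqrt_le_iff.2 (by norm_num)

theorem pow_mul_exp_le (i : ℕ) (x : ℝ) :
    |x| ^ i * Real.exp (-√2 * |x|) ≤ (5 / 2) ^ i * i.factorial * Real.exp (-|x|) := by
  -- `√2 ≥ 7/5` exceeds the target rate `1` by `2/5`; this surplus pays for the power of `|x|`.
  have h := Real.pow_div_factorial_le_exp (2 / 5 * |x|) (by positivity) i
  rw [div_le_iff₀ (by positivity)] at h
  have h2 : |x| ^ i = (5 / 2) ^ i * (2 / 5 * |x|) ^ i := by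
    rw [← mul_pow]; congr 1; ring
  rw [h2]
  calc _ ≤ (5 / 2) ^ i * (Real.exp (2 / 5 * |x|) * i.factorial) * Real.exp (-√2 * |x|) := by gcongr
    _ = (5 / 2) ^ i * i.factorial * Real.exp (2 / 5 * |x| + -√2 * |x|) := by
        rw [Real.exp_add]; ring
    _ ≤ _ := by
        gcongr
        nlinarith [abs_nonneg x, sqrt_two_lb]

theorem abs_H01 (x : ℝ) : |H01 x| ≤ 1 := by rw [abs_of_pos (H01_pos x)]; exact H01_le_one x

theorem abs_rho (x : ℝ) : |rho x| ≤ 1 := by rw [abs_of_pos (rho_pos x)]; exact rho_le_one x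

theorem Hr_pow_bound (i : ℕ) : ∃ C, ∀ x, |x ^ i * (H01 x * rho x)| ≤ C * Real.exp (-|x|) :=
  ⟨_, fun x => by
    rw [abs_mul, abs_pow, abs_of_pos (mul_pos (H01_pos x) (rho_pos x))]
    exact (mul_le_mul_of_nonneg_left (H01_mul_rho_le x) (by positivity)).trans (pow_mul_exp_le i x)⟩

theorem Sy.bounded {a : ℝ → ℝ} (h : Sy a) : ∃ C, ∀ x, |a x| ≤ C := by
  induction h with
  | const c => exact ⟨|c|, fun _ => le_rfl⟩
  | H01 => exact ⟨1, abs_H01⟩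
  | rho => exact ⟨1, abs_rho⟩
  | om => exact ⟨1, fun x => by rw [abs_of_pos (om_pos x)]; exact om_le_one x⟩
  | powHr i =>
    obtain ⟨C, hC⟩ := Hr_pow_bound i
    refine ⟨C, fun x => ?_⟩
    have h0 := hC x
    have h1 : 0 ≤ C := nonneg_of_mul_nonneg_left ((abs_nonneg _).trans h0) (Real.exp_pos _)
    have h2 : Real.exp (-|x|) ≤ 1 := Real.exp_le_one_iff.2 (by simp)
    nlinarith
  | add _ _ h1 h2 =>
    obtain ⟨C, hC⟩ := h1
    obtain ⟨D, hD⟩ := h2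
    exact ⟨C + D, fun x => (abs_add_le _ _).trans (add_le_add (hC x) (hD x))⟩
  | mul _ _ h1 h2 =>
    obtain ⟨C, hC⟩ := h1
    obtain ⟨D, hD⟩ := h2
    exact ⟨C * D, fun x => by
      rw [abs_mul]
      exact mul_le_mul (hC x) (hD x) (abs_nonneg _) ((abs_nonneg _).trans (hC x))⟩

theorem De.bounded {a : ℝ → ℝ} (h : De a) : ∃ C, ∀ x, |a x| ≤ C * Real.exp (-|x|) := by
  induction h with
  | base i ha =>
    obtain ⟨C, hC⟩ := Hr_pow_bound i
    obtain ⟨D, hD⟩ := ha.bounded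
    exact ⟨C * D, fun x => by
      rw [abs_mul, mul_right_comm]
      exact mul_le_mul (hC x) (hD x) (abs_nonneg _) ((abs_nonneg _).trans (hC x))⟩
  | add _ _ h1 h2 =>
    obtain ⟨C, hC⟩ := h1
    obtain ⟨D, hD⟩ := h2
    exact ⟨C + D, fun x => by
      rw [add_mul]; exact (abs_add_le _ _).trans (add_le_add (hC x) (hD x))⟩

theorem sqrt_two_sq : √2 ^ 2 = (2 : ℝ) := Real.sq_sqrt (by norm_num)

theorem De.Hr_mul {a : ℝ → ℝ} (h : Sy a) : De fun x => H01 x * rho x * a x := De.Hr.mul_sy h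

theorem hasDerivAt_Hr (x : ℝ) : HasDerivAt (fun x => H01 x * rho x)
    (H01 x * rho x * (√2 * (rho x ^ 2 - H01 x ^ 2))) x := by
  refine ((hasDerivAt_H01 x).fun_mul (hasDerivAt_rho x)).congr_deriv ?_
  ring

/-- The derivative of each nonconstant generator carries the factor `H01 rho`, so differentiating a
merely bounded profile already produces decay. -/
theorem Sy.hasDeriv {a : ℝ → ℝ} (h : Sy a) : ∃ a', De a' ∧ ∀ x, HasDerivAt a (a' x) x := by
  have hr : Sy PhiSix.rho := Sy.rho
  have hH : Sy PhiSix.H01 := Sy.H01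
  induction h with
  | const c => exact ⟨_, De.Hr.const_mul 0, fun x => (hasDerivAt_const x c).congr_deriv (by simp)⟩
  | H01 => exact ⟨_, (De.Hr_mul hr).const_mul √2,
      fun x => (hasDerivAt_H01 x).congr_deriv (by ring)⟩
  | rho => exact ⟨_, (De.Hr_mul hH).const_mul (-√2),
      fun x => (hasDerivAt_rho x).congr_deriv (by ring)⟩
  | om => exact ⟨_, (De.Hr_mul (hH.mul (Sy.om.pow 2))).const_mul √2,
      fun x => (hasDerivAt_om x).congr_deriv (by ring)⟩
  -- For `i = 0` the truncated exponent `i - 1` is harmless, as its coefficient `i` vanishes.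
  | powHr i => exact ⟨_, ((De.Hr.pow_mul (i - 1)).const_mul i).add
      ((De.Hr_mul (((hr.pow 2).sub (hH.pow 2)).const_mul √2)).pow_mul i),
      fun x => ((hasDerivAt_pow i x).fun_mul (hasDerivAt_Hr x)).congr_deriv (by ring)⟩
  | add _ _ h1 h2 =>
    obtain ⟨a', ha, h1⟩ := h1
    obtain ⟨b', hb, h2⟩ := h2
    exact ⟨_, ha.add hb, fun x => (h1 x).fun_add (h2 x)⟩
  | mul s1 s2 h1 h2 =>
    obtain ⟨a', ha, h1⟩ := h1
    obtain ⟨b', hb, h2⟩ := h2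
    exact ⟨_, (ha.mul_sy s2).add (hb.mul_sy s1),
      fun x => ((h1 x).fun_mul (h2 x)).congr_deriv (by ring)⟩

/-- This inclusion is why `x^i H01 rho` is among the generators of `Sy`: powers of `x` are bounded
only together with this factor. -/
theorem De.sy {a : ℝ → ℝ} (h : De a) : Sy a := by
  induction h with
  | base i ha => exact (Sy.powHr i).mul ha
  | add _ _ h1 h2 => exact h1.add h2

theorem De.mul {a b : ℝ → ℝ} (h : De a) (hb : De b) : De fun x => a x * b x := h.mul_sy hb.sy

theorem De.hasDeriv {a : ℝ → ℝ} (h : De a) : ∃ a', De a' ∧ ∀ x, HasDerivAt a (a' x) x := by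
  induction h with
  | @base i a ha =>
    obtain ⟨a', ha', hd⟩ := ha.hasDeriv
    refine ⟨_, ((((De.Hr_mul ha).pow_mul (i - 1)).const_mul i).add
      ((De.Hr_mul ((((Sy.rho.pow 2).sub (Sy.H01.pow 2)).const_mul √2).mul ha)).pow_mul i)).add
      ((ha'.mul_sy (Sy.H01.mul Sy.rho)).pow_mul i), fun x => ?_⟩
    refine (((hasDerivAt_pow i x).fun_mul (hasDerivAt_Hr x)).fun_mul (hd x)).congr_deriv ?_
    ring
  | add _ _ h1 h2 =>
    obtain ⟨a', ha, h1⟩ := h1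
    obtain ⟨b', hb, h2⟩ := h2
    exact ⟨_, ha.add hb, fun x => (h1 x).fun_add (h2 x)⟩

theorem De.deriv {a : ℝ → ℝ} (h : De a) : De (deriv a) := by
  obtain ⟨a', ha, hd⟩ := h.hasDeriv
  exact ha.of_eq fun x => (hd x).deriv

theorem De.differentiable {a : ℝ → ℝ} (h : De a) : Differentiable ℝ a := by
  obtain ⟨a', ha, hd⟩ := h.hasDeriv
  exact fun x => (hd x).differentiableAt

theorem De_deriv_H01 : De (deriv H01) :=
  ((De.Hr_mul Sy.rho).const_mul √2).of_eq fun x => by rw [(hasDerivAt_H01 x).deriv]; ring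

/-- The symbol `G / (H01 rho)` has the form `Gs x + 2 √2 x rho x` -/
def Gs (x : ℝ) : ℝ := (1 + rho x + rho x ^ 2) * om x + k1 * rho x

theorem Sy_Gs : Sy Gs :=
  ((((Sy.const 1).add Sy.rho).add (Sy.rho.pow 2)).mul Sy.om).add (Sy.rho.const_mul k1)

theorem G_eq_Gs (x : ℝ) : G x = H01 x * rho x * Gs x + x * (H01 x * rho x) * (2 * √2 * rho x) := by
  rw [G_eq_profile, Gs]; ring

theorem De_G : De G :=
  ((De.Hr_mul Sy_Gs).add ((De.Hr_mul (Sy.rho.const_mul (2 * √2))).id_mul)).of_eq fun x => by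
    rw [G_eq_Gs]; ring

theorem Sy_G : Sy G := De_G.sy

theorem De_G' : De G' := De_G.deriv.of_eq fun x => (hasDerivAt_G x).deriv.symm

/-- The second derivative of `G`. -/
def G'' (x : ℝ) : ℝ := iteratedDeriv 2 U (H01 x) * G x - 8 * √2 * deriv H01 x
    + (24 * H01 x ^ 2 - 30 * H01 x ^ 4) * Real.exp (-(√2 * x))

theorem De_G'' : De G'' := De_G'.deriv.of_eq fun x => (hasDerivAt_G' x).deriv.symm

/-- The first derivative of `H01`. -/
def H' (x : ℝ) : ℝ := √2 * (H01 x * rho x ^ 2)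

theorem De_H' : De H' := De_deriv_H01.of_eq fun x => (hasDerivAt_H01 x).deriv.symm

/-- The static kink equation, obtained from the first-order equation `H' = √2 H (1 - H²)`. -/
theorem hasDerivAt_H' (x : ℝ) : HasDerivAt H' (deriv U (H01 x)) x := by
  have h := ((hasDerivAt_H01 x).fun_mul ((hasDerivAt_rho x).fun_pow 2)).const_mul √2
  refine h.congr_deriv ?_
  rw [deriv_U]
  have := rho_pos x
  have h1 := H01_sq_add x
  have h2 := sqrt_two_sq
  generalize (√2 : ℝ) = s at *
  generalize rho x = p at *
  generalize H01 x = q at *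
  norm_num
  grind

/-- The second derivative of `H01`. -/
def H'' (x : ℝ) : ℝ := deriv U (H01 x)

theorem De_H'' : De H'' := De_H'.deriv.of_eq fun x => (hasDerivAt_H' x).deriv.symm

theorem integrable_exp_neg_abs : Integrable (fun x : ℝ => Real.exp (-|x|)) := by
  rw [← integrableOn_univ, ← Set.Iic_union_Ioi (a := (0 : ℝ))]
  refine IntegrableOn.union ?_ ?_
  · refine (integrableOn_exp_mul_Iic one_pos 0).congr_fun (fun x hx => ?_) measurableSet_Iic
    simp [abs_of_nonpos (Set.mem_Iic.1 hx)]
  · refine (integrableOn_exp_mul_Ioi (a := -1) (by norm_num) 0).congr_fun (fun x hx => ?_)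
      measurableSet_Ioi
    simp [abs_of_pos (Set.mem_Ioi.1 hx)]

theorem De.continuous {a : ℝ → ℝ} (h : De a) : Continuous a := h.differentiable.continuous

theorem De.integrable {a : ℝ → ℝ} (h : De a) : Integrable a := by
  obtain ⟨C, hC⟩ := h.bounded
  exact (integrable_exp_neg_abs.const_mul C).mono' h.continuous.aestronglyMeasurable
    (ae_of_all _ hC)

/-! ### Functions of `(v, t)` with symbol-like bounds -/

/-- The range of speeds. -/
abbrev Sp : Set ℝ := Ioo 0 (1 / 2)

/-- The logarithmic factor `|t| v + ln (1 / v²)`. -/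
def Lg (v t : ℝ) : ℝ := |t| * v + Real.log (1 / v ^ 2)

/-- The exponential weight `e^{-2√2 |t| v}`. -/
def ew (v t : ℝ) : ℝ := Real.exp (-(2 * √2 * |t| * v))

/-- The weight `v^p Lg^n ew^k`. -/
def wt (n k p : ℕ) (v t : ℝ) : ℝ := v ^ p * Lg v t ^ n * ew v t ^ k

/-- `c = O(wt)`. -/
def Bd (n k p : ℕ) (c : ℝ → ℝ → ℝ) : Prop := ∃ C, ∀ v ∈ Sp, ∀ t, |c v t| ≤ C * wt n k p v t

/-- Symbol bounds for `l` time derivatives, each of which gains a factor `v`. -/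
def Sb (n k : ℕ) : ℕ → ℕ → (ℝ → ℝ → ℝ) → Prop
  | 0, p, c => Bd n k p c
  | l + 1, p, c => Bd n k p c ∧ ∃ c' : ℝ → ℝ → ℝ,
      (∀ v ∈ Sp, ∀ t, HasDerivAt (c v) (c' v t) t) ∧ Sb n k l (p + 1) c'

/-- Symbol bounds for all time derivatives. -/
def SB (n k p : ℕ) (c : ℝ → ℝ → ℝ) : Prop := ∀ l, Sb n k l p c

theorem one_le_log_Sp {v : ℝ} (hv : v ∈ Sp) : 1 ≤ Real.log (1 / v ^ 2) := by
  have h1 : (4 : ℝ) ≤ 1 / v ^ 2 := by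
    rw [le_div_iff₀ (pow_pos hv.1 2)]; nlinarith [hv.1, hv.2]
  have h2 : Real.log 4 ≤ Real.log (1 / v ^ 2) := Real.log_le_log (by norm_num) h1
  have h3 : Real.log 4 = 2 * Real.log 2 := by
    rw [show (4 : ℝ) = 2 ^ 2 by norm_num, Real.log_pow]; norm_num
  linarith [Real.log_two_gt_d9]

theorem one_le_Lg {v : ℝ} (hv : v ∈ Sp) (t : ℝ) : 1 ≤ Lg v t := by
  have := one_le_log_Sp hv
  have : 0 ≤ |t| * v := mul_nonneg (abs_nonneg t) hv.1.le
  unfold Lg; linarith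

theorem ew_pos (v t : ℝ) : 0 < ew v t := Real.exp_pos _

theorem ew_le_one {v : ℝ} (hv : v ∈ Sp) (t : ℝ) : ew v t ≤ 1 := by
  have := hv.1
  exact Real.exp_le_one_iff.2 (by simp; positivity)

theorem wt_pos {v : ℝ} (hv : v ∈ Sp) (n k p : ℕ) (t : ℝ) : 0 < wt n k p v t :=
  mul_pos (mul_pos (pow_pos hv.1 _) (pow_pos (zero_lt_one.trans_le (one_le_Lg hv t)) _))
    (pow_pos (ew_pos v t) _)

theorem wt_mul (n k p n' k' p' : ℕ) (v t : ℝ) :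
    wt n k p v t * wt n' k' p' v t = wt (n + n') (k + k') (p + p') v t := by
  unfold wt; ring

theorem wt_mono {v : ℝ} (hv : v ∈ Sp) (t : ℝ) {n k p n' k' p' : ℕ} (hn : n ≤ n') (hk : k' ≤ k)
    (hp : p' ≤ p) : wt n k p v t ≤ wt n' k' p' v t := by
  have h1 := one_le_Lg hv t
  have h2 := (ew_pos v t).le
  have h3 : v ^ p ≤ v ^ p' := pow_le_pow_of_le_one hv.1.le (by linarith [hv.2]) hp
  have h4 : Lg v t ^ n ≤ Lg v t ^ n' := pow_le_pow_right₀ h1 hn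
  have h5 : ew v t ^ k ≤ ew v t ^ k' := pow_le_pow_of_le_one h2 (ew_le_one hv t) hk
  have := hv.1
  unfold wt; gcongr

theorem Bd.exists_nonneg {n k p : ℕ} {c : ℝ → ℝ → ℝ} (h : Bd n k p c) :
    ∃ C, 0 ≤ C ∧ ∀ v ∈ Sp, ∀ t, |c v t| ≤ C * wt n k p v t := by
  obtain ⟨C, hC⟩ := h
  exact ⟨|C|, abs_nonneg C, fun v hv t => (hC v hv t).trans
    (mul_le_mul_of_nonneg_right (le_abs_self C) (wt_pos hv _ _ _ t).le)⟩

theorem Bd.mono {n k p n' k' p' : ℕ} {c : ℝ → ℝ → ℝ} (h : Bd n k p c) (hn : n ≤ n') (hk : k' ≤ k)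
    (hp : p' ≤ p) : Bd n' k' p' c := by
  obtain ⟨C, h0, hC⟩ := h.exists_nonneg
  exact ⟨C, fun v hv t => (hC v hv t).trans
    (mul_le_mul_of_nonneg_left (wt_mono hv t hn hk hp) h0)⟩

theorem Bd.add {n k p : ℕ} {a b : ℝ → ℝ → ℝ} (ha : Bd n k p a) (hb : Bd n k p b) :
    Bd n k p fun v t => a v t + b v t := by
  obtain ⟨C, hC⟩ := ha
  obtain ⟨D, hD⟩ := hb
  exact ⟨C + D, fun v hv t => by
    rw [add_mul]; exact (abs_add_le _ _).trans (add_le_add (hC v hv t) (hD v hv t))⟩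

theorem Bd.mul {n k p n' k' p' : ℕ} {a b : ℝ → ℝ → ℝ} (ha : Bd n k p a) (hb : Bd n' k' p' b) :
    Bd (n + n') (k + k') (p + p') fun v t => a v t * b v t := by
  obtain ⟨C, hC⟩ := ha
  obtain ⟨D, hD⟩ := hb
  exact ⟨C * D, fun v hv t => by
    rw [abs_mul, ← wt_mul, mul_mul_mul_comm]
    exact mul_le_mul (hC v hv t) (hD v hv t) (abs_nonneg _) ((abs_nonneg _).trans (hC v hv t))⟩

theorem Sb.mono {n k n' k' : ℕ} (hn : n ≤ n') (hk : k' ≤ k) {l : ℕ} :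
    ∀ {p p' : ℕ} {c : ℝ → ℝ → ℝ}, Sb n k l p c → p' ≤ p → Sb n' k' l p' c := by
  induction l with
  | zero => exact fun h hp => Bd.mono h hn hk hp
  | succ l ih =>
    rintro p p' c ⟨hb, c', hd, hc⟩ hp
    exact ⟨hb.mono hn hk hp, c', hd, ih hc (by omega)⟩

theorem Sb.down {n k l : ℕ} : ∀ {p : ℕ} {c : ℝ → ℝ → ℝ}, Sb n k (l + 1) p c → Sb n k l p c := by
  induction l with
  | zero => exact fun h => h.1
  | succ l ih =>
    rintro p c ⟨hb, c', hd, hc⟩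
    exact ⟨hb, c', hd, ih hc⟩

theorem Sb.add {n k l : ℕ} : ∀ {p : ℕ} {a b : ℝ → ℝ → ℝ}, Sb n k l p a → Sb n k l p b →
    Sb n k l p fun v t => a v t + b v t := by
  induction l with
  | zero => exact fun h h' => Bd.add h h'
  | succ l ih =>
    rintro p a b ⟨ha, a', hda, ha'⟩ ⟨hb, b', hdb, hb'⟩
    exact ⟨ha.add hb, _, fun v hv t => (hda v hv t).fun_add (hdb v hv t), ih ha' hb'⟩

/-- Leibniz rule: a derivative falls on one factor only, so the product gains exactly one power of
`v`. The other factor is used with one derivative fewer, through `Sb.down`. -/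
theorem Sb.mul {n k n' k' l : ℕ} : ∀ {p p' : ℕ} {a b : ℝ → ℝ → ℝ}, Sb n k l p a → Sb n' k' l p' b →
    Sb (n + n') (k + k') l (p + p') fun v t => a v t * b v t := by
  induction l with
  | zero => exact fun h h' => Bd.mul h h'
  | succ l ih =>
    rintro p p' a b h h'
    obtain ⟨ha, a', hda, ha'⟩ := id h
    obtain ⟨hb, b', hdb, hb'⟩ := id h'
    refine ⟨ha.mul hb, _, fun v hv t => (hda v hv t).fun_mul (hdb v hv t), Sb.add ?_ ?_⟩
    · have := ih ha' h'.down
      rwa [show p + 1 + p' = p + p' + 1 by omega] at this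
    · have := ih h.down hb'
      rwa [show p + (p' + 1) = p + p' + 1 by omega] at this

theorem Sb.congr {n k l p : ℕ} {a b : ℝ → ℝ → ℝ} (h : Sb n k l p a)
    (e : ∀ v ∈ Sp, ∀ t, b v t = a v t) : Sb n k l p b := by
  have hb (h : Bd n k p a) : Bd n k p b := by
    obtain ⟨C, hC⟩ := h
    exact ⟨C, fun v hv t => by rw [e v hv t]; exact hC v hv t⟩
  cases l with
  | zero => exact hb h
  | succ l =>
    obtain ⟨ha, a', hda, ha'⟩ := h
    refine ⟨hb ha, a', fun v hv t => ?_, ha'⟩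
    rw [show b v = a v from funext (e v hv)]; exact hda v hv t

theorem Bd.const (c : ℝ) : Bd 0 0 0 fun _ _ => c := ⟨|c|, fun v _ t => by simp [wt]⟩

theorem Sb.zero {n k l : ℕ} : ∀ {p : ℕ}, Sb n k l p fun _ _ => 0 := by
  have hb (p : ℕ) : Bd n k p fun _ _ => 0 := ⟨0, fun v _ t => by simp⟩
  induction l with
  | zero => exact hb _
  | succ l ih => exact ⟨hb _, _, fun v _ t => hasDerivAt_const t 0, ih⟩

theorem SB.const (c : ℝ) : SB 0 0 0 fun _ _ => c := fun l => by
  cases l with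
  | zero => exact Bd.const c
  | succ l => exact ⟨Bd.const c, _, fun v _ t => hasDerivAt_const t c, Sb.zero⟩

theorem SB.vpow (p : ℕ) : SB 0 0 p fun v _ => v ^ p := fun l => by
  have hb : Bd 0 0 p fun v _ => v ^ p :=
    ⟨1, fun v hv t => by simp [wt, abs_of_pos hv.1]⟩
  cases l with
  | zero => exact hb
  | succ l => exact ⟨hb, _, fun v _ t => hasDerivAt_const t _, Sb.zero⟩

/-- From `Lg^n ≤ n! e^{Lg}` and `e^{Lg} = e^{|t| v} / v²`: the weight `ew` beats `e^{|t| v}` and the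
prefactor `v²` pays for the denominator. Hence two powers of `v` and one weight buy off any power of
`Lg`. -/
theorem factorial_absorb {v : ℝ} (hv : v ∈ Sp) (n : ℕ) (t : ℝ) :
    v ^ 2 * Lg v t ^ n * ew v t ≤ n.factorial := by
  have h0 := hv.1
  have h1 := Real.pow_div_factorial_le_exp (Lg v t) (by linarith [one_le_Lg hv t]) n
  rw [div_le_iff₀ (by positivity)] at h1
  have h2 : Real.exp (Lg v t) = Real.exp (|t| * v) / v ^ 2 := by
    rw [Lg, Real.exp_add, Real.exp_log (by positivity)]; ring
  have h3 : Real.exp (|t| * v) * ew v t ≤ 1 := by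
    rw [ew, ← Real.exp_add, Real.exp_le_one_iff]
    have : 0 ≤ |t| * v := by positivity
    nlinarith [sqrt_two_lb]
  have h4 := ew_pos v t
  calc v ^ 2 * Lg v t ^ n * ew v t
      ≤ v ^ 2 * (Real.exp (Lg v t) * n.factorial) * ew v t := by gcongr
    _ = (Real.exp (|t| * v) * ew v t) * n.factorial := by rw [h2]; field_simp
    _ ≤ 1 * n.factorial := by gcongr
    _ = _ := one_mul _

theorem Bd.absorb {n p : ℕ} {c : ℝ → ℝ → ℝ} (h : Bd n 1 (p + 2) c) : Bd 0 0 p c := by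
  obtain ⟨C, h0, hC⟩ := h.exists_nonneg
  refine ⟨C * n.factorial, fun v hv t => (hC v hv t).trans ?_⟩
  have := pow_pos hv.1 p
  calc C * wt n 1 (p + 2) v t = C * (v ^ p * (v ^ 2 * Lg v t ^ n * ew v t)) := by unfold wt; ring
    _ ≤ C * (v ^ p * n.factorial) := by gcongr; exact factorial_absorb hv n t
    _ = _ := by unfold wt; ring

theorem Sb.absorb {n l : ℕ} : ∀ {p : ℕ} {c : ℝ → ℝ → ℝ}, Sb n 1 l (p + 2) c → Sb 0 0 l p c := by
  induction l with
  | zero => exact fun h => Bd.absorb h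
  | succ l ih =>
    rintro p c ⟨hb, c', hd, hc⟩
    refine ⟨hb.absorb, c', hd, ih ?_⟩
    rwa [show p + 1 + 2 = p + 2 + 1 by omega]

theorem SB.bd {n k p : ℕ} {c : ℝ → ℝ → ℝ} (h : SB n k p c) : Bd n k p c := h 0

theorem SB.mono {n k n' k' p p' : ℕ} {c : ℝ → ℝ → ℝ} (h : SB n k p c) (hn : n ≤ n') (hk : k' ≤ k)
    (hp : p' ≤ p) : SB n' k' p' c := fun l => (h l).mono hn hk hp

theorem SB.add {n k p : ℕ} {a b : ℝ → ℝ → ℝ} (ha : SB n k p a) (hb : SB n k p b) :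
    SB n k p fun v t => a v t + b v t := fun l => (ha l).add (hb l)

theorem SB.mul {n k p n' k' p' : ℕ} {a b : ℝ → ℝ → ℝ} (ha : SB n k p a) (hb : SB n' k' p' b) :
    SB (n + n') (k + k') (p + p') fun v t => a v t * b v t := fun l => (ha l).mul (hb l)

theorem SB.congr {n k p : ℕ} {a b : ℝ → ℝ → ℝ} (h : SB n k p a)
    (e : ∀ v ∈ Sp, ∀ t, b v t = a v t) : SB n k p b := fun l => (h l).congr e

theorem SB.absorb {n p : ℕ} {c : ℝ → ℝ → ℝ} (h : SB n 1 (p + 2) c) : SB 0 0 p c :=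
  fun l => (h l).absorb

theorem Sb.const_mul {n k l p : ℕ} {a : ℝ → ℝ → ℝ} (h : Sb n k l p a) (c : ℝ) :
    Sb n k l p fun v t => c * a v t := by
  have := (SB.const c l).mul h
  simpa using this

theorem SB.const_mul {n k p : ℕ} {a : ℝ → ℝ → ℝ} (h : SB n k p a) (c : ℝ) :
    SB n k p fun v t => c * a v t := fun l => (h l).const_mul c

theorem SB.sub {n k p : ℕ} {a b : ℝ → ℝ → ℝ} (ha : SB n k p a) (hb : SB n k p b) :
    SB n k p fun v t => a v t - b v t := (ha.add (hb.const_mul (-1))).congr fun v _ t => by ring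

/-- The class is preserved under multiplication by functions of class `SB 0 0 0`. -/
theorem SB.mul_left {n k p : ℕ} {a b : ℝ → ℝ → ℝ} (ha : SB 0 0 0 a) (hb : SB n k p b) :
    SB n k p fun v t => a v t * b v t := by
  have := ha.mul hb
  simpa using this

theorem SB.intro {n k p : ℕ} {c c' : ℝ → ℝ → ℝ} (hb : Bd n k p c)
    (hd : ∀ v ∈ Sp, ∀ t, HasDerivAt (c v) (c' v t) t) (hc : SB n k (p + 1) c') : SB n k p c := by
  intro l
  cases l with
  | zero => exact hb
  | succ l => exact ⟨hb, c', hd, hc l⟩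

/-- The hypothesis supplies a possibly different `c'` for every order `l`; they agree on `Sp` by
uniqueness of derivatives, so one of them serves for all orders. -/
theorem SB.hasDeriv {n k p : ℕ} {c : ℝ → ℝ → ℝ} (h : SB n k p c) : ∃ c' : ℝ → ℝ → ℝ,
    (∀ v ∈ Sp, ∀ t, HasDerivAt (c v) (c' v t) t) ∧ SB n k (p + 1) c' := by
  obtain ⟨_, c', hd, _⟩ := h 1
  refine ⟨c', hd, fun l => ?_⟩
  obtain ⟨_, c2, hd2, hc2⟩ := h (l + 1)
  exact hc2.congr fun v hv t => (hd v hv t).unique (hd2 v hv t)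

theorem SB.of_hasDeriv {n k p : ℕ} {c c' : ℝ → ℝ → ℝ} (h : SB n k p c)
    (hd : ∀ v ∈ Sp, ∀ t, HasDerivAt (c v) (c' v t) t) : SB n k (p + 1) c' := by
  obtain ⟨c2, hd2, h2⟩ := h.hasDeriv
  exact h2.congr fun v hv t => (hd v hv t).unique (hd2 v hv t)

theorem SB.contDiff {n k p : ℕ} {c : ℝ → ℝ → ℝ} (h : SB n k p c) {v : ℝ} (hv : v ∈ Sp) :
    ContDiff ℝ ∞ (c v) := by
  have key : ∀ (l : ℕ) (p : ℕ) (c : ℝ → ℝ → ℝ), SB n k p c → ContDiff ℝ l (c v) := by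
    intro l
    induction l with
    | zero =>
      intro p c h
      obtain ⟨c', hd, _⟩ := h.hasDeriv
      exact contDiff_zero.2 (continuous_iff_continuousAt.2 fun t => (hd v hv t).continuousAt)
    | succ l ih =>
      intro p c h
      obtain ⟨c', hd, hc⟩ := h.hasDeriv
      have e : deriv (c v) = c' v := funext fun t => (hd v hv t).deriv
      push_cast
      refine contDiff_succ_iff_deriv.2 ⟨fun t => (hd v hv t).differentiableAt, by simp, ?_⟩
      rw [e]; exact ih _ _ hc
  exact contDiff_infty.2 fun l => key l p c h

/-! ### The coefficient functions of the soliton trajectory -/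

/-- `tanh (√2 v t)`. -/
def th (v t : ℝ) : ℝ := Real.tanh (√2 * v * t)

/-- `sech² (√2 v t)`. -/
def sg (v t : ℝ) : ℝ := 1 - th v t ^ 2

/-- The Lorentz factor `γ_v`. -/
def ga (v t : ℝ) : ℝ := 1 / √(1 - v ^ 2 * th v t ^ 2)

/-- `e^{-√2 d_v}`. -/
def ep (v t : ℝ) : ℝ := Real.exp (-(√2 * d v t))

theorem th_eq (v t : ℝ) :
    th v t = Real.sinh (√2 * v * t) / Real.cosh (√2 * v * t) := Real.tanh_eq_sinh_div_cosh _

theorem sg_eq (v t : ℝ) : sg v t = 1 / Real.cosh (√2 * v * t) ^ 2 := by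
  have h := Real.cosh_pos (√2 * v * t)
  rw [sg, th_eq]
  field_simp
  linarith [Real.cosh_sq (√2 * v * t)]

theorem sg_pos (v t : ℝ) : 0 < sg v t := by
  have := Real.cosh_pos (√2 * v * t)
  rw [sg_eq]; positivity

theorem th_sq_lt_one (v t : ℝ) : th v t ^ 2 < 1 := by
  have := sg_pos v t
  unfold sg at this; linarith

theorem abs_th_le_one (v t : ℝ) : |th v t| ≤ 1 :=
  abs_le_one_iff_mul_self_le_one.2 (by nlinarith [th_sq_lt_one v t])

theorem hasDerivAt_mul_const' (a t : ℝ) : HasDerivAt (fun t => a * t) a t := by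
  simpa using (hasDerivAt_id t).const_mul a

theorem hasDerivAt_th (v t : ℝ) : HasDerivAt (th v) (√2 * v * sg v t) t := by
  have hl := hasDerivAt_mul_const' (√2 * v) t
  have h := Real.cosh_pos (√2 * v * t)
  have h2 := (hl.sinh).fun_div (hl.cosh) h.ne'
  rw [show th v = fun t => Real.sinh (√2 * v * t) / Real.cosh (√2 * v * t) from funext (th_eq v)]
  refine h2.congr_deriv ?_
  rw [sg_eq]
  field_simp
  linear_combination v * Real.cosh_sq (√2 * v * t)

theorem hasDerivAt_sg (v t : ℝ) : HasDerivAt (sg v) (-(2 * √2) * v * (th v t * sg v t)) t := by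
  refine (((hasDerivAt_th v t).fun_pow 2).const_sub 1).congr_deriv ?_
  norm_num; ring

theorem exp_le_two_cosh (x : ℝ) : Real.exp |x| ≤ 2 * Real.cosh x := by
  rw [Real.cosh_eq]; linarith [Real.exp_abs_le x]

theorem sg_le (v t : ℝ) (hv : 0 < v) : sg v t ≤ 4 * ew v t := by
  have h := exp_le_two_cosh (√2 * v * t)
  have h1 := Real.cosh_pos (√2 * v * t)
  rw [sg_eq, div_le_iff₀ (by positivity)]
  have h2 : ew v t * Real.exp |√2 * v * t| ^ 2 = 1 := by
    rw [ew, ← Real.exp_nat_mul, ← Real.exp_add, abs_mul, abs_mul, abs_of_pos hv,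
      abs_of_pos (show (0 : ℝ) < √2 by positivity), Real.exp_eq_one_iff]
    push_cast; ring
  have h3 := ew_pos v t
  calc (1 : ℝ) = ew v t * Real.exp |√2 * v * t| ^ 2 := h2.symm
    _ ≤ ew v t * (2 * Real.cosh (√2 * v * t)) ^ 2 := by gcongr
    _ = _ := by ring

theorem d_eq (v t : ℝ) (hv : 0 < v) : d v t =
    1 / √2 * (Real.log (8 / v ^ 2) + 2 * Real.log (Real.cosh (√2 * v * t))) := by
  have h := Real.cosh_pos (√2 * v * t)
  rw [d, Real.log_mul (by positivity) (by positivity), Real.log_pow]; norm_num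

theorem sqrt_two_mul_d (v t : ℝ) (hv : 0 < v) : √2 * d v t =
    Real.log (8 / v ^ 2) + 2 * Real.log (Real.cosh (√2 * v * t)) := by
  rw [d_eq v t hv]; field_simp

theorem hasDerivAt_d (v t : ℝ) (hv : 0 < v) : HasDerivAt (d v) (2 * v * th v t) t := by
  have hl := hasDerivAt_mul_const' (√2 * v) t
  have h := Real.cosh_pos (√2 * v * t)
  have h2 := (((hl.cosh).log h.ne').const_mul 2).const_add (Real.log (8 / v ^ 2))
    |>.const_mul (1 / √2)
  rw [show d v = _ from funext fun t => d_eq v t hv]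
  refine h2.congr_deriv ?_
  rw [th_eq]; field_simp

theorem deriv_d (v t : ℝ) (hv : 0 < v) : deriv (d v) t = 2 * v * th v t := (hasDerivAt_d v t hv).deriv

theorem contr_eq (v t : ℝ) (hv : 0 < v) : contr v t = √(1 - v ^ 2 * th v t ^ 2) := by
  rw [contr, deriv_d v t hv]; congr 1; ring

theorem three_quarters_le {v : ℝ} (hv : v ∈ Sp) (t : ℝ) : 3 / 4 ≤ 1 - v ^ 2 * th v t ^ 2 := by
  have h1 := th_sq_lt_one v t
  have h2 : v ^ 2 ≤ 1 / 4 := by nlinarith [hv.1, hv.2]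
  nlinarith [sq_nonneg (th v t), sq_nonneg v]

theorem ga_pos {v : ℝ} (hv : v ∈ Sp) (t : ℝ) : 0 < ga v t := by
  have := three_quarters_le hv t
  have : 0 < 1 - v ^ 2 * th v t ^ 2 := by linarith
  unfold ga; positivity

theorem ga_sq {v : ℝ} (hv : v ∈ Sp) (t : ℝ) : ga v t ^ 2 * (1 - v ^ 2 * th v t ^ 2) = 1 := by
  have := three_quarters_le hv t
  have h : 0 < 1 - v ^ 2 * th v t ^ 2 := by linarith
  rw [ga, div_pow, Real.sq_sqrt h.le]; field_simp

theorem ga_contr {v : ℝ} (hv : v ∈ Sp) (t : ℝ) : contr v t = 1 / ga v t := by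
  rw [contr_eq v t hv.1, ga, one_div_one_div]

theorem one_le_ga {v : ℝ} (hv : v ∈ Sp) (t : ℝ) : 1 ≤ ga v t := by
  have h1 := ga_sq hv t
  have h2 := ga_pos hv t
  by_contra! h
  nlinarith [three_quarters_le hv t, mul_nonneg (sq_nonneg v) (sq_nonneg (th v t))]

theorem ga_sub_one_le {v : ℝ} (hv : v ∈ Sp) (t : ℝ) : ga v t - 1 ≤ v ^ 2 := by
  have h1 := ga_sq hv t
  have h2 := one_le_ga hv t
  have h3 := th_sq_lt_one v t
  have h5 : ga v t ≤ 2 := by nlinarith [three_quarters_le hv t]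
  have h4 : ga v t ^ 2 ≤ 4 / 3 := by nlinarith [three_quarters_le hv t]
  have h6 : ga v t ^ 2 - 1 ≤ 4 / 3 * v ^ 2 := by
    have : ga v t ^ 2 - 1 = v ^ 2 * (th v t ^ 2 * ga v t ^ 2) := by linarith
    rw [this, mul_comm (4 / 3 : ℝ)]
    gcongr
    nlinarith [sq_nonneg (th v t), sq_nonneg (ga v t)]
  nlinarith [sq_nonneg v]

theorem ga_le_two {v : ℝ} (hv : v ∈ Sp) (t : ℝ) : ga v t ≤ 2 := by
  nlinarith [ga_sub_one_le hv t, hv.1, hv.2]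

theorem hasDerivAt_ga {v : ℝ} (hv : v ∈ Sp) (t : ℝ) :
    HasDerivAt (ga v) (√2 * v ^ 3 * (ga v t ^ 3 * (th v t * sg v t))) t := by
  have h3 := three_quarters_le hv t
  have h : 0 < 1 - v ^ 2 * th v t ^ 2 := by linarith
  have h1 := ((((hasDerivAt_th v t).fun_pow 2).const_mul (v ^ 2)).const_sub 1).sqrt h.ne'
  have h2 := (hasDerivAt_const t (1 : ℝ)).fun_div h1 (by positivity)
  refine h2.congr_deriv ?_
  have hs : √(1 - v ^ 2 * th v t ^ 2) ≠ 0 := by positivity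
  have e : ga v t = 1 / √(1 - v ^ 2 * th v t ^ 2) := rfl
  rw [e]
  field_simp
  norm_num
  ring

/-- This links the trajectory to the interaction: `8√2 ep = √2 v² sg` balances acceleration and
force, and `32 ep = 4 v² sg` makes the modulation equation explicitly solvable. -/
theorem ep_eq (v t : ℝ) (hv : 0 < v) : ep v t = v ^ 2 * (sg v t / 8) := by
  have h := Real.cosh_pos (√2 * v * t)
  rw [ep, sqrt_two_mul_d v t hv, sg_eq, neg_add, Real.exp_add, ← neg_mul, mul_comm (-2 : ℝ),
    Real.exp_mul, Real.exp_log h, Real.exp_neg, Real.exp_log (by positivity),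
    show (-2 : ℝ) = -(2 : ℕ) by norm_num, Real.rpow_neg h.le, Real.rpow_natCast]
  field_simp

/-- The induction closes because `th' = √2 v (1 - th²)` is `v` times a polynomial in `th`. The same
mechanism serves `sg` and `ga`. -/
theorem Sb_th (l : ℕ) : Sb 0 0 l 0 th := by
  have hb : Bd 0 0 0 th := ⟨1, fun v _ t => by simpa [wt] using abs_th_le_one v t⟩
  induction l with
  | zero => exact hb
  | succ l ih =>
    refine ⟨hb, fun v t => √2 * (v ^ 1 * (1 + (-1) * (th v t * th v t))), fun v hv t => ?_, ?_⟩
    · refine (hasDerivAt_th v t).congr_deriv ?_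
      rw [sg]; ring
    · have h := (SB.const 1 l).add ((ih.mul ih).const_mul (-1))
      have h2 := ((SB.vpow 1 l).mul h).const_mul √2
      simpa using h2

theorem SB_th : SB 0 0 0 th := Sb_th

theorem Bd_sg : Bd 0 1 0 sg := ⟨4, fun v hv t => by
  rw [abs_of_pos (sg_pos v t)]; simpa [wt] using sg_le v t hv.1⟩

theorem SB_sg : SB 0 1 0 sg := by
  intro l
  induction l with
  | zero => exact Bd_sg
  | succ l ih =>
    refine ⟨Bd_sg, fun v t => (-(2 * √2)) * (v ^ 1 * (th v t * sg v t)), fun v hv t => ?_, ?_⟩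
    · exact (hasDerivAt_sg v t).congr_deriv (by ring)
    · have h2 := ((SB.vpow 1 l).mul ((Sb_th l).mul ih)).const_mul (-(2 * √2))
      simpa using h2

theorem SB_ga : SB 0 0 0 ga := by
  have hb : Bd 0 0 0 ga := ⟨2, fun v hv t => by
    rw [abs_of_pos (ga_pos hv t)]; simpa [wt] using ga_le_two hv t⟩
  intro l
  induction l with
  | zero => exact hb
  | succ l ih =>
    refine ⟨hb, fun v t => √2 * (v ^ 3 * ((ga v t * (ga v t * ga v t)) * (th v t * sg v t))),
      fun v hv t => ?_, ?_⟩
    · exact (hasDerivAt_ga hv t).congr_deriv (by ring)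
    · have h2 := ((SB.vpow 3 l).mul ((ih.mul (ih.mul ih)).mul
        ((Sb_th l).mul (SB_sg l)))).const_mul √2
      exact h2.mono (by simp) (by simp) (by simp)

theorem SB_one_sub_ga : SB 0 0 2 fun v t => 1 - ga v t := by
  refine SB.intro (c' := fun v t => (-√2) * (v ^ 3 * ((ga v t * (ga v t * ga v t)) *
    (th v t * sg v t)))) ⟨1, fun v hv t => ?_⟩ (fun v hv t => ?_) ?_
  · rw [abs_sub_comm, abs_of_nonneg (by linarith [one_le_ga hv t])]
    simpa [wt] using ga_sub_one_le hv t
  · exact ((hasDerivAt_ga hv t).const_sub 1).congr_deriv (by ring)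
  · have h2 := ((SB.vpow 3).mul ((SB_ga.mul (SB_ga.mul SB_ga)).mul
        (SB_th.mul SB_sg))).const_mul (-√2)
    exact h2.mono (by simp) (by simp) (by simp)

theorem SB_inv_ga : SB 0 0 0 fun v t => 1 / ga v t := by
  have h : SB 0 0 0 fun v t => ga v t * (1 - v ^ 2 * th v t ^ 2) := by
    have := SB_ga.mul ((SB.const 1).sub (((SB.vpow 2).mul (SB_th.mul SB_th)).mono
      (n' := 0) (k' := 0) (p' := 0) (by simp) (by simp) (by simp)))
    exact this.congr fun v _ t => by ring
  refine h.congr fun v hv t => ?_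
  have := ga_pos hv t
  field_simp
  linarith [ga_sq hv t]

theorem log_cosh_nonneg (x : ℝ) : 0 ≤ Real.log (Real.cosh x) := Real.log_nonneg (Real.one_le_cosh x)

theorem log_cosh_le (x : ℝ) : Real.log (Real.cosh x) ≤ |x| := by
  rw [Real.log_le_iff_le_exp (Real.cosh_pos x), Real.cosh_eq]
  have h1 : Real.exp x ≤ Real.exp |x| := Real.exp_le_exp.2 (le_abs_self x)
  have h2 : Real.exp (-x) ≤ Real.exp |x| := Real.exp_le_exp.2 (neg_le_abs x)
  linarith

theorem d_pos {v : ℝ} (hv : v ∈ Sp) (t : ℝ) : 0 < d v t := by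
  have h0 := log_cosh_nonneg (√2 * v * t)
  have h1 : 0 < Real.log (8 / v ^ 2) := by
    apply Real.log_pos
    rw [lt_div_iff₀ (pow_pos hv.1 2)]; nlinarith [hv.1, hv.2]
  rw [d_eq v t hv.1]; positivity

theorem d_le {v : ℝ} (hv : v ∈ Sp) (t : ℝ) : d v t ≤ 20 * Lg v t := by
  have h1 := one_le_Lg hv t
  have hv0 := hv.1
  have h2 : Real.log (8 / v ^ 2) = Real.log 8 + Real.log (1 / v ^ 2) := by
    rw [← Real.log_mul (by norm_num) (by positivity)]; congr 1; ring
  have h3 : Real.log 8 ≤ 7 := by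
    have := Real.log_le_sub_one_of_pos (show (0 : ℝ) < 8 by norm_num)
    linarith
  have h4 := log_cosh_le (√2 * v * t)
  have h5 : |√2 * v * t| = √2 * (|t| * v) := by
    rw [abs_mul, abs_mul, abs_of_pos hv.1, abs_of_pos (show (0 : ℝ) < √2 by positivity)]; ring
  have h6 : d v t ≤ √2 * d v t := by nlinarith [sqrt_two_lb, d_pos hv t]
  rw [sqrt_two_mul_d v t hv.1, h2] at h6
  have h7 : 0 ≤ |t| * v := by positivity
  have h8 := one_le_log_Sp hv
  unfold Lg at *
  nlinarith [sqrt_two_ub]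

theorem SB_d : SB 1 0 0 d := by
  refine SB.intro (c' := fun v t => 2 * (v ^ 1 * th v t)) ⟨20, fun v hv t => ?_⟩
    (fun v hv t => ?_) ?_
  · rw [abs_of_pos (d_pos hv t)]; simpa [wt] using d_le hv t
  · exact (hasDerivAt_d v t hv.1).congr_deriv (by ring)
  · exact (((SB.vpow 1).mul SB_th).const_mul 2).mono (by simp) (by simp) (by simp)

theorem SB_ep : SB 0 1 2 ep :=
  (((SB.vpow 2).mul SB_sg).const_mul (1 / 8)).congr (fun v hv t => by rw [ep_eq v t hv.1]; ring)

/-! ### The wave operator on moving profiles -/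

/-- `b = ∂ₜ² φ - ∂ₓ² φ`, with all derivatives involved existing. -/
def HasBox (φ b : ℝ → ℝ → ℝ) : Prop := ∃ pt ptt px pxx : ℝ → ℝ → ℝ,
  (∀ t x, HasDerivAt (fun τ => φ τ x) (pt t x) t) ∧ (∀ t x, HasDerivAt (fun τ => pt τ x) (ptt t x) t) ∧
  (∀ t x, HasDerivAt (fun y => φ t y) (px t x) x) ∧ (∀ t x, HasDerivAt (fun y => px t y) (pxx t x) x) ∧
  ∀ t x, ptt t x - pxx t x = b t x

theorem iteratedDeriv_two_eq {f f' : ℝ → ℝ} {a : ℝ} {x : ℝ} (h : ∀ x, HasDerivAt f (f' x) x)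
    (h' : HasDerivAt f' a x) : iteratedDeriv 2 f x = a := by
  rw [iteratedDeriv_succ, iteratedDeriv_one, show deriv f = f' from funext fun x => (h x).deriv,
    h'.deriv]

theorem HasBox.box_eq {φ b : ℝ → ℝ → ℝ} (h : HasBox φ b) (t x : ℝ) : box φ t x = b t x := by
  obtain ⟨pt, ptt, px, pxx, h1, h2, h3, h4, h5⟩ := h
  rw [box, iteratedDeriv_two_eq (fun t => h1 t x) (h2 t x),
    iteratedDeriv_two_eq (fun x => h3 t x) (h4 t x), h5]

theorem HasBox.add {φ b ψ c : ℝ → ℝ → ℝ} (h : HasBox φ b) (h' : HasBox ψ c) :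
    HasBox (fun t x => φ t x + ψ t x) fun t x => b t x + c t x := by
  obtain ⟨pt, ptt, px, pxx, h1, h2, h3, h4, h5⟩ := h
  obtain ⟨qt, qtt, qx, qxx, k1, k2, k3, k4, k5⟩ := h'
  exact ⟨_, _, _, _, fun t x => (h1 t x).fun_add (k1 t x), fun t x => (h2 t x).fun_add (k2 t x),
    fun t x => (h3 t x).fun_add (k3 t x), fun t x => (h4 t x).fun_add (k4 t x),
    fun t x => by simp only [← h5, ← k5]; ring⟩

theorem HasBox.sub {φ b ψ c : ℝ → ℝ → ℝ} (h : HasBox φ b) (h' : HasBox ψ c) :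
    HasBox (fun t x => φ t x - ψ t x) fun t x => b t x - c t x := by
  obtain ⟨pt, ptt, px, pxx, h1, h2, h3, h4, h5⟩ := h
  obtain ⟨qt, qtt, qx, qxx, k1, k2, k3, k4, k5⟩ := h'
  exact ⟨_, _, _, _, fun t x => (h1 t x).fun_sub (k1 t x), fun t x => (h2 t x).fun_sub (k2 t x),
    fun t x => (h3 t x).fun_sub (k3 t x), fun t x => (h4 t x).fun_sub (k4 t x),
    fun t x => by simp only [← h5, ← k5]; ring⟩

/-- The coordinate `X` is affine in `x`, so `∂ₜ X` is an affine function of `X` and the result is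
again a function of `t` and `X`. Only `κ²` enters, so one formula covers both kinks, whose
coordinates have slopes `γ` and `-γ`. -/
theorem hasBox_profile {c c' c'' α α' β β' κ : ℝ → ℝ} {g g' g'' : ℝ → ℝ} {X : ℝ → ℝ → ℝ}
    (hc : ∀ t, HasDerivAt c (c' t) t) (hc' : ∀ t, HasDerivAt c' (c'' t) t)
    (hg : ∀ y, HasDerivAt g (g' y) y) (hg' : ∀ y, HasDerivAt g' (g'' y) y)
    (hα : ∀ t, HasDerivAt α (α' t) t) (hβ : ∀ t, HasDerivAt β (β' t) t)
    (hXt : ∀ t x, HasDerivAt (fun τ => X τ x) (α t * X t x + β t) t)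
    (hXx : ∀ t x, HasDerivAt (fun y => X t y) (κ t) x) :
    HasBox (fun t x => c t * g (X t x)) fun t x => c'' t * g (X t x)
      + 2 * c' t * (g' (X t x) * (α t * X t x + β t))
      + c t * (g'' (X t x) * ((α t * X t x + β t) ^ 2 - κ t ^ 2)
        + g' (X t x) * ((α' t + α t ^ 2) * X t x + α t * β t + β' t)) := by
  have gt : ∀ t x, HasDerivAt (fun τ => g (X τ x)) (g' (X t x) * (α t * X t x + β t)) t :=
    fun t x => (hg _).comp t (hXt t x)
  have gt' : ∀ t x, HasDerivAt (fun τ => g' (X τ x)) (g'' (X t x) * (α t * X t x + β t)) t :=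
    fun t x => (hg' _).comp t (hXt t x)
  refine ⟨_, _, _, _, fun t x => (hc t).fun_mul (gt t x), fun t x => ((hc' t).fun_mul (gt t x)).fun_add
    ((hc t).fun_mul ((gt' t x).fun_mul (((hα t).fun_mul (hXt t x)).fun_add (hβ t)))),
    fun t x => ((hg _).comp x (hXx t x)).const_mul (c t),
    fun t x => (((hg' _).comp x (hXx t x)).mul_const (κ t)).const_mul (c t), fun t x => ?_⟩
  ring

/-- `γ' / γ`. -/
def al (v t : ℝ) : ℝ := √2 * v ^ 3 * (ga v t ^ 2 * (th v t * sg v t))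

/-- The derivative of `al`. -/
def al' (v t : ℝ) : ℝ := deriv (al v) t

theorem SB_al : SB 0 1 3 al :=
  (((SB.vpow 3).mul ((SB_ga.mul SB_ga).mul (SB_th.mul SB_sg))).const_mul √2).congr
    fun v _ t => by rw [al]; ring

theorem hasDerivAt_al {v : ℝ} (hv : v ∈ Sp) (t : ℝ) : HasDerivAt (al v) (al' v t) t := by
  obtain ⟨c', hd, _⟩ := SB_al.hasDeriv
  exact (hd v hv t).differentiableAt.hasDerivAt

theorem SB_al' : SB 0 1 4 al' := SB_al.of_hasDeriv fun _ hv t => hasDerivAt_al hv t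

/-- The first derivative of `ep`. -/
def ep' (v t : ℝ) : ℝ := deriv (ep v) t

/-- The second derivative of `ep`. -/
def ep'' (v t : ℝ) : ℝ := deriv (ep' v) t

theorem hasDerivAt_ep {v : ℝ} (hv : v ∈ Sp) (t : ℝ) : HasDerivAt (ep v) (ep' v t) t := by
  obtain ⟨c', hd, _⟩ := SB_ep.hasDeriv
  exact (hd v hv t).differentiableAt.hasDerivAt

theorem SB_ep' : SB 0 1 3 ep' := SB_ep.of_hasDeriv fun _ hv t => hasDerivAt_ep hv t

theorem hasDerivAt_ep' {v : ℝ} (hv : v ∈ Sp) (t : ℝ) : HasDerivAt (ep' v) (ep'' v t) t := by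
  obtain ⟨c', hd, _⟩ := SB_ep'.hasDeriv
  exact (hd v hv t).differentiableAt.hasDerivAt

theorem SB_ep'' : SB 0 1 4 ep'' := SB_ep'.of_hasDeriv fun _ hv t => hasDerivAt_ep' hv t

/-- The part of `∂ₜ w₀` that is constant in `x`, for a modulation with derivative `q`. -/
def be (q : ℝ → ℝ → ℝ) (v t : ℝ) : ℝ := ga v t * (q v t - v * th v t)

/-- The derivative of `be q` when `q' = q2`. -/
def be' (q q2 : ℝ → ℝ → ℝ) (v t : ℝ) : ℝ :=
  al v t * ga v t * (q v t - v * th v t) + ga v t * (q2 v t - √2 * v ^ 2 * sg v t)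

theorem hasDerivAt_ga' {v : ℝ} (hv : v ∈ Sp) (t : ℝ) :
    HasDerivAt (ga v) (al v t * ga v t) t :=
  (hasDerivAt_ga hv t).congr_deriv (by rw [al]; ring)

theorem hasDerivAt_be {q q2 : ℝ → ℝ → ℝ} {v : ℝ} (hv : v ∈ Sp)
    (hq : ∀ t, HasDerivAt (q v) (q2 v t) t) (t : ℝ) : HasDerivAt (be q v) (be' q q2 v t) t := by
  refine ((hasDerivAt_ga' hv t).fun_mul
    ((hq t).fun_sub ((hasDerivAt_th v t).const_mul v))).congr_deriv ?_
  rw [be']; ring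

theorem w0_eq {v : ℝ} (hv : v ∈ Sp) (t x : ℝ) : w0 v t x = ga v t * (x - d v t / 2) := by
  have := ga_pos hv t
  rw [w0, ga_contr hv]; field_simp

theorem hasDerivAt_w0_t {p q : ℝ → ℝ → ℝ} {v : ℝ} (hv : v ∈ Sp)
    (hp : ∀ t, HasDerivAt (p v) (q v t) t) (t x : ℝ) : HasDerivAt (fun τ => w0 v τ (x + p v τ))
      (al v t * w0 v t (x + p v t) + be q v t) t := by
  have h := (hasDerivAt_ga' hv t).fun_mul
    (((hp t).const_add x).fun_sub ((hasDerivAt_d v t hv.1).div_const 2))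
  rw [show (fun τ => w0 v τ (x + p v τ)) = _ from funext fun τ => w0_eq hv τ (x + p v τ)]
  refine h.congr_deriv ?_
  rw [w0_eq hv, be]; ring

theorem hasDerivAt_w0_x {v : ℝ} (hv : v ∈ Sp) (t s x : ℝ) :
    HasDerivAt (fun y => w0 v t (y + s)) (ga v t) x := by
  have h := (((hasDerivAt_id x).add_const s).sub_const (d v t / 2)).const_mul (ga v t)
  rw [show (fun y => w0 v t (y + s)) = _ from funext fun y => w0_eq hv t (y + s)]
  exact h.congr_deriv (by simp)

theorem hasDerivAt_w0_neg {v : ℝ} (hv : v ∈ Sp) (t s x : ℝ) :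
    HasDerivAt (fun y => w0 v t (-y + s)) (-ga v t) x := by
  have h := (((hasDerivAt_neg x).add_const s).sub_const (d v t / 2)).const_mul (ga v t)
  rw [show (fun y => w0 v t (-y + s)) = _ from funext fun y => w0_eq hv t (-y + s)]
  exact h.congr_deriv (by simp)

/-- The remainder of the wave operator on the moving kink. -/
def PH (q q2 : ℝ → ℝ → ℝ) (v t y : ℝ) : ℝ :=
  al v t ^ 2 * (y ^ 2 * H'' y) + 2 * al v t * be q v t * (y * H'' y)
    + ga v t ^ 2 * (q v t ^ 2 - 2 * (v * th v t) * q v t) * H'' y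
    + (al' v t + al v t ^ 2) * (y * H' y)
    + (al v t * be q v t + (be' q q2 v t + √2 * v ^ 2 * sg v t)) * H' y

/-- The remainder of the wave operator on the moving correction. -/
def PG (q q2 : ℝ → ℝ → ℝ) (v t y : ℝ) : ℝ :=
  ep'' v t * G y + 2 * ep' v t * al v t * (y * G' y) + 2 * ep' v t * be q v t * G' y
    + ep v t * al v t ^ 2 * (y ^ 2 * G'' y) + 2 * ep v t * al v t * be q v t * (y * G'' y)
    + ep v t * (ga v t ^ 2 * (q v t ^ 2 - 2 * (v * th v t) * q v t)) * G'' y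
    + ep v t * (al' v t + al v t ^ 2) * (y * G' y)
    + ep v t * (al v t * be q v t + be' q q2 v t) * G' y

/-- Lorentz invariance: without modulation (`q = 0`) the coefficient of the second derivative of the
profile is exactly `-1`. -/
theorem be_sq {q : ℝ → ℝ → ℝ} {v : ℝ} (hv : v ∈ Sp) (t : ℝ) : be q v t ^ 2 - ga v t ^ 2
    = -1 + ga v t ^ 2 * (q v t ^ 2 - 2 * (v * th v t) * q v t) := by
  rw [be]; linear_combination -ga_sq hv t

section
variable {q q2 : ℝ → ℝ → ℝ} {v : ℝ} {X : ℝ → ℝ → ℝ} {κ : ℝ → ℝ}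

/-- The term `-√2 v² sg H'`, the acceleration of the trajectory, is kept apart from `PH`: it is the
only contribution of order `v²` besides `-H''`, and the correction has to cancel it. -/
theorem hasBox_H (hv : v ∈ Sp) (hq : ∀ t, HasDerivAt (q v) (q2 v t) t)
    (hXt : ∀ t x, HasDerivAt (fun τ => X τ x) (al v t * X t x + be q v t) t)
    (hXx : ∀ t x, HasDerivAt (fun y => X t y) (κ t) x) (hκ : ∀ t, κ t ^ 2 = ga v t ^ 2) :
    HasBox (fun t x => H01 (X t x)) fun t x => -H'' (X t x) - √2 * v ^ 2 * sg v t * H' (X t x)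
      + PH q q2 v t (X t x) := by
  have h := hasBox_profile (fun t => hasDerivAt_const t (1 : ℝ)) (fun t => hasDerivAt_const t (0 : ℝ))
    hasDerivAt_H01 hasDerivAt_H' (hasDerivAt_al hv) (hasDerivAt_be hv hq) hXt hXx
  convert h using 3 with t x
  · simp
  · rename_i t x
    have h1 := be_sq (q := q) hv t
    rw [hκ, PH, H']
    rw [← H'']
    linear_combination (-H'' (X t x)) * h1

theorem hasBox_G (hv : v ∈ Sp) (hq : ∀ t, HasDerivAt (q v) (q2 v t) t)
    (hXt : ∀ t x, HasDerivAt (fun τ => X τ x) (al v t * X t x + be q v t) t)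
    (hXx : ∀ t x, HasDerivAt (fun y => X t y) (κ t) x) (hκ : ∀ t, κ t ^ 2 = ga v t ^ 2) :
    HasBox (fun t x => ep v t * G (X t x)) fun t x => -(ep v t * G'' (X t x))
      + PG q q2 v t (X t x) := by
  have h := hasBox_profile (hasDerivAt_ep hv) (hasDerivAt_ep' hv)
    hasDerivAt_G hasDerivAt_G' (hasDerivAt_al hv) (hasDerivAt_be hv hq) hXt hXx
  convert h using 3 with t x
  have h1 := be_sq (q := q) hv t
  rw [hκ, PG, ← G'']
  linear_combination (-ep v t * G'' (X t x)) * h1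

end

theorem w0_point {v : ℝ} (hv : v ∈ Sp) (t y : ℝ) : w0 v t (y * contr v t + d v t / 2) = y := by
  have := ga_pos hv t
  rw [w0_eq hv, ga_contr hv]; field_simp; ring

theorem hasDerivAt_w0_t_zero {v : ℝ} (hv : v ∈ Sp) (t x : ℝ) : HasDerivAt (fun τ => w0 v τ x)
    (al v t * w0 v t x + be (fun _ _ => 0) v t) t := by
  have h := hasDerivAt_w0_t (p := fun _ _ => 0) (q := fun _ _ => 0) (v := v) hv
    (fun t => hasDerivAt_const t (0 : ℝ)) t x
  simpa using h

theorem hasDerivAt_w0_x_zero {v : ℝ} (hv : v ∈ Sp) (t x : ℝ) :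
    HasDerivAt (fun y => w0 v t y) (ga v t) x := by
  simpa using hasDerivAt_w0_x hv t 0 x

/-- The definition of `R1` subtracts the acceleration with a factor `γ`, while `PH` leaves it out
with factor `1`; the extra term is the discrepancy. -/
theorem R1_eq {v : ℝ} (hv : v ∈ Sp) (t y : ℝ) : R1 v t y = PH (fun _ _ => 0) (fun _ _ => 0) v t y
    + √2 * v ^ 2 * sg v t * (ga v t - 1) * H' y := by
  have h := hasBox_H (q := fun _ _ => 0) (q2 := fun _ _ => 0) (X := w0 v) (κ := ga v) hv
    (fun t => hasDerivAt_const t (0 : ℝ))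
    (hasDerivAt_w0_t_zero hv) (hasDerivAt_w0_x_zero hv) (fun _ => rfl)
  rw [R1, Lam, h.box_eq, w0_point hv, (hasDerivAt_H01 y).deriv, ga_contr hv]
  have h1 := ep_eq v t hv.1
  rw [ep] at h1
  have := ga_pos hv t
  rw [h1, div_div_eq_mul_div, div_one]
  simp only [H'', H']
  ring

theorem R2_eq {v : ℝ} (hv : v ∈ Sp) (t y : ℝ) :
    R2 v t y = PG (fun _ _ => 0) (fun _ _ => 0) v t y := by
  have h := hasBox_G (q := fun _ _ => 0) (q2 := fun _ _ => 0) (X := w0 v) (κ := ga v) hv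
    (fun t => hasDerivAt_const t (0 : ℝ))
    (hasDerivAt_w0_t_zero hv) (hasDerivAt_w0_x_zero hv) (fun _ => rfl)
  have h2 := h.box_eq t (y * contr v t + d v t / 2)
  simp only [ep] at h2
  rw [R2, h2, w0_point hv, G'']
  ring

/-! ### Separated sums -/

/-- Finite sums of `c(v,t) b(y)`, `c` of class `SB n 1 p` and `b` rapidly decreasing. -/
inductive Sep (n p : ℕ) : (ℝ → ℝ → ℝ → ℝ) → Prop
  | base {c : ℝ → ℝ → ℝ} {b : ℝ → ℝ} : SB n 1 p c → De b → Sep n p fun v t y => c v t * b y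
  | add {F F' : ℝ → ℝ → ℝ → ℝ} : Sep n p F → Sep n p F' → Sep n p fun v t y => F v t y + F' v t y

theorem Sep.integrable {n p : ℕ} {F : ℝ → ℝ → ℝ → ℝ} (h : Sep n p F) (v t : ℝ) :
    Integrable fun y => deriv H01 y * F v t y := by
  induction h with
  | base hc hb =>
    exact (((De_deriv_H01.mul hb).integrable).const_mul _).congr (ae_of_all _ fun y => by ring_nf)
  | add _ _ h1 h2 => exact (h1.add h2).congr (ae_of_all _ fun y => by simp; ring)

/-- The coefficient comes out of the integral, so no differentiation under the integral sign is
needed. -/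
theorem Sep.proj {n p : ℕ} {F : ℝ → ℝ → ℝ → ℝ} (h : Sep n p F) :
    SB n 1 p fun v t => proj (F v t) := by
  induction h with
  | @base c b hc hb =>
    refine (hc.const_mul (PhiSix.proj b)).congr fun v _ t => ?_
    rw [PhiSix.proj, PhiSix.proj, ← integral_mul_const]
    congr 1; funext y; ring
  | add h1 h2 i1 i2 =>
    refine (i1.add i2).congr fun v _ t => ?_
    rw [PhiSix.proj, PhiSix.proj, PhiSix.proj, ← integral_add (h1.integrable v t) (h2.integrable v t)]
    congr 1; funext y; ring

section
variable {N : ℕ} {q q2 : ℝ → ℝ → ℝ}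

theorem SB_be (hq : SB N 1 3 q) : SB 0 0 1 (be q) :=
  (SB_ga.mul_left (hq.absorb.sub (((SB.vpow 1).mul SB_th)))).congr fun v _ t => by rw [be]; ring

theorem SB_q_part (hq : SB N 1 3 q) :
    SB N 1 4 fun v t => ga v t ^ 2 * (q v t ^ 2 - 2 * (v * th v t) * q v t) := by
  have h1 : SB 0 0 1 fun v t => q v t - 2 * (v ^ 1 * th v t) :=
    hq.absorb.sub (((SB.vpow 1).mul SB_th).const_mul 2)
  refine ((SB_ga.mul SB_ga).mul (h1.mul hq)).mono (by simp) (by simp) (by simp) |>.congr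
    fun v _ t => by ring

/-- The acceleration inside `be'` has only order `v²`; adding `√2 v² sg` leaves it with the factor
`1 - ga`, worth two more powers of `v`. -/
theorem SB_be' (hq : SB N 1 3 q) (hq2 : SB N 1 4 q2) :
    SB N 1 4 fun v t => be' q q2 v t + √2 * v ^ 2 * sg v t := by
  have h1 := (SB_al.mul (SB_be hq)).mono (n' := N) (k' := 1) (p' := 4) (by simp) (by simp) (by simp)
  have h2 : SB N 1 4 _ := SB_ga.mul_left hq2
  have h3 := ((((SB.vpow 2).mul SB_sg).mul SB_one_sub_ga).const_mul √2).mono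
    (n' := N) (k' := 1) (p' := 4) (by simp) (by simp) (by simp)
  exact ((h1.add h2).add h3).congr fun v _ t => by rw [be', be]; ring

theorem SB_be'_rough (hq : SB N 1 3 q) (hq2 : SB N 1 4 q2) : SB N 0 2 fun v t => be' q q2 v t := by
  have h1 := (SB_be' hq hq2).mono (n' := N) (k' := 0) (p' := 2) (by simp) (by simp) (by simp)
  have h2 := (((SB.vpow 2).mul SB_sg).const_mul √2).mono
    (n' := N) (k' := 0) (p' := 2) (by simp) (by simp) (by simp)
  exact (h1.sub h2).congr fun v _ t => by ring

theorem Sep_PH (hq : SB N 1 3 q) (hq2 : SB N 1 4 q2) : Sep N 4 (PH q q2) := by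
  have hb := SB_be hq
  have h1 : SB N 1 4 fun v t => al v t ^ 2 :=
    ((SB_al.mul SB_al).mono (by simp) (by simp) (by simp)).congr fun v _ t => by ring
  have h2 : SB N 1 4 fun v t => al v t * be q v t :=
    (SB_al.mul hb).mono (by simp) (by simp) (by simp)
  have h3 : SB N 1 4 al' := SB_al'.mono (by simp) (by simp) (by simp)
  exact ((((Sep.base h1 (De_H''.pow_mul 2)).add (Sep.base ((h2.const_mul 2).congr fun v _ t => by
    ring) De_H''.id_mul)).add (Sep.base (SB_q_part hq) De_H'')).add
    (Sep.base (h3.add h1) De_H'.id_mul)).add (Sep.base (h2.add (SB_be' hq hq2)) De_H')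

theorem Sep_PG (hq : SB N 1 3 q) (hq2 : SB N 1 4 q2) : Sep N 4 (PG q q2) := by
  have hb := SB_be hq
  have he {c : ℝ → ℝ → ℝ} (hc : SB N 0 2 c) : SB N 1 4 fun v t => ep v t * c v t := by
    simpa using SB_ep.mul hc
  have h1 : SB N 0 2 fun v t => al v t ^ 2 :=
    ((SB_al.mul SB_al).mono (by simp) (by simp) (by simp)).congr fun v _ t => by ring
  have h2 : SB N 0 2 fun v t => al v t * be q v t :=
    (SB_al.mul hb).mono (by simp) (by simp) (by simp)
  have h3 : SB N 0 2 al' := SB_al'.mono (by simp) (by simp) (by simp)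
  have h4 : SB N 1 4 fun v t => 2 * ep' v t * al v t :=
    (((SB_ep'.mul SB_al).const_mul 2).mono (by simp) (by simp) (by simp)).congr fun v _ t => by ring
  have h5 : SB N 1 4 fun v t => 2 * ep' v t * be q v t :=
    (((SB_ep'.mul hb).const_mul 2).mono (by simp) (by simp) (by simp)).congr fun v _ t => by ring
  have h6 := he ((SB_q_part hq).mono le_rfl (Nat.zero_le 1) (show 2 ≤ 4 by norm_num))
  exact (((((((Sep.base (SB_ep''.mono (by simp) le_rfl le_rfl) De_G).add
    (Sep.base h4 De_G'.id_mul)).add (Sep.base h5 De_G')).add (Sep.base (he h1) (De_G''.pow_mul 2))).add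
    (Sep.base (((he h2).const_mul 2).congr fun v _ t => by ring) De_G''.id_mul)).add
    (Sep.base h6 De_G'')).add (Sep.base (he (h3.add h1)) De_G'.id_mul)).add
    (Sep.base (he (h2.add (SB_be'_rough hq hq2))) De_G')

end

/-! ### The inhomogeneity of the modulation equation -/

theorem Bd.exp {n : ℕ} {E : ℝ → ℝ → ℝ} {M : ℝ} (h : Bd n 0 2 E) (hM : ∀ v ∈ Sp, ∀ t, E v t ≤ M) :
    Bd n 0 2 fun v t => Real.exp (E v t) - 1 := by
  obtain ⟨C, hC⟩ := h
  refine ⟨(1 + Real.exp M) * C, fun v hv t => ?_⟩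
  have h1 : |Real.exp (E v t) - 1| ≤ (1 + Real.exp M) * |E v t| := by
    have a1 := Real.add_one_le_exp (E v t)
    have a2 := Real.add_one_le_exp (-E v t)
    have a3 : Real.exp (E v t) ≤ Real.exp M := Real.exp_le_exp.2 (hM v hv t)
    have a4 : Real.exp (-E v t) * Real.exp (E v t) = 1 := by rw [← Real.exp_add]; simp
    have a5 := Real.exp_pos (E v t)
    have a6 := Real.exp_pos M
    have a7 : Real.exp (E v t) - 1 ≤ E v t * Real.exp (E v t) := by nlinarith
    rcases le_total 0 (E v t) with h | h
    · rw [abs_of_nonneg h, abs_of_nonneg (by linarith)]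
      nlinarith [mul_le_mul_of_nonneg_left a3 h]
    · rw [abs_of_nonpos h, abs_of_nonpos (by nlinarith)]
      nlinarith
  calc _ ≤ _ := h1
    _ ≤ (1 + Real.exp M) * (C * wt n 0 2 v t) := by
        have := Real.exp_pos M
        gcongr; exact hC v hv t
    _ = _ := by ring

/-- Although `E` may grow like a power of `Lg`, its exponential is bounded by the one-sided bound
`M`. Assuming `E'` free of logarithms keeps them out of the derivatives of `exp E`. -/
theorem SB_exp {n : ℕ} {E E' : ℝ → ℝ → ℝ} {M : ℝ} (h : SB n 0 2 E)
    (hd : ∀ v ∈ Sp, ∀ t, HasDerivAt (E v) (E' v t) t) (hE : SB 0 0 1 E')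
    (hM : ∀ v ∈ Sp, ∀ t, E v t ≤ M) : SB 0 0 0 (fun v t => Real.exp (E v t)) ∧
      SB n 0 2 fun v t => Real.exp (E v t) - 1 := by
  have hb : Bd 0 0 0 (fun v t => Real.exp (E v t)) := ⟨Real.exp M, fun v hv t => by
    rw [abs_of_pos (Real.exp_pos _)]; simpa [wt] using hM v hv t⟩
  have hd' : ∀ v ∈ Sp, ∀ t, HasDerivAt (fun t => Real.exp (E v t))
      (Real.exp (E v t) * E' v t) t := fun v hv t => (hd v hv t).exp
  have h1 : SB 0 0 0 (fun v t => Real.exp (E v t)) := by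
    intro l
    induction l with
    | zero => exact hb
    | succ l ih => exact ⟨hb, _, hd', by simpa using ih.mul (hE l)⟩
  exact ⟨h1, SB.intro (h.bd.exp hM) (fun v hv t => (hd' v hv t).sub_const 1)
    (h1.mul_left (h.of_hasDeriv hd))⟩

/-- The exponent `√2 (1 - γ) d`. -/
def E0 (v t : ℝ) : ℝ := √2 * ((1 - ga v t) * d v t)

/-- The derivative of `E0`. -/
def E0' (v t : ℝ) : ℝ := √2 * (-(al v t * ga v t) * d v t + (1 - ga v t) * (2 * v * th v t))

theorem hasDerivAt_E0 {v : ℝ} (hv : v ∈ Sp) (t : ℝ) : HasDerivAt (E0 v) (E0' v t) t :=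
  (((hasDerivAt_ga' hv t).const_sub 1).fun_mul (hasDerivAt_d v t hv.1)).const_mul √2

theorem SB_E0 : SB 1 0 2 E0 := (SB_one_sub_ga.mul SB_d).const_mul √2

theorem SB_E0' : SB 0 0 1 E0' := by
  have h1 : SB 0 0 1 fun v t => al v t * ga v t * d v t :=
    ((SB_al.mul SB_ga).mul SB_d).absorb
  have h2 : SB 0 0 1 fun v t => (1 - ga v t) * (2 * (v ^ 1 * th v t)) :=
    (SB_one_sub_ga.mul (((SB.vpow 1).mul SB_th).const_mul 2)).mono (by simp) (by simp) (by simp)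
  exact ((h2.sub h1).const_mul √2).congr fun v _ t => by rw [E0']; ring

theorem E0_nonpos {v : ℝ} (hv : v ∈ Sp) (t : ℝ) : E0 v t ≤ 0 := by
  have h1 := one_le_ga hv t
  have h2 := d_pos hv t
  have h3 : 0 ≤ (ga v t - 1) * d v t := mul_nonneg (by linarith) h2.le
  have h4 : 0 ≤ √2 * ((ga v t - 1) * d v t) := by positivity
  unfold E0; linarith

theorem exp_two_d (v t : ℝ) : Real.exp (-(2 * √2 * d v t)) = ep v t ^ 2 := by
  rw [ep, ← Real.exp_nat_mul]; congr 1; push_cast; ring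

theorem exp_d_div_contr {v : ℝ} (hv : v ∈ Sp) (t : ℝ) :
    Real.exp (-(√2 * d v t) / contr v t) = ep v t * Real.exp (E0 v t) := by
  have := ga_pos hv t
  rw [ep, ← Real.exp_add, ga_contr hv, E0]; congr 1; field_simp; ring

/-- Each term of the inhomogeneity has order `v⁴` with weight `ew`; the single power of `Lg` comes
from the factors `d_v`, either explicit or in the exponent `E0`. -/
theorem SB_NL : SB 1 1 4 NL := by
  have hz1 : SB 0 1 3 fun _ _ => 0 := fun l => Sb.zero
  have hz2 : SB 0 1 4 fun _ _ => 0 := fun l => Sb.zero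
  have s1 := (Sep_PH hz1 hz2)
  have c1 : SB 0 1 4 fun v t => √2 * v ^ 2 * sg v t * (ga v t - 1) :=
    (((((SB.vpow 2).mul SB_sg).mul SB_one_sub_ga).const_mul (-√2)).mono (by simp) (by simp)
      (by simp)).congr fun v _ t => by ring
  have s2 := (s1.add (Sep.base c1 De_H')).add (Sep_PG hz1 hz2)
  have h1 : SB 1 1 4 fun v t => proj (fun x => R1 v t x + R2 v t x) :=
    (s2.proj.mono (by simp) le_rfl le_rfl).congr fun v hv t => by
      congr 1; funext y; rw [R1_eq hv, R2_eq hv]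
  have hee : SB 0 1 4 fun v t => ep v t ^ 2 :=
    ((SB_ep.mul SB_ep).mono (by simp) (by simp) (by simp)).congr fun v _ t => by ring
  have h2 : SB 1 1 4 fun v t => d v t * ep v t ^ 2 := (SB_d.mul hee).mono (by simp) (by simp) (by simp)
  have h3 : SB 1 1 4 fun v t => ep v t ^ 2 := hee.mono (by simp) le_rfl le_rfl
  have hE := SB_exp SB_E0 (fun v hv t => hasDerivAt_E0 hv t) SB_E0' (fun v hv t => E0_nonpos hv t)
  -- The bracket `γ⁻¹ e^{-√2 γ d} - e^{-√2 d}` is `ep (γ⁻¹ e^{E0} - 1)`, split here into two parts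
  -- that are both small.
  have h4 : SB 1 0 2 fun v t => 1 / ga v t * (Real.exp (E0 v t) - 1) + 1 / ga v t * (1 - ga v t) :=
    (SB_inv_ga.mul_left hE.2).add ((SB_inv_ga.mul_left SB_one_sub_ga).mono (by simp) le_rfl le_rfl)
  have h5 : SB 1 1 4 fun v t => ep v t *
      (1 / ga v t * (Real.exp (E0 v t) - 1) + 1 / ga v t * (1 - ga v t)) :=
    (SB_ep.mul h4).mono (by simp) (by simp) (by simp)
  refine ((((h1.const_mul (-1)).add (h3.const_mul (-proj (fun x => x * cA x + x * cB x + cC x - cD x)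
    - 1 / 2 * proj (fun x => iteratedDeriv 3 U (H01 x) * G x ^ 2) - 15 - 24 * proj V))).add
    (h2.const_mul (-proj cB))).add (h5.const_mul (-4))).congr fun v hv t => ?_
  have := ga_pos hv t
  rw [NL, exp_two_d, exp_d_div_contr hv, ga_contr hv, ← ep]
  field_simp
  ring

/-! ### Evenness of the inhomogeneity in time. -/

theorem d_neg (v t : ℝ) : d v (-t) = d v t := by
  rw [d, d, mul_neg, Real.cosh_neg]

theorem deriv_neg_of_even {f : ℝ → ℝ} (h : ∀ t, f (-t) = f t) (t : ℝ) : deriv f (-t) = -deriv f t := by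
  have h1 := deriv_comp_neg f t
  rw [funext h] at h1
  linarith

theorem contr_neg (v t : ℝ) : contr v (-t) = contr v t := by
  rw [contr, contr, deriv_neg_of_even (d_neg v), neg_sq]

theorem w0_neg (v t x : ℝ) : w0 v (-t) x = w0 v t x := by
  rw [w0, w0, contr_neg, d_neg]

theorem box_neg {φ : ℝ → ℝ → ℝ} (h : ∀ t x, φ (-t) x = φ t x) (t x : ℝ) :
    box φ (-t) x = box φ t x := by
  have h1 := iteratedDeriv_comp_neg 2 (fun τ => φ τ x) (-t)
  simp only [h, neg_neg] at h1
  rw [box, box, h1, show φ (-t) = φ t from funext (h t)]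
  simp

theorem NL_neg (v t : ℝ) : NL v (-t) = NL v t := by
  have h1 : R1 v (-t) = R1 v t := by
    funext y
    rw [R1, R1, Lam, Lam, contr_neg, d_neg, box_neg (fun t x => by rw [w0_neg]), w0_neg]
  have h2 : R2 v (-t) = R2 v t := by
    funext y
    rw [R2, R2, contr_neg, d_neg, box_neg (fun t x => by rw [w0_neg, d_neg])]
  rw [NL, NL, h1, h2, d_neg, contr_neg]

theorem integral_deriv_H01_sq_pos : 0 < ∫ x, deriv H01 x ^ 2 := by
  have hi : Integrable fun x => deriv H01 x ^ 2 :=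
    (De_deriv_H01.mul De_deriv_H01).integrable.congr (ae_of_all _ fun x => by ring_nf)
  have hp (x : ℝ) : 0 < deriv H01 x ^ 2 := by
    rw [deriv_H01]; have := bump_pos x; positivity
  rw [integral_pos_iff_support_of_nonneg (fun x => (hp x).le) hi]
  rw [show Function.support (fun x => deriv H01 x ^ 2) = Set.univ from
    Set.eq_univ_of_forall fun x => (hp x).ne']
  simp

/-! ### The linear equation for the modulation -/

theorem Lg_neg (v t : ℝ) : Lg v (-t) = Lg v t := by rw [Lg, Lg, abs_neg]

theorem ew_neg (v t : ℝ) : ew v (-t) = ew v t := by rw [ew, ew, abs_neg]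

theorem Lg_ew_le {v : ℝ} (hv : v ∈ Sp) (t : ℝ) : (1 + |√2 * v * t|) * (Lg v t * ew v t)
    ≤ 3 / 2 * Real.log (1 / v ^ 2) * Real.exp (-(4 / 5 * v * |t|)) := by
  have h0 := one_le_log_Sp hv
  have hx : 0 ≤ |t| * v := mul_nonneg (abs_nonneg t) hv.1.le
  have h1 : |√2 * v * t| = √2 * (|t| * v) := by
    rw [abs_mul, abs_mul, abs_of_pos hv.1, abs_of_pos (show (0 : ℝ) < √2 by positivity)]; ring
  -- With `x = |t| v`, the growth of the second homogeneous solution and that of `Lg` cost a factor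
  -- `e^x` each, so of the rate `14/5` there remains `4/5`.
  have h2 : ew v t ≤ Real.exp (-(14 / 5 * (|t| * v))) := by
    rw [ew, Real.exp_le_exp]; nlinarith [sqrt_two_lb]
  have h3 : 4 / 5 * v * |t| = 4 / 5 * (|t| * v) := by ring
  rw [h1, Lg, h3]
  generalize |t| * v = x at *
  generalize Real.log (1 / v ^ 2) = M at *
  have h4 : 1 + √2 * x ≤ 3 / 2 * Real.exp x := by
    nlinarith [sqrt_two_ub, Real.add_one_le_exp x]
  have h5 : x + M ≤ M * Real.exp x := by nlinarith [Real.add_one_le_exp x]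
  have h6 := (ew_pos v t).le
  have h7 : 0 ≤ x + M := by linarith
  calc _ ≤ (3 / 2 * Real.exp x) * ((M * Real.exp x) * Real.exp (-(14 / 5 * x))) := by gcongr
    _ = 3 / 2 * M * (Real.exp x * Real.exp x * Real.exp (-(14 / 5 * x))) := by ring
    _ = _ := by rw [← Real.exp_add, ← Real.exp_add]; ring_nf

theorem tendsto_Lg_ew {v : ℝ} (hv : v ∈ Sp) :
    Tendsto (fun t => (1 + |√2 * v * t|) * (Lg v t * ew v t)) atTop (𝓝 0) := by
  have h1 : Tendsto (fun t => 3 / 2 * Real.log (1 / v ^ 2) * Real.exp (-(4 / 5 * v * |t|)))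
      atTop (𝓝 (3 / 2 * Real.log (1 / v ^ 2) * 0)) := by
    refine Tendsto.const_mul _ (Real.tendsto_exp_atBot.comp (tendsto_neg_atTop_atBot.comp ?_))
    have := hv.1
    exact Tendsto.const_mul_atTop (by positivity) tendsto_abs_atTop_atTop
  rw [mul_zero] at h1
  refine squeeze_zero (fun t => ?_) (Lg_ew_le hv) h1
  have := one_le_Lg hv t
  have := ew_pos v t
  positivity

theorem hasDerivAt_tail {v : ℝ} (hv : v ∈ Sp) (s : ℝ) : HasDerivAt
    (fun s => -(1 / v) * ((s * v + Real.log (1 / v ^ 2)) * Real.exp (-(2 * √2 * s * v))))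
    (Real.exp (-(2 * √2 * s * v)) * (2 * √2 * (s * v + Real.log (1 / v ^ 2)) - 1)) s := by
  have h1 : HasDerivAt (fun s : ℝ => s * v + Real.log (1 / v ^ 2)) v s := by
    simpa using ((hasDerivAt_id s).mul_const v).add_const (Real.log (1 / v ^ 2))
  have h2 : HasDerivAt (fun s : ℝ => -(2 * √2 * s * v)) (-(2 * √2 * v)) s := by
    simpa using (((hasDerivAt_id s).const_mul (2 * √2)).mul_const v).fun_neg
  refine ((h1.fun_mul h2.exp).const_mul (-(1 / v))).congr_deriv ?_
  have := hv.1
  field_simp; ring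

/-- Integrability at infinity and the size of the tail of functions of size `Lg ew`. -/
theorem tail_bound {v C : ℝ} (hv : v ∈ Sp) {f : ℝ → ℝ} (hc : Continuous f) (hC : 0 ≤ C)
    (hf : ∀ t, |f t| ≤ C * (Lg v t * ew v t)) {t : ℝ} (ht : 0 ≤ t) :
    IntegrableOn f (Ioi t) ∧ |∫ s in Ioi t, f s| ≤ C / v * (Lg v t * ew v t) := by
  have hv0 := hv.1
  -- For `s ≥ 0` the derivative of `F` is `(2√2 Lg - 1) ew`, which dominates `Lg ew` because `Lg ≥
  -- 1`. Thus `-F(t) = Lg ew / v` bounds the tail.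
  set F := fun s : ℝ => -(1 / v) * ((s * v + Real.log (1 / v ^ 2)) * Real.exp (-(2 * √2 * s * v)))
  set F' := fun s : ℝ =>
    Real.exp (-(2 * √2 * s * v)) * (2 * √2 * (s * v + Real.log (1 / v ^ 2)) - 1)
  have hF : ∀ s, 0 ≤ s → F s = -(1 / v) * (Lg v s * ew v s) := fun s hs => by
    simp only [F, Lg, ew, abs_of_nonneg hs]
  have hF' : ∀ s, 0 ≤ s → Lg v s * ew v s ≤ F' s := fun s hs => by
    have h1 := one_le_Lg hv s
    have h2 := ew_pos v s
    have : F' s = ew v s * (2 * √2 * Lg v s - 1) := by simp only [F', Lg, ew, abs_of_nonneg hs]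
    rw [this, mul_comm]
    gcongr
    nlinarith [sqrt_two_lb]
  have hpos : ∀ s, 0 ≤ s → 0 ≤ F' s := fun s hs => le_trans (by
    have h1 := one_le_Lg hv s
    have h2 := ew_pos v s
    positivity) (hF' s hs)
  have hlim : Tendsto F atTop (𝓝 0) := by
    have h1 : Tendsto (fun s => Lg v s * ew v s) atTop (𝓝 0) := by
      refine squeeze_zero (fun s => ?_) (fun s => ?_) (tendsto_Lg_ew hv)
      · have h1 := one_le_Lg hv s
        have h2 := ew_pos v s
        positivity
      · have h1 := one_le_Lg hv s
        have h2 := ew_pos v s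
        have h3 : 0 ≤ Lg v s * ew v s := by positivity
        nlinarith [abs_nonneg (√2 * v * s)]
    have h2 := h1.const_mul (-(1 / v))
    rw [mul_zero] at h2
    refine h2.congr' ?_
    filter_upwards [eventually_ge_atTop 0] with s hs
    rw [hF s hs]
  have hder : ∀ s, HasDerivAt F (F' s) s := hasDerivAt_tail hv
  have hint : IntegrableOn F' (Ioi t) := integrableOn_Ioi_deriv_of_nonneg
    (hder t).continuousAt.continuousWithinAt (fun s _ => hder s)
    (fun s hs => hpos s (ht.trans (le_of_lt hs))) hlim
  have hval : ∫ s in Ioi t, F' s = 0 - F t := integral_Ioi_of_hasDerivAt_of_nonneg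
    (hder t).continuousAt.continuousWithinAt (fun s _ => hder s)
    (fun s hs => hpos s (ht.trans (le_of_lt hs))) hlim
  have hbd : ∀ᵐ s ∂(volume.restrict (Ioi t)), ‖f s‖ ≤ C * F' s := by
    refine (ae_restrict_mem measurableSet_Ioi).mono fun s hs => (hf s).trans ?_
    gcongr
    exact hF' s (ht.trans (le_of_lt hs))
  refine ⟨(hint.const_mul C).mono' hc.aestronglyMeasurable hbd, ?_⟩
  have := norm_integral_le_of_norm_le (hint.const_mul C) hbd
  rw [integral_const_mul, hval, hF t ht] at this
  refine this.trans (le_of_eq ?_)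
  ring

theorem weighted_bound {v C : ℝ} (hv : v ∈ Sp) {f : ℝ → ℝ} (hC : 0 ≤ C)
    (hf : ∀ t, |f t| ≤ C * ((1 + |√2 * v * t|) * (Lg v t * ew v t))) {t : ℝ} (ht : 0 ≤ t) :
    |∫ s in (0 : ℝ)..t, f s| ≤ 2 * C / v * Real.log (1 / v ^ 2) := by
  have hv0 := hv.1
  have h0 := one_le_log_Sp hv
  set M := Real.log (1 / v ^ 2)
  have hd : ∀ s ∈ uIcc 0 t, HasDerivAt
      (fun s => C * (3 / 2 * M) * (-(5 / (4 * v)) * Real.exp (-(4 / 5 * v) * s)))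
      (C * (3 / 2 * M) * Real.exp (-(4 / 5 * v) * s)) s := fun s _ => by
    have h1 := (hasDerivAt_mul_const' (-(4 / 5 * v)) s).exp
    refine ((h1.const_mul (-(5 / (4 * v)))).const_mul (C * (3 / 2 * M))).congr_deriv ?_
    field_simp
  have hi : IntervalIntegrable (fun s => C * (3 / 2 * M) * Real.exp (-(4 / 5 * v) * s)) volume 0 t :=
    Continuous.intervalIntegrable (by fun_prop) _ _
  have := intervalIntegral.norm_integral_le_of_norm_le ht (f := f)
    (g := fun s => C * (3 / 2 * M) * Real.exp (-(4 / 5 * v) * s))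
    (ae_of_all _ fun s hs => (hf s).trans (by
      rw [mul_assoc C]
      refine mul_le_mul_of_nonneg_left ((Lg_ew_le hv s).trans (le_of_eq ?_)) hC
      rw [abs_of_pos hs.1, neg_mul])) hi
  rw [intervalIntegral.integral_eq_sub_of_hasDerivAt hd hi] at this
  refine this.trans ?_
  have h3 := Real.exp_pos (-(4 / 5 * v) * t)
  have h4 : 0 ≤ C / v * M := by positivity
  have e : C * (3 / 2 * M) * (-(5 / (4 * v)) * Real.exp (-(4 / 5 * v) * t)) -
      C * (3 / 2 * M) * (-(5 / (4 * v)) * Real.exp (-(4 / 5 * v) * 0)) =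
      C / v * M * (15 / 8 * (1 - Real.exp (-(4 / 5 * v) * t))) := by
    simp only [mul_zero, Real.exp_zero]; field_simp; ring
  rw [e]
  calc _ ≤ C / v * M * 2 := by gcongr; linarith
    _ = _ := by ring

/-! ### Variation of constants for `r'' = -4 v² sech²(√2 v t) r + f`. -/

section
variable (f : ℝ → ℝ → ℝ)

/-- The second solution of the homogeneous equation. -/
def u2 (v t : ℝ) : ℝ := √2 * v * t * th v t - 1

/-- The integral `∫₀ᵗ u₂ f`. -/
def I1 (v t : ℝ) : ℝ := ∫ s in (0 : ℝ)..t, u2 v s * f v s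

/-- The integral `-∫ₜ^∞ tanh(√2 v s) f`. -/
def I2 (v t : ℝ) : ℝ := (∫ s in (0 : ℝ)..t, th v s * f v s) - ∫ s in Ioi (0 : ℝ), th v s * f v s

/-- The bounded even solution of the modulation equation with inhomogeneity `f`. -/
def modul (v t : ℝ) : ℝ := 1 / (√2 * v) * (-(th v t * I1 f v t) + u2 v t * I2 f v t)

/-- The derivative of `modul`. -/
def modul' (v t : ℝ) : ℝ := -(sg v t * I1 f v t) + (th v t + √2 * v * t * sg v t) * I2 f v t

/-- The second derivative of `modul`. -/
def modul'' (v t : ℝ) : ℝ := -4 * (v ^ 2 * (sg v t * modul f v t)) + f v t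

variable {f}

theorem continuous_th (v : ℝ) : Continuous (th v) :=
  continuous_iff_continuousAt.2 fun t => (hasDerivAt_th v t).continuousAt

theorem hasDerivAt_u2 (v t : ℝ) :
    HasDerivAt (u2 v) (√2 * v * (th v t + √2 * v * t * sg v t)) t := by
  refine (((hasDerivAt_mul_const' (√2 * v) t).fun_mul (hasDerivAt_th v t)).sub_const 1).congr_deriv ?_
  ring

theorem continuous_u2 (v : ℝ) : Continuous (u2 v) :=
  continuous_iff_continuousAt.2 fun t => (hasDerivAt_u2 v t).continuousAt

variable {v : ℝ}

theorem hasDerivAt_I1 (hc : Continuous (f v)) (t : ℝ) :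
    HasDerivAt (I1 f v) (u2 v t * f v t) t :=
  ((continuous_u2 v).mul hc).integral_hasStrictDerivAt 0 t |>.hasDerivAt

theorem hasDerivAt_I2 (hc : Continuous (f v)) (t : ℝ) :
    HasDerivAt (I2 f v) (th v t * f v t) t :=
  (((continuous_th v).mul hc).integral_hasStrictDerivAt 0 t).hasDerivAt.sub_const _

theorem hasDerivAt_modul (hv : 0 < v) (hc : Continuous (f v)) (t : ℝ) :
    HasDerivAt (modul f v) (modul' f v t) t := by
  have h := ((((hasDerivAt_th v t).fun_mul (hasDerivAt_I1 hc t)).fun_neg).fun_add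
    ((hasDerivAt_u2 v t).fun_mul (hasDerivAt_I2 hc t))).const_mul (1 / (√2 * v))
  refine h.congr_deriv ?_
  rw [modul']
  field_simp
  ring

theorem hasDerivAt_modul' (hv : 0 < v) (hc : Continuous (f v)) (t : ℝ) :
    HasDerivAt (modul' f v) (modul'' f v t) t := by
  have h := (((hasDerivAt_sg v t).fun_mul (hasDerivAt_I1 hc t)).fun_neg).fun_add
    (((hasDerivAt_th v t).fun_add ((hasDerivAt_mul_const' (√2 * v) t).fun_mul
      (hasDerivAt_sg v t))).fun_mul (hasDerivAt_I2 hc t))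
  refine h.congr_deriv ?_
  have h1 : v ^ 2 * (sg v t * modul f v t)
      = √2 / 2 * v * (sg v t * (-(th v t * I1 f v t) + u2 v t * I2 f v t)) := by
    rw [modul]
    field_simp
    rw [sqrt_two_sq]; ring
  rw [modul'', h1, u2]
  -- The coefficient of `f` is the Wronskian of the two homogeneous solutions divided by `√2 v`,
  -- that is `th² + sg = 1`.
  have h2 : th v t ^ 2 = 1 - sg v t := by rw [sg]; ring
  linear_combination f v t * h2

theorem th_neg (v t : ℝ) : th v (-t) = -th v t := by rw [th, th, mul_neg, Real.tanh_neg]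

theorem u2_neg (v t : ℝ) : u2 v (-t) = u2 v t := by rw [u2, u2, th_neg]; ring

/-- `I1` is odd and `I2` is even. `I2` was normalised to vanish at `+∞` only; evenness transfers the
resulting control to `-∞`. -/
theorem modul_neg (he : ∀ t, f v (-t) = f v t) (t : ℝ) : modul f v (-t) = modul f v t := by
  have h1 : I1 f v (-t) = -I1 f v t := by
    have h := intervalIntegral.integral_comp_neg (a := 0) (b := t) (fun s => u2 v s * f v s)
    rw [neg_zero] at h
    simp only [u2_neg, he] at h
    rw [I1, I1, intervalIntegral.integral_symm, h]
  have h2 : I2 f v (-t) = I2 f v t := by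
    have h := intervalIntegral.integral_comp_neg (a := 0) (b := t) (fun s => th v s * f v s)
    rw [neg_zero] at h
    simp only [th_neg, he] at h
    rw [I2, I2, intervalIntegral.integral_symm, ← h, ← intervalIntegral.integral_neg]
    simp
  rw [modul, modul, h1, h2, th_neg, u2_neg]; ring

theorem modul'_neg (hv : 0 < v) (hc : Continuous (f v)) (he : ∀ t, f v (-t) = f v t) (t : ℝ) :
    modul' f v (-t) = -modul' f v t := by
  have h := deriv_neg_of_even (modul_neg he) t
  rwa [(hasDerivAt_modul hv hc _).deriv, (hasDerivAt_modul hv hc _).deriv] at h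

end

section
variable {f : ℝ → ℝ → ℝ} {v C : ℝ}

theorem abs_u2_le (v t : ℝ) : |u2 v t| ≤ 1 + |√2 * v * t| := by
  have h := abs_th_le_one v t
  calc |u2 v t| ≤ |√2 * v * t * th v t| + |1| := abs_sub _ _
    _ ≤ |√2 * v * t| * 1 + 1 := by rw [abs_mul, abs_one]; gcongr
    _ = _ := by ring

/-- Bounds for a continuous inhomogeneity of size `v⁴ Lg ew`. -/
theorem abs_I1_le (hv : v ∈ Sp) (hC : 0 ≤ C) (hf : ∀ t, |f v t| ≤ C * wt 1 1 4 v t) {t : ℝ}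
    (ht : 0 ≤ t) : |I1 f v t| ≤ 2 * C * v ^ 3 * Real.log (1 / v ^ 2) := by
  have hv0 := hv.1
  have h := weighted_bound (f := fun s => u2 v s * f v s) (C := C * v ^ 4) hv (by positivity)
    (fun s => by
      rw [abs_mul]
      calc _ ≤ (1 + |√2 * v * s|) * (C * wt 1 1 4 v s) :=
            mul_le_mul (abs_u2_le v s) (hf s) (abs_nonneg _) (by positivity)
        _ = _ := by rw [wt]; ring) ht
  refine h.trans (le_of_eq ?_)
  field_simp

theorem abs_th_mul_le (hf : ∀ t, |f v t| ≤ C * wt 1 1 4 v t) (s : ℝ) :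
    |th v s * f v s| ≤ C * v ^ 4 * (Lg v s * ew v s) := by
  rw [abs_mul]
  calc |th v s| * |f v s| ≤ 1 * |f v s| := by gcongr; exact abs_th_le_one v s
    _ ≤ C * wt 1 1 4 v s := by rw [one_mul]; exact hf s
    _ = _ := by rw [wt]; ring

theorem abs_I2_le (hv : v ∈ Sp) (hC : 0 ≤ C) (hc : Continuous (f v))
    (hf : ∀ t, |f v t| ≤ C * wt 1 1 4 v t) {t : ℝ}
    (ht : 0 ≤ t) : |I2 f v t| ≤ C * v ^ 3 * (Lg v t * ew v t) := by
  have hv0 := hv.1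
  have hcc : Continuous fun s => th v s * f v s := (continuous_th v).mul hc
  have hC4 : 0 ≤ C * v ^ 4 := by positivity
  have h0 := tail_bound hv hcc hC4 (abs_th_mul_le hf) le_rfl
  have h1 := tail_bound hv hcc hC4 (abs_th_mul_le hf) ht
  have h2 : I2 f v t = -∫ s in Ioi t, th v s * f v s := by
    have h3 : ∫ s in Ioi (0 : ℝ), th v s * f v s = (∫ s in (0 : ℝ)..t, th v s * f v s) +
        ∫ s in Ioi t, th v s * f v s := by
      rw [intervalIntegral.integral_of_le ht, ← setIntegral_union Ioc_disjoint_Ioi_same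
        measurableSet_Ioi (h0.1.mono_set Ioc_subset_Ioi_self) h1.1, Ioc_union_Ioi_eq_Ioi ht]
    rw [I2, h3]; ring
  rw [h2, abs_neg]
  refine h1.2.trans (le_of_eq ?_)
  field_simp

/-- The linear growth of `u2` is compensated by the exponentially small tail `I2`, which leaves a
bound uniform in `t` with only `ln (1/v²)` in it. -/
theorem abs_modul_le (hv : v ∈ Sp) (hC : 0 ≤ C) (hc : Continuous (f v))
    (he : ∀ t, f v (-t) = f v t) (hf : ∀ t, |f v t| ≤ C * wt 1 1 4 v t) (t : ℝ) :
    |modul f v t| ≤ 3 * C * v ^ 2 * Real.log (1 / v ^ 2) := by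
  wlog ht : 0 ≤ t generalizing t
  · rw [← modul_neg he]; exact this (-t) (by linarith)
  have hv0 := hv.1
  have h1 := abs_I1_le hv hC hf ht
  have h2 := abs_I2_le hv hC hc hf ht
  have hM := one_le_log_Sp hv
  have h4 : |u2 v t * I2 f v t| ≤ 3 / 2 * C * v ^ 3 * Real.log (1 / v ^ 2) := by
    rw [abs_mul]
    calc _ ≤ (1 + |√2 * v * t|) * (C * v ^ 3 * (Lg v t * ew v t)) :=
          mul_le_mul (abs_u2_le v t) h2 (abs_nonneg _) (by positivity)
      _ = C * v ^ 3 * ((1 + |√2 * v * t|) * (Lg v t * ew v t)) := by ring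
      _ ≤ C * v ^ 3 * (3 / 2 * Real.log (1 / v ^ 2) * 1) := by
          refine mul_le_mul_of_nonneg_left ((Lg_ew_le hv t).trans ?_) (by positivity)
          gcongr
          exact Real.exp_le_one_iff.2 (by simp; positivity)
      _ = _ := by ring
  have h5 : |th v t * I1 f v t| ≤ 2 * C * v ^ 3 * Real.log (1 / v ^ 2) := by
    rw [abs_mul]
    calc _ ≤ 1 * |I1 f v t| := by gcongr; exact abs_th_le_one v t
      _ ≤ _ := by rw [one_mul]; exact h1
  have h6 : |-(th v t * I1 f v t) + u2 v t * I2 f v t|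
      ≤ 7 / 2 * C * v ^ 3 * Real.log (1 / v ^ 2) := by
    refine (abs_add_le _ _).trans ?_
    rw [abs_neg]; linarith
  rw [modul, abs_mul, abs_of_pos (show 0 < 1 / (√2 * v) by positivity)]
  calc _ ≤ 1 / (√2 * v) * (7 / 2 * C * v ^ 3 * Real.log (1 / v ^ 2)) := by gcongr
    _ = (1 / √2) * (7 / 2 * C * v ^ 2 * Real.log (1 / v ^ 2)) := by field_simp
    _ ≤ 5 / 7 * (7 / 2 * C * v ^ 2 * Real.log (1 / v ^ 2)) := by
        refine mul_le_mul_of_nonneg_right ?_ (by positivity)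
        rw [div_le_div_iff₀ (by positivity) (by norm_num)]
        linarith [sqrt_two_lb]
    _ ≤ _ := by
        have : 0 ≤ C * v ^ 2 * Real.log (1 / v ^ 2) := by positivity
        linarith

/-- Unlike `modul`, the derivative decays: `I1` now comes with `sg`, and `I2` is itself a decaying
tail. The constant is `15 = 4 · 2 + 7`. -/
theorem abs_modul'_le (hv : v ∈ Sp) (hC : 0 ≤ C) (hc : Continuous (f v))
    (he : ∀ t, f v (-t) = f v t) (hf : ∀ t, |f v t| ≤ C * wt 1 1 4 v t) (t : ℝ) :
    |modul' f v t| ≤ 15 * C * wt 1 1 3 v t := by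
  have hv0 := hv.1
  wlog ht : 0 ≤ t generalizing t
  · have h := this (-t) (by linarith)
    rwa [modul'_neg hv0 hc he, abs_neg, wt, Lg_neg, ew_neg] at h
  have h1 := abs_I1_le hv hC hf ht
  have h2 := abs_I2_le hv hC hc hf ht
  have hM := one_le_log_Sp hv
  have hs := sg_le v t hv0
  have hw := ew_pos v t
  have hL := one_le_Lg hv t
  have hx : 0 ≤ |t| * v := by positivity
  have h3 : |th v t + √2 * v * t * sg v t| ≤ 7 := by
    have a1 : |√2 * v * t| * sg v t ≤ 6 := by
      have e : |√2 * v * t| = √2 * (|t| * v) := by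
        rw [abs_mul, abs_mul, abs_of_pos hv.1, abs_of_pos (show (0 : ℝ) < √2 by positivity)]; ring
      have a2 : |t| * v * ew v t ≤ 1 := by
        have b1 : |t| * v ≤ Real.exp (2 * √2 * |t| * v) := by
          have := Real.add_one_le_exp (2 * √2 * |t| * v)
          nlinarith [sqrt_two_lb]
        calc _ ≤ Real.exp (2 * √2 * |t| * v) * ew v t := by gcongr
          _ = 1 := by rw [ew, ← Real.exp_add]; simp
      rw [e]
      calc _ ≤ 3 / 2 * (|t| * v) * (4 * ew v t) := by
            have := sqrt_two_ub
            have := (sg_pos v t).le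
            gcongr
        _ = 6 * (|t| * v * ew v t) := by ring
        _ ≤ 6 := by linarith
    calc _ ≤ |th v t| + |√2 * v * t * sg v t| := abs_add_le _ _
      _ ≤ 1 + 6 := by
          rw [abs_mul, abs_of_pos (sg_pos v t)]
          exact add_le_add (abs_th_le_one v t) a1
      _ = 7 := by norm_num
  rw [modul']
  calc _ ≤ |sg v t * I1 f v t| + |(th v t + √2 * v * t * sg v t) * I2 f v t| := by
        rw [← abs_neg (sg v t * _)]; exact abs_add_le _ _
    _ ≤ (4 * ew v t) * (2 * C * v ^ 3 * Lg v t) + 7 * (C * v ^ 3 * (Lg v t * ew v t)) := by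
        rw [abs_mul, abs_mul, abs_of_pos (sg_pos v t)]
        have : Real.log (1 / v ^ 2) ≤ Lg v t := by unfold Lg; linarith
        have h4 : |I1 f v t| ≤ 2 * C * v ^ 3 * Lg v t := h1.trans (by gcongr)
        gcongr
    _ = _ := by rw [wt]; ring

theorem Bd_modul {n : ℕ} (hb : Bd 1 1 4 f) (hc : ∀ v ∈ Sp, Continuous (f v))
    (he : ∀ v ∈ Sp, ∀ t, f v (-t) = f v t) (hn : 1 ≤ n) : Bd n 0 2 (modul f) := by
  obtain ⟨C, hC, hf⟩ := hb.exists_nonneg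
  refine Bd.mono (n := 1) (k := 0) (p := 2) ⟨3 * C, fun v hv t => ?_⟩ hn le_rfl le_rfl
  have hx : 0 ≤ |t| * v := mul_nonneg (abs_nonneg _) hv.1.le
  refine (abs_modul_le hv hC (hc v hv) (he v hv) (hf v hv) t).trans ?_
  rw [wt, pow_one, pow_zero, mul_one, mul_assoc]
  have := hv.1
  gcongr
  unfold Lg; linarith

/-- Only the function and its first derivative need estimates. The equation expresses the second
derivative through `v² sg modul` and `f`, which raises the number of controlled derivatives by one
at a time. -/
theorem SB_modul (hf : SB 1 1 4 f) (he : ∀ v ∈ Sp, ∀ t, f v (-t) = f v t) :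
    SB 1 0 2 (modul f) ∧ SB 1 1 3 (modul' f) ∧ SB 1 1 4 (modul'' f) := by
  have hc : ∀ v ∈ Sp, Continuous (f v) := fun v hv => (hf.contDiff hv).continuous
  have b0 := Bd_modul hf.bd hc he le_rfl
  have b1 : Bd 1 1 3 (modul' f) := by
    obtain ⟨C, hC, h⟩ := hf.bd.exists_nonneg
    exact ⟨15 * C, fun v hv t => abs_modul'_le hv hC (hc v hv) (he v hv) (h v hv) t⟩
  have s2 : ∀ l, Sb 1 0 l 2 (modul f) → Sb 1 1 l 4 (modul'' f) := fun l h =>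
    Sb.add ((((SB.vpow 2 l).mul ((SB_sg l).mul h)).mono (by simp) (by simp) (by simp)).const_mul
      (-4)) (hf l)
  have key : ∀ l, Sb 1 0 l 2 (modul f) ∧ Sb 1 1 l 3 (modul' f) := by
    intro l
    induction l with
    | zero => exact ⟨b0, b1⟩
    | succ l ih =>
      exact ⟨⟨b0, modul' f, fun v hv t => hasDerivAt_modul hv.1 (hc v hv) t,
        ih.2.mono le_rfl (Nat.zero_le 1) le_rfl⟩, b1, modul'' f,
        fun v hv t => hasDerivAt_modul' hv.1 (hc v hv) t, s2 l ih.1⟩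
  exact ⟨fun l => (key l).1, fun l => (key l).2, fun l => s2 l (key l).1⟩

theorem exists_tendsto_modul (hv : v ∈ Sp) (hf : SB 1 1 4 f)
    (he : ∀ v ∈ Sp, ∀ t, f v (-t) = f v t) : ∃ a, Tendsto (modul f v) atTop (𝓝 a) := by
  have hc := (hf.contDiff hv).continuous
  obtain ⟨C, hC, hq⟩ := (SB_modul hf he).2.1.bd.exists_nonneg
  have hcq : Continuous (modul' f v) := ((SB_modul hf he).2.1.contDiff hv).continuous
  have hv0 := hv.1
  have hi := (tail_bound hv hcq (show 0 ≤ C * v ^ 3 by positivity) (fun t => (hq v hv t).trans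
    (le_of_eq (by rw [wt]; ring))) le_rfl).1
  exact ⟨_, tendsto_limUnder_of_hasDerivAt_of_integrableOn_Ioi (a := 0)
    (fun t _ => hasDerivAt_modul hv0 hc t) hi⟩

theorem Bd.tendsto_zero {n p : ℕ} {c : ℝ → ℝ → ℝ} (h : Bd n 1 p c) (hv : v ∈ Sp) :
    Tendsto (c v) atTop (𝓝 0) := by
  obtain ⟨C, hC, hc⟩ := h.exists_nonneg
  have hv0 := hv.1
  have h1 : Tendsto (fun t => C * v ^ p * (n.factorial / v ^ 2) * Real.exp (-(v * |t|)))
      atTop (𝓝 (C * v ^ p * (n.factorial / v ^ 2) * 0)) :=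
    Tendsto.const_mul _ (Real.tendsto_exp_atBot.comp (tendsto_neg_atTop_atBot.comp
      (Tendsto.const_mul_atTop hv0 tendsto_abs_atTop_atTop)))
  rw [mul_zero] at h1
  refine squeeze_zero_norm (fun t => (hc v hv t).trans ?_) h1
  have h2 := Real.pow_div_factorial_le_exp (Lg v t) (by linarith [one_le_Lg hv t]) n
  rw [div_le_iff₀ (by positivity)] at h2
  have h3 : Real.exp (Lg v t) = Real.exp (v * |t|) / v ^ 2 := by
    rw [Lg, Real.exp_add, Real.exp_log (by positivity), mul_comm |t|]; ring
  have h4 : Real.exp (v * |t|) * ew v t ≤ Real.exp (-(v * |t|)) := by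
    rw [ew, ← Real.exp_add, Real.exp_le_exp]
    have : 0 ≤ |t| * v := by positivity
    nlinarith [sqrt_two_lb]
  have h5 := ew_pos v t
  rw [wt, pow_one]
  calc C * (v ^ p * Lg v t ^ n * ew v t)
      ≤ C * (v ^ p * (Real.exp (Lg v t) * n.factorial) * ew v t) := by gcongr
    _ = C * v ^ p * (n.factorial / v ^ 2) * (Real.exp (v * |t|) * ew v t) := by rw [h3]; ring
    _ ≤ _ := by gcongr

end

/-! ### The modulation `r_v`. -/

/-- The inhomogeneity divided by `‖H01'‖²`. -/
def fN (v t : ℝ) : ℝ := 1 / (∫ x, deriv H01 x ^ 2) * NL v t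

theorem SB_fN : SB 1 1 4 fN := SB_NL.const_mul _

theorem fN_neg (v : ℝ) (_ : v ∈ Sp) (t : ℝ) : fN v (-t) = fN v t := by rw [fN, fN, NL_neg]

/-- The modulation `r_v`. -/
def rv : ℝ → ℝ → ℝ := modul fN

/-- The derivative of `rv`. -/
def rv' : ℝ → ℝ → ℝ := modul' fN

/-- The second derivative of `rv`. -/
def rv'' : ℝ → ℝ → ℝ := modul'' fN

theorem SB_rv : SB 1 0 2 rv := (SB_modul SB_fN fN_neg).1

theorem SB_rv' : SB 1 1 3 rv' := (SB_modul SB_fN fN_neg).2.1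

theorem SB_rv'' : SB 1 1 4 rv'' := (SB_modul SB_fN fN_neg).2.2

theorem hasDerivAt_rv {v : ℝ} (hv : v ∈ Sp) (t : ℝ) : HasDerivAt (rv v) (rv' v t) t :=
  hasDerivAt_modul hv.1 (SB_fN.contDiff hv).continuous t

theorem hasDerivAt_rv' {v : ℝ} (hv : v ∈ Sp) (t : ℝ) : HasDerivAt (rv' v) (rv'' v t) t :=
  hasDerivAt_modul' hv.1 (SB_fN.contDiff hv).continuous t

theorem rv_neg {v : ℝ} (hv : v ∈ Sp) (t : ℝ) : rv v (-t) = rv v t := modul_neg (fN_neg v hv) t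

theorem exists_abs_rv_le : ∃ K, 0 < K ∧
    ∀ v ∈ Sp, ∀ t, |rv v t| ≤ K * (v ^ 2 * Real.log (1 / v)) := by
  obtain ⟨C, hC, h⟩ := SB_fN.bd.exists_nonneg
  refine ⟨6 * C + 1, by positivity, fun v hv t => ?_⟩
  have h1 := abs_modul_le hv hC (SB_fN.contDiff hv).continuous (fN_neg v hv) (h v hv) t
  have h2 : Real.log (1 / v ^ 2) = 2 * Real.log (1 / v) := by
    rw [← one_div_pow, Real.log_pow]; norm_num
  have h3 := one_le_log_Sp hv
  rw [h2] at h1 h3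
  refine h1.trans ?_
  have : 0 ≤ v ^ 2 * Real.log (1 / v) := mul_nonneg (sq_nonneg v) (by linarith)
  nlinarith

theorem rv_equation {v : ℝ} (hv : v ∈ Sp) (t : ℝ) :
    (∫ x, deriv H01 x ^ 2) * iteratedDeriv 2 (rv v) t
      = -32 * Real.exp (-(√2 * d v t)) * (∫ x, deriv H01 x ^ 2) * rv v t + NL v t := by
  have h := integral_deriv_H01_sq_pos
  rw [iteratedDeriv_two_eq (hasDerivAt_rv hv) (hasDerivAt_rv' hv t), rv'', modul'', ← ep,
    ep_eq v t hv.1, fN, ← rv]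
  field_simp
  ring

/-! ### Two-centre terms -/

/-- The coordinate centred at the right kink. -/
def Xc (v t x : ℝ) : ℝ := w0 v t (x + rv v t)

/-- The coordinate centred at the left kink. -/
def Yc (v t x : ℝ) : ℝ := w0 v t (-x + rv v t)

/-- Finite sums of `c(v,t) a(X) b(Y)` with one of `a`, `b` rapidly decreasing. -/
inductive Tm : ℕ → (ℝ → ℝ → ℝ → ℝ) → Prop
  | left {p : ℕ} {c : ℝ → ℝ → ℝ} {a b : ℝ → ℝ} : SB 1 1 p c → Sy a → De b →
      Tm p fun v t x => c v t * (a (Xc v t x) * b (Yc v t x))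
  | right {p : ℕ} {c : ℝ → ℝ → ℝ} {a b : ℝ → ℝ} : SB 1 1 p c → De a → Sy b →
      Tm p fun v t x => c v t * (a (Xc v t x) * b (Yc v t x))
  | add {p : ℕ} {F F' : ℝ → ℝ → ℝ → ℝ} : Tm p F → Tm p F' →
      Tm p fun v t x => F v t x + F' v t x

theorem Tm.of_eq {p : ℕ} {F F' : ℝ → ℝ → ℝ → ℝ} (h : Tm p F) (e : ∀ v t x, F' v t x = F v t x) :
    Tm p F' := by
  rwa [show F' = F from funext fun v => funext fun t => funext (e v t)]

theorem Tm.coef_mul {p : ℕ} {F : ℝ → ℝ → ℝ → ℝ} (h : Tm p F) {e : ℝ → ℝ → ℝ} (he : SB 0 0 0 e) :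
    Tm p fun v t x => e v t * F v t x := by
  induction h with
  | left hc ha hb => exact (Tm.left (he.mul_left hc) ha hb).of_eq fun v t x => by ring
  | right hc ha hb => exact (Tm.right (he.mul_left hc) ha hb).of_eq fun v t x => by ring
  | add _ _ h1 h2 => exact (h1.add h2).of_eq fun v t x => by ring

theorem Tm.const_mul {p : ℕ} {F : ℝ → ℝ → ℝ → ℝ} (h : Tm p F) (c : ℝ) :
    Tm p fun v t x => c * F v t x := h.coef_mul (SB.const c)

theorem Tm.sub {p : ℕ} {F F' : ℝ → ℝ → ℝ → ℝ} (h : Tm p F) (h' : Tm p F') :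
    Tm p fun v t x => F v t x - F' v t x :=
  (h.add (h'.const_mul (-1))).of_eq fun v t x => by ring

theorem Tm.mul_X {p : ℕ} {F : ℝ → ℝ → ℝ → ℝ} (h : Tm p F) {s : ℝ → ℝ} (hs : Sy s) :
    Tm p fun v t x => s (Xc v t x) * F v t x := by
  induction h with
  | left hc ha hb => exact (Tm.left hc (hs.mul ha) hb).of_eq fun v t x => by ring
  | right hc ha hb => exact (Tm.right hc (ha.mul_sy hs) hb).of_eq fun v t x => by ring
  | add _ _ h1 h2 => exact (h1.add h2).of_eq fun v t x => by ring

theorem Tm.mul_Y {p : ℕ} {F : ℝ → ℝ → ℝ → ℝ} (h : Tm p F) {s : ℝ → ℝ} (hs : Sy s) :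
    Tm p fun v t x => s (Yc v t x) * F v t x := by
  induction h with
  | left hc ha hb => exact (Tm.left hc ha (hb.mul_sy hs)).of_eq fun v t x => by ring
  | right hc ha hb => exact (Tm.right hc ha (hs.mul hb)).of_eq fun v t x => by ring
  | add _ _ h1 h2 => exact (h1.add h2).of_eq fun v t x => by ring

theorem Xc_neg (v t x : ℝ) : Xc v t (-x) = Yc v t x := rfl

theorem Yc_neg (v t x : ℝ) : Yc v t (-x) = Xc v t x := by rw [Yc, Xc, neg_neg]

theorem Tm.swap {p : ℕ} {F : ℝ → ℝ → ℝ → ℝ} (h : Tm p F) : Tm p fun v t x => F v t (-x) := by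
  induction h with
  | left hc ha hb => exact (Tm.right hc hb ha).of_eq fun v t x => by simp only [Xc_neg, Yc_neg]; ring
  | right hc ha hb => exact (Tm.left hc hb ha).of_eq fun v t x => by simp only [Xc_neg, Yc_neg]; ring
  | add _ _ h1 h2 => exact h1.add h2

theorem Sep.tm {p : ℕ} {F : ℝ → ℝ → ℝ → ℝ} (h : Sep 1 p F) :
    Tm p fun v t x => F v t (Xc v t x) := by
  induction h with
  | base hc hb => exact (Tm.right hc hb (Sy.const 1)).of_eq fun v t x => by ring
  | add _ _ h1 h2 => exact h1.add h2

section
variable {v : ℝ}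

theorem hasDerivAt_Xc_t (hv : v ∈ Sp) (t x : ℝ) : HasDerivAt (fun τ => Xc v τ x)
    (al v t * Xc v t x + be rv' v t) t :=
  hasDerivAt_w0_t (p := rv) hv (hasDerivAt_rv hv) t x

theorem hasDerivAt_Yc_t (hv : v ∈ Sp) (t x : ℝ) : HasDerivAt (fun τ => Yc v τ x)
    (al v t * Yc v t x + be rv' v t) t :=
  hasDerivAt_w0_t (p := rv) hv (hasDerivAt_rv hv) t (-x)

theorem hasDerivAt_Xc_x (hv : v ∈ Sp) (t x : ℝ) : HasDerivAt (fun y => Xc v t y) (ga v t) x :=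
  hasDerivAt_w0_x hv t (rv v t) x

theorem hasDerivAt_Yc_x (hv : v ∈ Sp) (t x : ℝ) : HasDerivAt (fun y => Yc v t y) (-ga v t) x :=
  hasDerivAt_w0_neg hv t (rv v t) x

end

/-- Both `al` and `be` supply the factor `v`. The unbounded factor `X` or `Y` in `∂ₜ X`, `∂ₜ Y`
always meets the derivative of the profile in the same variable; this derivative is rapidly
decreasing and absorbs it. -/
theorem Tm.dt {p : ℕ} {F : ℝ → ℝ → ℝ → ℝ} (h : Tm p F) : ∃ F', Tm (p + 1) F' ∧
    ∀ v ∈ Sp, ∀ t x, HasDerivAt (fun τ => F v τ x) (F' v t x) t := by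
  have hal {p : ℕ} {c : ℝ → ℝ → ℝ} (hc : SB 1 1 p c) : SB 1 1 (p + 1) fun v t => c v t * al v t :=
    (hc.mul SB_al).mono (by simp) (by simp) (by simp)
  have hbe {p : ℕ} {c : ℝ → ℝ → ℝ} (hc : SB 1 1 p c) :
      SB 1 1 (p + 1) fun v t => c v t * be rv' v t := hc.mul (SB_be SB_rv')
  have hder {c c' : ℝ → ℝ → ℝ} {a a' b b' : ℝ → ℝ}
      (hc : ∀ v ∈ Sp, ∀ t, HasDerivAt (c v) (c' v t) t) (ha : ∀ x, HasDerivAt a (a' x) x)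
      (hb : ∀ x, HasDerivAt b (b' x) x) : ∀ v ∈ Sp, ∀ t x, HasDerivAt
        (fun τ => c v τ * (a (Xc v τ x) * b (Yc v τ x)))
        (c' v t * (a (Xc v t x) * b (Yc v t x)) + (
          (c v t * al v t * ((Xc v t x * a' (Xc v t x)) * b (Yc v t x))
          + c v t * be rv' v t * (a' (Xc v t x) * b (Yc v t x)))
          + (c v t * al v t * (a (Xc v t x) * (Yc v t x * b' (Yc v t x)))
          + c v t * be rv' v t * (a (Xc v t x) * b' (Yc v t x))))) t := fun v hv t x =>
    ((hc v hv t).fun_mul (((ha _).comp t (hasDerivAt_Xc_t hv t x)).fun_mul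
      ((hb _).comp t (hasDerivAt_Yc_t hv t x)))).congr_deriv (by
        simp only [Function.comp_apply]; ring)
  induction h with
  | left hc ha hb =>
    obtain ⟨c', hdc, hc'⟩ := hc.hasDeriv
    obtain ⟨a', ha', hda⟩ := ha.hasDeriv
    obtain ⟨b', hb', hdb⟩ := hb.hasDeriv
    exact ⟨_, (Tm.left hc' ha hb).add (((Tm.left (hal hc) ha'.id_mul.sy hb).add
      (Tm.left (hbe hc) ha'.sy hb)).add ((Tm.left (hal hc) ha hb'.id_mul).add
      (Tm.left (hbe hc) ha hb'))), hder hdc hda hdb⟩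
  | right hc ha hb =>
    obtain ⟨c', hdc, hc'⟩ := hc.hasDeriv
    obtain ⟨a', ha', hda⟩ := ha.hasDeriv
    obtain ⟨b', hb', hdb⟩ := hb.hasDeriv
    exact ⟨_, (Tm.right hc' ha hb).add (((Tm.right (hal hc) ha'.id_mul hb).add
      (Tm.right (hbe hc) ha' hb)).add ((Tm.right (hal hc) ha hb'.id_mul.sy).add
      (Tm.right (hbe hc) ha hb'.sy))), hder hdc hda hdb⟩
  | add _ _ h1 h2 =>
    obtain ⟨F1, t1, d1⟩ := h1
    obtain ⟨F2, t2, d2⟩ := h2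
    exact ⟨_, t1.add t2, fun v hv t x => (d1 v hv t x).fun_add (d2 v hv t x)⟩

theorem Tm.dx {p : ℕ} {F : ℝ → ℝ → ℝ → ℝ} (h : Tm p F) : ∃ F', Tm p F' ∧
    ∀ v ∈ Sp, ∀ t x, HasDerivAt (F v t) (F' v t x) x := by
  have hga {p : ℕ} {c : ℝ → ℝ → ℝ} (hc : SB 1 1 p c) : SB 1 1 p fun v t => ga v t * c v t :=
    SB_ga.mul_left hc
  have hder {c : ℝ → ℝ → ℝ} {a a' b b' : ℝ → ℝ} (ha : ∀ x, HasDerivAt a (a' x) x)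
      (hb : ∀ x, HasDerivAt b (b' x) x) : ∀ v ∈ Sp, ∀ t x, HasDerivAt
        (fun y => c v t * (a (Xc v t y) * b (Yc v t y)))
        (ga v t * c v t * (a' (Xc v t x) * b (Yc v t x))
          - ga v t * c v t * (a (Xc v t x) * b' (Yc v t x))) x := fun v hv t x =>
    ((((ha _).comp x (hasDerivAt_Xc_x hv t x)).fun_mul
      ((hb _).comp x (hasDerivAt_Yc_x hv t x))).const_mul (c v t)).congr_deriv (by
        simp only [Function.comp_apply]; ring)
  induction h with
  | left hc ha hb =>
    obtain ⟨a', ha', hda⟩ := ha.hasDeriv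
    obtain ⟨b', hb', hdb⟩ := hb.hasDeriv
    exact ⟨_, (Tm.left (hga hc) ha'.sy hb).sub (Tm.left (hga hc) ha hb'), hder hda hdb⟩
  | right hc ha hb =>
    obtain ⟨a', ha', hda⟩ := ha.hasDeriv
    obtain ⟨b', hb', hdb⟩ := hb.hasDeriv
    exact ⟨_, (Tm.right (hga hc) ha' hb).sub (Tm.right (hga hc) ha hb'.sy), hder hda hdb⟩
  | add _ _ h1 h2 =>
    obtain ⟨F1, t1, d1⟩ := h1
    obtain ⟨F2, t2, d2⟩ := h2
    exact ⟨_, t1.add t2, fun v hv t x => (d1 v hv t x).fun_add (d2 v hv t x)⟩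

/-! ### The error of the ansatz -/

/-- Multipliers of the classes `Tm p`. -/
def Mu (e : ℝ → ℝ → ℝ → ℝ) : Prop := ∀ p F, Tm p F → Tm p fun v t x => e v t x * F v t x

theorem Mu.add {e e' : ℝ → ℝ → ℝ → ℝ} (h : Mu e) (h' : Mu e') :
    Mu fun v t x => e v t x + e' v t x := fun p F hF =>
  ((h p F hF).add (h' p F hF)).of_eq fun v t x => by ring

theorem Mu.mul {e e' : ℝ → ℝ → ℝ → ℝ} (h : Mu e) (h' : Mu e') :
    Mu fun v t x => e v t x * e' v t x := fun p F hF =>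
  (h p _ (h' p F hF)).of_eq fun v t x => by ring

theorem Mu.const (c : ℝ) : Mu fun _ _ _ => c := fun _ _ hF => hF.const_mul c

theorem Mu.sub {e e' : ℝ → ℝ → ℝ → ℝ} (h : Mu e) (h' : Mu e') :
    Mu fun v t x => e v t x - e' v t x := fun p F hF =>
  ((h p F hF).sub (h' p F hF)).of_eq fun v t x => by ring

theorem Mu.pow {e : ℝ → ℝ → ℝ → ℝ} (h : Mu e) : ∀ n : ℕ, Mu fun v t x => e v t x ^ n
  | 0 => fun _ _ hF => hF.of_eq fun v t x => by ring
  | n + 1 => fun p F hF => ((Mu.pow h n).mul h p F hF).of_eq fun v t x => by ring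

/-! ### The strength of the interaction between the kinks. -/

/-- The exponent with `e^{√2 (X + Y)} = e^{-√2 d} e^{E1}`. -/
def E1 (v t : ℝ) : ℝ := E0 v t + 2 * √2 * (ga v t * rv v t)

/-- The factor `e^{√2 (X + Y)}`. -/
def qf (v t : ℝ) : ℝ := ep v t * Real.exp (E1 v t)

theorem exp_Xc_mul_exp_Yc {v : ℝ} (hv : v ∈ Sp) (t x : ℝ) :
    Real.exp (√2 * Xc v t x) * Real.exp (√2 * Yc v t x) = qf v t := by
  rw [qf, ep, ← Real.exp_add, ← Real.exp_add, Xc, Yc, w0_eq hv, w0_eq hv, E1, E0]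
  congr 1; ring

/-- Since `X + Y` is independent of `x`, overlap of the kinks converts into a small coefficient,
uniformly in space. -/
theorem H01_Xc_mul_H01_Yc {v : ℝ} (hv : v ∈ Sp) (t x : ℝ) : H01 (Xc v t x) * H01 (Yc v t x)
    = qf v t * rho (Xc v t x) * rho (Yc v t x) := by
  rw [H01_eq, H01_eq, ← exp_Xc_mul_exp_Yc hv t x]; ring

theorem SB_exp_E1 : SB 0 0 0 (fun v t => Real.exp (E1 v t)) ∧
    SB 1 0 2 fun v t => Real.exp (E1 v t) - 1 := by
  obtain ⟨C, hC, hr⟩ := exists_abs_rv_le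
  have h1 : SB 1 0 2 E1 := SB_E0.add ((SB_ga.mul_left SB_rv).const_mul (2 * √2))
  have hd : ∀ v ∈ Sp, ∀ t, HasDerivAt (E1 v) (E0' v t + 2 * √2 *
      (al v t * ga v t * rv v t + ga v t * rv' v t)) t := fun v hv t =>
    (hasDerivAt_E0 hv t).fun_add
      (((hasDerivAt_ga' hv t).fun_mul (hasDerivAt_rv hv t)).const_mul (2 * √2))
  have h2 : SB 0 0 1 fun v t => al v t * ga v t * rv v t := by
    have := ((SB_al.mul SB_ga).mul SB_rv).mono (n' := 1) (k' := 1) (p' := 3) (by simp) (by simp)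
      (by simp)
    exact this.absorb
  refine SB_exp (M := 2 * √2 * (2 * C)) h1 hd
    (SB_E0'.add ((h2.add (SB_ga.mul_left SB_rv'.absorb)).const_mul (2 * √2))) fun v hv t => ?_
  have h3 := E0_nonpos hv t
  have h4 : rv v t ≤ C := by
    refine (le_abs_self _).trans ((hr v hv t).trans ?_)
    have hv0 := hv.1
    -- The bound `v² ln (1/v)` on `rv` is needed here only as uniform boundedness, to bound `E1`
    -- from above.
    have h5 : v * Real.log (1 / v) ≤ 1 := by
      have := Real.log_le_sub_one_of_pos (show 0 < 1 / v by positivity)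
      calc v * Real.log (1 / v) ≤ v * (1 / v - 1) := by gcongr
        _ = 1 - v := by field_simp
        _ ≤ 1 := by linarith
    have h6 : v ^ 2 * Real.log (1 / v) ≤ 1 := by
      rw [sq, mul_assoc]
      nlinarith [hv.2]
    nlinarith
  have h7 : ga v t * rv v t ≤ 2 * C := by
    have h8 := ga_pos hv t
    calc ga v t * rv v t ≤ ga v t * C := by gcongr
      _ ≤ 2 * C := by gcongr; exact ga_le_two hv t
  have h9 : 2 * √2 * (ga v t * rv v t) ≤ 2 * √2 * (2 * C) := by gcongr
  unfold E1; linarith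

theorem SB_qf : SB 0 1 2 qf := SB_ep.mul SB_exp_E1.1

/-- The correction is tuned to the force `e^{-√2 d}`, while the true one is `e^{√2 (X + Y)}`.
Lorentz contraction and modulation change the exponent by `O(v² Lg)` only. -/
theorem SB_qf_sub : SB 1 1 4 fun v t => qf v t - ep v t :=
  (SB_ep.mul SB_exp_E1.2).congr fun v _ t => by rw [qf]; ring

theorem SB_ep_qf : SB 0 1 4 fun v t => ep v t * qf v t :=
  (SB_ep.mul SB_qf).mono le_rfl (by simp) le_rfl

/-- `X + Y`. -/
def sumXY (v t : ℝ) : ℝ := ga v t * (2 * rv v t - d v t)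

theorem Xc_add_Yc {v : ℝ} (hv : v ∈ Sp) (t x : ℝ) : Xc v t x = sumXY v t - Yc v t x := by
  rw [Xc, Yc, w0_eq hv, w0_eq hv, sumXY]; ring

theorem SB_sumXY : SB 1 0 0 sumXY :=
  SB_ga.mul_left (((SB_rv.mono le_rfl le_rfl (Nat.zero_le 2)).const_mul 2).sub SB_d)

/-- The interaction of the right kink and its correction with the left kink. -/
def P1 (v t x : ℝ) : ℝ :=
  (24 - 30 * H01 (Xc v t x) ^ 2) * H01 (Xc v t x) * (H01 (Xc v t x) * H01 (Yc v t x))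
    - ep v t * (24 - 30 * H01 (Xc v t x) ^ 2) * H01 (Xc v t x) * rho (Xc v t x)
    + 60 * H01 (Xc v t x) * (H01 (Xc v t x) * H01 (Yc v t x)) ^ 2
    + ep v t * G (Xc v t x) * (H01 (Xc v t x) * H01 (Yc v t x) * (48 - 120 * H01 (Xc v t x) ^ 2
        + 180 * (H01 (Xc v t x) * H01 (Yc v t x)) - 120 * H01 (Yc v t x) ^ 2)
      + H01 (Yc v t x) ^ 2 * (-24 + 30 * H01 (Yc v t x) ^ 2))

theorem exists_Tm_P1 : ∃ F, Tm 4 F ∧ ∀ v ∈ Sp, ∀ t x, P1 v t x = F v t x := by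
  have hH := Sy.H01
  have hr := Sy.rho
  have h24 : Sy fun x => 24 - 30 * H01 x ^ 2 := (Sy.const 24).sub ((hH.pow 2).const_mul 30)
  have h24' : Sy fun x => -24 + 30 * H01 x ^ 2 := (Sy.const (-24)).add ((hH.pow 2).const_mul 30)
  have c1 := SB_qf_sub
  have c2 : SB 1 1 4 fun v t => ep v t * qf v t := SB_ep_qf.mono (by simp) le_rfl le_rfl
  have c3 : SB 1 1 4 fun v t => qf v t * qf v t :=
    (SB_qf.mul SB_qf).mono (by simp) (by simp) (by simp)
  have c4 : SB 1 1 4 fun v t => ep v t * qf v t * sumXY v t := SB_ep_qf.mul SB_sumXY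
  -- `t1` and `t2` come from `q b - ε = (q - ε) b - ε (1 - b)` with `b = rho Y`; the vanishing of `1
  -- - b` supplies an `H01 Y` that pairs with `H01 X` into a second factor `q`.
  have t1 := Tm.right c1 (De.Hr_mul h24) hr
  have t2 := Tm.left c2 (h24.mul (hr.pow 2)) (De.Hr_mul Sy.om)
  have t3 := (Tm.right c3 (De.Hr_mul hr) (hr.pow 2)).const_mul 60
  have t4 := (Tm.right c2 (De_G.mul_sy hr) hr)
  have t5 := ((((Tm.right c2 (De_G.mul_sy hr) hr).const_mul 48).add
    ((t4.mul_X (hH.pow 2)).const_mul (-120))).add (((t4.mul_X hH).mul_Y hH).const_mul 180)).add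
    ((t4.mul_Y (hH.pow 2)).const_mul (-120))
  have t6 := Tm.left c2 ((hr.pow 2).mul Sy_Gs) (De.Hr_mul h24')
  have t7 := (Tm.left c4 (hr.pow 3) (De.Hr_mul h24')).const_mul (2 * √2)
  have t8 := (Tm.left c2 (hr.pow 3) (De.Hr_mul h24').id_mul).const_mul (2 * √2)
  refine ⟨_, (((t1.sub t2).add t3).add t5).add ((t6.add t7).sub t8), fun v hv t x => ?_⟩
  have e1 := H01_Xc_mul_H01_Yc hv t x
  have e2 := Xc_add_Yc hv t x
  have e3 := one_sub_rho (Yc v t x)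
  have e4 := G_eq_Gs (Xc v t x)
  -- Spending the `H01 X` contained in `𝒢(X)` on the factor `q` leaves `X rho(X)`, unbounded at
  -- `-∞`. Writing `X = (X + Y) - Y` moves the growth to `Y`, where `H01 rho` absorbs it, at the
  -- price of one `Lg` from `X + Y`.
  have e5 : G (Xc v t x) * H01 (Yc v t x) ^ 2 = qf v t * rho (Xc v t x) ^ 2 * rho (Yc v t x)
      * H01 (Yc v t x) * (Gs (Xc v t x)
        + 2 * √2 * (sumXY v t - Yc v t x) * rho (Xc v t x)) := by
    rw [e4, ← e2]
    linear_combination (H01 (Yc v t x) * rho (Xc v t x) * (Gs (Xc v t x)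
      + 2 * √2 * Xc v t x * rho (Xc v t x))) * e1
  rw [P1]
  generalize Xc v t x = X at *
  generalize Yc v t x = Y at *
  generalize sumXY v t = S at *
  generalize G X = g at *
  generalize Gs X = gs at *
  generalize ep v t = ε at *
  generalize qf v t = q at *
  generalize H01 X = h at *
  generalize H01 Y = k at *
  generalize rho X = a at *
  generalize rho Y = b at *
  generalize om Y = o at *
  rw [e1]
  linear_combination (ε * (-24 + 30 * k ^ 2)) * e5 - ε * (24 - 30 * h ^ 2) * h * a * e3
    - (ε * (24 - 30 * h ^ 2) * a * k * o) * e1 - 180 * ε * g * q * a * b * e1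

theorem HasBox.ansatz {v : ℝ} (hv : v ∈ Sp) :
    HasBox (PhiSix.ansatz v (rv v)) fun t x =>
      (-H'' (Xc v t x) - √2 * v ^ 2 * sg v t * H' (Xc v t x) + PH rv' rv'' v t (Xc v t x))
      - (-H'' (Yc v t x) - √2 * v ^ 2 * sg v t * H' (Yc v t x) + PH rv' rv'' v t (Yc v t x))
      + ((-(ep v t * G'' (Xc v t x)) + PG rv' rv'' v t (Xc v t x))
      - (-(ep v t * G'' (Yc v t x)) + PG rv' rv'' v t (Yc v t x))) := by
  have h1 := hasBox_H hv (hasDerivAt_rv' hv) (hasDerivAt_Xc_t hv) (hasDerivAt_Xc_x hv) fun _ => rfl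
  have h2 := hasBox_H hv (hasDerivAt_rv' hv) (hasDerivAt_Yc_t hv) (hasDerivAt_Yc_x hv)
    fun _ => neg_sq _
  have h3 := hasBox_G hv (hasDerivAt_rv' hv) (hasDerivAt_Xc_t hv) (hasDerivAt_Xc_x hv) fun _ => rfl
  have h4 := hasBox_G hv (hasDerivAt_rv' hv) (hasDerivAt_Yc_t hv) (hasDerivAt_Yc_x hv)
    fun _ => neg_sq _
  convert (h1.sub h2).add (h3.sub h4) using 3 with t x
  simp only [PhiSix.ansatz, Xc, Yc, ep]
  ring

/-- The correction part of the ansatz. -/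
def mG (v t x : ℝ) : ℝ := ep v t * (G (Xc v t x) - G (Yc v t x))

/-- The kink part of the ansatz. -/
def pH (v t x : ℝ) : ℝ := H01 (Xc v t x) - H01 (Yc v t x)

/-- The terms of `U'` that are at least quadratic in the correction. -/
def QG (v t x : ℝ) : ℝ := mG v t x ^ 2 * (-8 * (3 * pH v t x + mG v t x)
  + 6 * (10 * pH v t x ^ 3 + 10 * pH v t x ^ 2 * mG v t x + 5 * pH v t x * mG v t x ^ 2
    + mG v t x ^ 3))

/-- Two factors `ep` give the order `v⁴`, one factor `G(X) - G(Y)` gives the decay, and everything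
else acts as a bounded multiplier. -/
theorem Tm_QG : Tm 4 QG := by
  have mX {s : ℝ → ℝ} (hs : Sy s) : Mu fun v t x => s (Xc v t x) := fun _ _ hF => hF.mul_X hs
  have mY {s : ℝ → ℝ} (hs : Sy s) : Mu fun v t x => s (Yc v t x) := fun _ _ hF => hF.mul_Y hs
  have me : Mu fun v t _ => ep v t := fun _ _ hF =>
    hF.coef_mul (SB_ep.mono le_rfl (Nat.zero_le 1) (Nat.zero_le 2))
  have mg := (mX Sy_G).sub (mY Sy_G)
  have mm := me.mul mg
  have mp := (mX Sy.H01).sub (mY Sy.H01)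
  have hc : SB 1 1 4 fun v t => ep v t ^ 2 :=
    ((SB_ep.mul SB_ep).mono (by simp) (by simp) (by simp)).congr fun v _ t => by ring
  have t0 := (Tm.right hc De_G (Sy.const 1)).sub (Tm.left hc (Sy.const 1) De_G)
  have mQ := ((((Mu.const 3).mul mp).add mm).pow 1 |>.mul (Mu.const (-8))).add
    ((Mu.const 6).mul (((((Mu.const 10).mul (mp.pow 3)).add
      (((Mu.const 10).mul (mp.pow 2)).mul mm)).add (((Mu.const 5).mul mp).mul (mm.pow 2))).add
      (mm.pow 3)))
  refine (mQ _ _ (mg _ _ t0)).of_eq fun v t x => ?_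
  rw [QG, mG, pH]
  ring

/-- In `-ep G''` the term `8√2 ep H'` cancels the acceleration, `-ep U''(H) G` cancels the
linearisation of `U'` at a single kink, and the exponential source becomes the second term of `P1`,
since `e^{-√2 X} H01(X) = rho(X)`. What remains is a polynomial identity in the profile values. -/
theorem Lam_ansatz_eq {v : ℝ} (hv : v ∈ Sp) (t x : ℝ) : Lam (ansatz v (rv v)) t x
    = (PH rv' rv'' v t (Xc v t x) + PG rv' rv'' v t (Xc v t x) + P1 v t x)
      - (PH rv' rv'' v t (Xc v t (-x)) + PG rv' rv'' v t (Xc v t (-x)) + P1 v t (-x))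
      + QG v t x := by
  have e0 : ansatz v (rv v) t x = pH v t x + mG v t x := rfl
  have e1 := ep_eq v t hv.1
  have e2 := expm_neg_mul_H01 (Xc v t x)
  have e3 := expm_neg_mul_H01 (Yc v t x)
  rw [Lam, (HasBox.ansatz hv).box_eq, e0, deriv_U, QG, P1, P1, mG, pH, Xc_neg, Yc_neg, G'', G'',
    H'', H'', deriv_U, deriv_U, iteratedDeriv_two_U, iteratedDeriv_two_U,
    (hasDerivAt_H01 _).deriv, (hasDerivAt_H01 _).deriv, ← H', ← H']
  generalize PH rv' rv'' v t (Xc v t x) = p1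
  generalize PH rv' rv'' v t (Yc v t x) = p2
  generalize PG rv' rv'' v t (Xc v t x) = p3
  generalize PG rv' rv'' v t (Yc v t x) = p4
  generalize H' (Xc v t x) = d1
  generalize H' (Yc v t x) = d2
  generalize G (Xc v t x) = g
  generalize G (Yc v t x) = j
  generalize H01 (Xc v t x) = h at *
  generalize H01 (Yc v t x) = k at *
  generalize rho (Xc v t x) = a at *
  generalize rho (Yc v t x) = b at *
  generalize Real.exp (-(√2 * Xc v t x)) = u at *
  generalize Real.exp (-(√2 * Yc v t x)) = w at *
  generalize ep v t = ε at *
  linear_combination (8 * √2 * (d1 - d2)) * e1 - ε * (24 * h - 30 * h ^ 3) * e2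
    + ε * (24 * k - 30 * k ^ 3) * e3

/-- The error of the ansatz is a sum of two-centre terms of order `v⁴`. -/
theorem exists_Tm_Lam : ∃ F, Tm 4 F ∧ ∀ v ∈ Sp, ∀ t x, Lam (ansatz v (rv v)) t x = F v t x := by
  obtain ⟨F, hF, h⟩ := exists_Tm_P1
  have h1 := ((Sep_PH SB_rv' SB_rv'').tm.add (Sep_PG SB_rv' SB_rv'').tm).add hF
  refine ⟨_, (h1.sub h1.swap).add Tm_QG, fun v hv t x => ?_⟩
  rw [Lam_ansatz_eq hv, h v hv, h v hv]

/-! ### Sobolev norms of two-centre terms -/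

theorem integral_abs_comp_affine {g : ℝ → ℝ} (hg : Integrable g) {a : ℝ} (ha : a ≠ 0) (b : ℝ) :
    Integrable (fun x => g (a * x + b)) ∧ ∫ x, |g (a * x + b)| = |a⁻¹| * ∫ x, |g x| := by
  have e : ∀ x, a * x + b = a * (x + b / a) := fun x => by field_simp
  simp only [e]
  refine ⟨(hg.comp_mul_left' ha).comp_add_right (b / a), ?_⟩
  rw [integral_add_right_eq_self (fun x => |g (a * x)|),
    Measure.integral_comp_mul_left (fun x => |g x|) a, smul_eq_mul]

theorem Xc_eq {v : ℝ} (hv : v ∈ Sp) (t x : ℝ) :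
    Xc v t x = ga v t * x + ga v t * (rv v t - d v t / 2) := by
  rw [Xc, w0_eq hv]; ring

theorem Yc_eq {v : ℝ} (hv : v ∈ Sp) (t x : ℝ) :
    Yc v t x = -ga v t * x + ga v t * (rv v t - d v t / 2) := by
  rw [Yc, w0_eq hv]; ring

theorem abs_inv_ga_le {v : ℝ} (hv : v ∈ Sp) (t : ℝ) : |(ga v t)⁻¹| ≤ 1 := by
  rw [abs_of_pos (inv_pos.2 (ga_pos hv t))]
  exact inv_le_one_of_one_le₀ (one_le_ga hv t)

theorem integrable_Xc {v : ℝ} (hv : v ∈ Sp) (t : ℝ) {b : ℝ → ℝ} (hb : De b) :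
    Integrable (fun x => b (Xc v t x)) ∧ ∫ x, |b (Xc v t x)| ≤ ∫ x, |b x| := by
  simp only [Xc_eq hv]
  obtain ⟨h1, h2⟩ := integral_abs_comp_affine hb.integrable (ga_pos hv t).ne'
    (ga v t * (rv v t - d v t / 2))
  refine ⟨h1, h2.trans_le ?_⟩
  exact mul_le_of_le_one_left (integral_nonneg fun x => abs_nonneg _) (abs_inv_ga_le hv t)

theorem integrable_Yc {v : ℝ} (hv : v ∈ Sp) (t : ℝ) {b : ℝ → ℝ} (hb : De b) :
    Integrable (fun x => b (Yc v t x)) ∧ ∫ x, |b (Yc v t x)| ≤ ∫ x, |b x| := by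
  simp only [Yc_eq hv]
  obtain ⟨h1, h2⟩ := integral_abs_comp_affine hb.integrable (neg_ne_zero.2 (ga_pos hv t).ne')
    (ga v t * (rv v t - d v t / 2))
  refine ⟨h1, h2.trans_le ?_⟩
  refine mul_le_of_le_one_left (integral_nonneg fun x => abs_nonneg _) ?_
  rw [inv_neg, abs_neg]; exact abs_inv_ga_le hv t

theorem Tm.continuous {p : ℕ} {F : ℝ → ℝ → ℝ → ℝ} (h : Tm p F) {v : ℝ} (hv : v ∈ Sp) (t : ℝ) :
    Continuous (F v t) := by
  obtain ⟨F', _, hd⟩ := h.dx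
  exact continuous_iff_continuousAt.2 fun x => (hd v hv t x).continuousAt

/-- One profile is bounded; the change of variables for the decaying one has Jacobian `1/γ ≤ 1`, so
its `L¹` norm is controlled uniformly in `v` and `t`. -/
theorem Tm.integral_le {p : ℕ} {F : ℝ → ℝ → ℝ → ℝ} (h : Tm p F) : ∃ C, 0 ≤ C ∧ ∀ v ∈ Sp, ∀ t,
    Integrable (F v t) ∧ ∫ x, |F v t x| ≤ C * wt 1 1 p v t := by
  have key {c : ℝ → ℝ → ℝ} {a b : ℝ → ℝ} {Ca Cc v t : ℝ} {p : ℕ} {z y : ℝ → ℝ}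
      (hCa : ∀ x, |a x| ≤ Ca) (hCc : |c v t| ≤ Cc * wt 1 1 p v t) (hv : v ∈ Sp)
      (hb : Integrable (fun x => b (z x)) ∧ ∫ x, |b (z x)| ≤ ∫ x, |b x|)
      (hcont : Continuous fun x => c v t * (a (y x) * b (z x))) :
      Integrable (fun x => c v t * (a (y x) * b (z x))) ∧
      ∫ x, |c v t * (a (y x) * b (z x))| ≤ Cc * Ca * (∫ x, |b x|) * wt 1 1 p v t := by
    have hp : ∀ x, |c v t * (a (y x) * b (z x))| ≤ Cc * wt 1 1 p v t * Ca * |b (z x)| := fun x => by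
      rw [abs_mul, abs_mul, mul_assoc (Cc * _)]
      exact mul_le_mul hCc (mul_le_mul_of_nonneg_right (hCa _) (abs_nonneg _))
        (by positivity) ((abs_nonneg _).trans hCc)
    have hi := hb.1.abs.const_mul (Cc * wt 1 1 p v t * Ca)
    have hI : Integrable (fun x => c v t * (a (y x) * b (z x))) :=
      hi.mono' hcont.aestronglyMeasurable (ae_of_all _ hp)
    refine ⟨hI, (integral_mono hI.abs hi hp).trans ?_⟩
    have h0 : 0 ≤ Cc * wt 1 1 p v t * Ca :=
      mul_nonneg ((abs_nonneg _).trans hCc) ((abs_nonneg _).trans (hCa 0))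
    rw [integral_const_mul]
    calc _ ≤ Cc * wt 1 1 p v t * Ca * ∫ x, |b x| := mul_le_mul_of_nonneg_left hb.2 h0
      _ = _ := by ring
  induction h with
  | left hc ha hb =>
    obtain ⟨Ca, hCa⟩ := ha.bounded
    obtain ⟨Cc, h0, hCc⟩ := hc.bd.exists_nonneg
    have h1 : 0 ≤ Ca := (abs_nonneg _).trans (hCa 0)
    exact ⟨_, mul_nonneg (mul_nonneg h0 h1) (integral_nonneg fun x => abs_nonneg _),
      fun v hv t => key hCa (hCc v hv t) hv (integrable_Yc hv t hb)
        ((Tm.left hc ha hb).continuous hv t)⟩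
  | @right c a b hc ha hb =>
    obtain ⟨Ca, hCa⟩ := hb.bounded
    obtain ⟨Cc, h0, hCc⟩ := hc.bd.exists_nonneg
    have h1 : 0 ≤ Ca := (abs_nonneg _).trans (hCa 0)
    refine ⟨Cc * Ca * ∫ x, |a x|, mul_nonneg (mul_nonneg h0 h1)
      (integral_nonneg fun x => abs_nonneg _), fun v hv t => ?_⟩
    have hcont := (Tm.right hc ha hb).continuous hv t
    simp only [mul_comm (a _)] at hcont ⊢
    exact key hCa (hCc v hv t) hv (integrable_Xc hv t ha) hcont
  | add _ _ h1 h2 =>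
    obtain ⟨C, hC0, hC⟩ := h1
    obtain ⟨D, hD0, hD⟩ := h2
    refine ⟨C + D, by positivity, fun v hv t => ?_⟩
    obtain ⟨i1, b1⟩ := hC v hv t
    obtain ⟨i2, b2⟩ := hD v hv t
    refine ⟨i1.add i2, ?_⟩
    calc _ ≤ ∫ x, (|_| + |_|) := integral_mono (i1.add i2).abs (i1.abs.add i2.abs)
          fun x => abs_add_le _ _
      _ = _ := integral_add i1.abs i2.abs
      _ ≤ _ := add_le_add b1 b2
      _ = _ := by ring

theorem pow_mul_exp_neg_le (k : ℕ) {S x y : ℝ} (hS : 0 ≤ S) (h : |x| ≤ S + |y|) :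
    |x| ^ k * Real.exp (-|y|) ≤ (1 + S) ^ k * (k.factorial * Real.exp 1) := by
  have h1 := Real.pow_div_factorial_le_exp (1 + |y|) (by positivity) k
  rw [div_le_iff₀ (by positivity)] at h1
  have h2 : |x| ≤ (1 + S) * (1 + |y|) := by nlinarith [abs_nonneg y]
  calc |x| ^ k * Real.exp (-|y|) ≤ ((1 + S) * (1 + |y|)) ^ k * Real.exp (-|y|) := by gcongr
    _ = (1 + S) ^ k * ((1 + |y|) ^ k * Real.exp (-|y|)) := by rw [mul_pow]; ring
    _ ≤ (1 + S) ^ k * (Real.exp (1 + |y|) * k.factorial * Real.exp (-|y|)) := by gcongr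
    _ = (1 + S) ^ k * (k.factorial * Real.exp (1 + |y| + -|y|)) := by
        rw [Real.exp_add _ (-|y|)]; ring
    _ = _ := by simp

/-- Purely qualitative: the constant depends on `v` and `t`. It serves only to place the terms in
the Schwartz space, where the Plancherel transform in `normHs` is given by the Fourier integral. -/
theorem Tm.pow_mul_le {p : ℕ} {F : ℝ → ℝ → ℝ → ℝ} (h : Tm p F) {v : ℝ} (hv : v ∈ Sp) (t : ℝ)
    (k : ℕ) : ∃ C, ∀ x, |x| ^ k * |F v t x| ≤ C := by
  have hg := one_le_ga hv t
  set S := |rv v t - d v t / 2|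
  have hX : ∀ x, |x| ≤ S + |Xc v t x| := fun x => by
    have e : Xc v t x / ga v t - (rv v t - d v t / 2) = x := by
      rw [Xc_eq hv]; field_simp; ring
    have h1 : |Xc v t x / ga v t| ≤ |Xc v t x| := by
      rw [abs_div, abs_of_pos (zero_lt_one.trans_le hg)]; exact div_le_self (abs_nonneg _) hg
    calc |x| = |Xc v t x / ga v t - (rv v t - d v t / 2)| := by rw [e]
      _ ≤ |Xc v t x / ga v t| + S := abs_sub _ _
      _ ≤ _ := by linarith
  have hY : ∀ x, |x| ≤ S + |Yc v t x| := fun x => by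
    have := hX (-x)
    rwa [abs_neg, Xc_neg] at this
  have key {c Ca Cb a b y x : ℝ} (ha : |a| ≤ Ca) (hb : |b| ≤ Cb * Real.exp (-|y|))
      (hx : |x| ≤ S + |y|) : |x| ^ k * |c * (a * b)|
        ≤ |c| * Ca * Cb * ((1 + S) ^ k * (k.factorial * Real.exp 1)) := by
    have h0 : 0 ≤ Ca := (abs_nonneg _).trans ha
    have h1 : 0 ≤ Cb := nonneg_of_mul_nonneg_left ((abs_nonneg _).trans hb) (Real.exp_pos _)
    rw [abs_mul, abs_mul]
    calc _ ≤ |x| ^ k * (|c| * (Ca * (Cb * Real.exp (-|y|)))) := by gcongr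
      _ = |c| * Ca * Cb * (|x| ^ k * Real.exp (-|y|)) := by ring
      _ ≤ _ := by
        refine mul_le_mul_of_nonneg_left (pow_mul_exp_neg_le k (abs_nonneg _) hx) (by positivity)
  induction h with
  | left hc ha hb =>
    obtain ⟨Ca, hCa⟩ := ha.bounded
    obtain ⟨Cb, hCb⟩ := hb.bounded
    exact ⟨_, fun x => key (hCa _) (hCb _) (hY x)⟩
  | @right c a b hc ha hb =>
    obtain ⟨Ca, hCa⟩ := hb.bounded
    obtain ⟨Cb, hCb⟩ := ha.bounded
    exact ⟨_, fun x => by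
      simp only [mul_comm (a _)]; exact key (hCa _) (hCb _) (hX x)⟩
  | add _ _ h1 h2 =>
    obtain ⟨C, hC⟩ := h1
    obtain ⟨D, hD⟩ := h2
    refine ⟨C + D, fun x => ?_⟩
    refine (mul_le_mul_of_nonneg_left (abs_add_le _ _) (by positivity)).trans ?_
    rw [mul_add]; exact add_le_add (hC x) (hD x)

theorem Tm.iterate_dx {p : ℕ} (n : ℕ) : ∀ {F : ℝ → ℝ → ℝ → ℝ}, Tm p F → ∃ F', Tm p F' ∧
    ∀ v ∈ Sp, ∀ t, iteratedDeriv n (fun x => (F v t x : ℂ)) = fun x => (F' v t x : ℂ) := by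
  induction n with
  | zero => exact fun {F} h => ⟨F, h, fun v _ t => by rw [iteratedDeriv_zero]⟩
  | succ n ih =>
    intro F h
    obtain ⟨F1, h1, hd⟩ := h.dx
    obtain ⟨F2, h2, he⟩ := ih h1
    refine ⟨F2, h2, fun v hv t => ?_⟩
    rw [iteratedDeriv_succ', ← he v hv t]
    congr 1
    funext x
    exact (hd v hv t x).ofReal_comp.deriv

open SchwartzMap in
theorem Tm.exists_schwartz {p : ℕ} {F : ℝ → ℝ → ℝ → ℝ} (h : Tm p F) {v : ℝ} (hv : v ∈ Sp) (t : ℝ) :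
    ∃ f : 𝓢(ℝ, ℂ), ∀ x, f x = (F v t x : ℂ) := by
  refine ⟨⟨fun x => (F v t x : ℂ), contDiff_of_differentiable_iteratedDeriv fun m _ => ?_,
    fun k n => ?_⟩, fun x => rfl⟩
  · obtain ⟨F', h', he⟩ := h.iterate_dx m
    obtain ⟨F2, _, hd⟩ := h'.dx
    rw [he v hv t]
    exact fun x => (hd v hv t x).ofReal_comp.differentiableAt
  · obtain ⟨F', h', he⟩ := h.iterate_dx n
    obtain ⟨C, hC⟩ := h'.pow_mul_le hv t k
    refine ⟨C, fun x => ?_⟩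
    rw [norm_iteratedFDeriv_eq_norm_iteratedDeriv, he v hv t, Complex.norm_real]
    exact hC x

/-- The Fourier multiplier is `1 - ∂ₓ²`, which preserves `Tm p`. -/
theorem Tm.fourier_weight {p : ℕ} {F : ℝ → ℝ → ℝ → ℝ} (h : Tm p F) : ∃ F', Tm p F' ∧
    ∀ v ∈ Sp, ∀ t ξ, 𝓕 (fun x => (F' v t x : ℂ)) ξ
      = ((1 + (2 * Real.pi * ξ) ^ 2 : ℝ) : ℂ) * 𝓕 (fun x => (F v t x : ℂ)) ξ := by
  obtain ⟨F1, h1, d1⟩ := h.dx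
  obtain ⟨F2, h2, d2⟩ := h1.dx
  refine ⟨_, h.sub h2, fun v hv t ξ => ?_⟩
  have hi {p : ℕ} {F : ℝ → ℝ → ℝ → ℝ} (h : Tm p F) : Integrable (fun x => (F v t x : ℂ)) := by
    obtain ⟨C, _, hC⟩ := h.integral_le
    exact (hC v hv t).1.ofReal
  have e1 : deriv (fun x => (F v t x : ℂ)) = fun x => (F1 v t x : ℂ) :=
    funext fun x => (d1 v hv t x).ofReal_comp.deriv
  have e2 : deriv (fun x => (F1 v t x : ℂ)) = fun x => (F2 v t x : ℂ) :=
    funext fun x => (d2 v hv t x).ofReal_comp.deriv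
  have f1 := Real.fourier_deriv (hi h)
    (fun x => (d1 v hv t x).ofReal_comp.differentiableAt) (by rw [e1]; exact hi h1)
  have f2 := Real.fourier_deriv (hi h1)
    (fun x => (d2 v hv t x).ofReal_comp.differentiableAt) (by rw [e2]; exact hi h2)
  rw [e1] at f1
  rw [e2] at f2
  have e3 : 𝓕 (fun x => ((F v t x - F2 v t x : ℝ) : ℂ)) ξ
      = 𝓕 (fun x => (F v t x : ℂ)) ξ - 𝓕 (fun x => (F2 v t x : ℂ)) ξ := by
    simp only [Real.fourier_eq, Complex.ofReal_sub, smul_sub]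
    exact integral_sub ((Real.fourierIntegral_convergent_iff ξ).2 (hi h))
      ((Real.fourierIntegral_convergent_iff ξ).2 (hi h2))
  rw [e3, f2]
  simp only [f1, smul_eq_mul]
  push_cast
  linear_combination (-(4 * Real.pi ^ 2 * ξ ^ 2 : ℂ) * 𝓕 (fun x => (F v t x : ℂ)) ξ) * Complex.I_sq

theorem Tm.fourier_weight_pow {p : ℕ} (m : ℕ) : ∀ {F : ℝ → ℝ → ℝ → ℝ}, Tm p F → ∃ F', Tm p F' ∧
    ∀ v ∈ Sp, ∀ t ξ, 𝓕 (fun x => (F' v t x : ℂ)) ξ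
      = ((1 + (2 * Real.pi * ξ) ^ 2 : ℝ) : ℂ) ^ m * 𝓕 (fun x => (F v t x : ℂ)) ξ := by
  induction m with
  | zero => exact fun {F} h => ⟨F, h, fun v _ t ξ => by simp⟩
  | succ m ih =>
    intro F h
    obtain ⟨F1, h1, e1⟩ := h.fourier_weight
    obtain ⟨F2, h2, e2⟩ := ih h1
    exact ⟨F2, h2, fun v hv t ξ => by rw [e2 v hv, e1 v hv]; ring⟩

theorem lintegral_weight_lt_top :
    ∫⁻ ξ : ℝ, ENNReal.ofReal ((1 + (2 * Real.pi * ξ) ^ 2)⁻¹) < ⊤ := by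
  have h : Integrable fun ξ : ℝ => (1 + (2 * Real.pi * ξ) ^ 2)⁻¹ :=
    integrable_inv_one_add_sq.comp_mul_left' (by positivity)
  exact h.lintegral_lt_top

open SchwartzMap in
theorem Tm.normHs_le {p : ℕ} {F : ℝ → ℝ → ℝ → ℝ} (h : Tm p F) (s : ℝ) : ∃ C, 0 < C ∧
    ∀ v ∈ Sp, ∀ t, normHs s (F v t) ≤ ENNReal.ofReal (C * wt 1 1 p v t) := by
  -- Then `s ≤ 2 m - 1`: with `y = 1 + (2πξ)²`, the bound `M / y^m` on the transform leaves at most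
  -- `M² / y` in the weighted integral, which is integrable.
  set m : ℕ := ⌈s⌉₊ + 1
  obtain ⟨F', h', he⟩ := h.fourier_weight_pow m
  obtain ⟨C, hC0, hC⟩ := h'.integral_le
  set A := (∫⁻ ξ : ℝ, ENNReal.ofReal ((1 + (2 * Real.pi * ξ) ^ 2)⁻¹)).toReal
  have hA : ∫⁻ ξ : ℝ, ENNReal.ofReal ((1 + (2 * Real.pi * ξ) ^ 2)⁻¹) = ENNReal.ofReal A :=
    (ENNReal.ofReal_toReal lintegral_weight_lt_top.ne).symm
  have hA0 : 0 ≤ A := ENNReal.toReal_nonneg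
  refine ⟨C * √A + 1, by positivity, fun v hv t => ?_⟩
  obtain ⟨f, hf⟩ := h.exists_schwartz hv t
  have hfe : (f : ℝ → ℂ) = fun x => (F v t x : ℂ) := funext hf
  set M := C * wt 1 1 p v t
  have hw := wt_pos hv 1 1 p t
  have hM : 0 ≤ M := by positivity
  have hb : ∀ ξ, ‖𝓕 (fun x => (F v t x : ℂ)) ξ‖ ≤ M / (1 + (2 * Real.pi * ξ) ^ 2) ^ m := fun ξ => by
    have hp : 0 < 1 + (2 * Real.pi * ξ) ^ 2 := by positivity
    rw [le_div_iff₀ (by positivity)]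
    calc _ = ‖𝓕 (fun x => (F' v t x : ℂ)) ξ‖ := by
          rw [he v hv, norm_mul, norm_pow, Complex.norm_real, Real.norm_of_nonneg hp.le, mul_comm]
      _ ≤ ∫ x, ‖(F' v t x : ℂ)‖ := VectorFourier.norm_fourierIntegral_le_integral_norm _ _ _ _ _
      _ = ∫ x, |F' v t x| := by simp only [Complex.norm_real, Real.norm_eq_abs]
      _ ≤ M := (hC v hv t).2
  have hmem : MemLp (fun x => (F v t x : ℂ)) 2 (volume : Measure ℝ) := by
    rw [← hfe]; exact f.memLp 2
  have hL : hmem.toLp (fun x => (F v t x : ℂ)) = f.toLp 2 :=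
    MemLp.toLp_congr _ _ (ae_of_all _ fun x => (hf x).symm)
  have hFae : (𝓕 (hmem.toLp (fun x => (F v t x : ℂ))) : Lp ℂ 2 (volume : Measure ℝ))
      =ᵐ[volume] 𝓕 (fun x => (F v t x : ℂ)) := by
    rw [hL, SchwartzMap.toLp_fourier_eq]
    refine ((𝓕 f).coeFn_toLp 2).trans (ae_of_all _ fun ξ => ?_)
    rw [SchwartzMap.fourier_coe, hfe]
  have hpt : ∀ ξ : ℝ, ENNReal.ofReal ((1 + (2 * Real.pi * ξ) ^ 2) ^ s)
      * ‖𝓕 (fun x => (F v t x : ℂ)) ξ‖ₑ ^ 2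
      ≤ ENNReal.ofReal (M ^ 2) * ENNReal.ofReal ((1 + (2 * Real.pi * ξ) ^ 2)⁻¹) := fun ξ => by
    have hp : 1 ≤ 1 + (2 * Real.pi * ξ) ^ 2 := by nlinarith [sq_nonneg (2 * Real.pi * ξ)]
    have hb' := hb ξ
    generalize 1 + (2 * Real.pi * ξ) ^ 2 = y at *
    have hy : 0 < y := by linarith
    rw [← ofReal_norm, ← ENNReal.ofReal_pow (norm_nonneg _),
      ← ENNReal.ofReal_mul (by positivity), ← ENNReal.ofReal_mul (by positivity)]
    refine ENNReal.ofReal_le_ofReal ?_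
    have h1 : y ^ s ≤ y ^ (2 * m - 1) := by
      rw [← Real.rpow_natCast]
      refine Real.rpow_le_rpow_of_exponent_le hp ((Nat.le_ceil s).trans ?_)
      exact_mod_cast (by omega : ⌈s⌉₊ ≤ 2 * m - 1)
    calc y ^ s * ‖𝓕 (fun x => (F v t x : ℂ)) ξ‖ ^ 2 ≤ y ^ (2 * m - 1) * (M / y ^ m) ^ 2 := by gcongr
      _ = M ^ 2 * y⁻¹ := by
        have h2 : y ^ (2 * m - 1) * y = (y ^ m) ^ 2 := by
          rw [← pow_succ, ← pow_mul]; congr 1; omega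
        rw [div_pow, ← h2]; field_simp
  rw [normHs, dif_pos hmem]
  have hsum : ∫⁻ ξ : ℝ, ENNReal.ofReal ((1 + (2 * Real.pi * ξ) ^ 2) ^ s)
      * ‖(𝓕 (hmem.toLp (fun x => (F v t x : ℂ))) : Lp ℂ 2 (volume : Measure ℝ)) ξ‖ₑ ^ 2
      ≤ ENNReal.ofReal (M ^ 2 * A) := by
    rw [lintegral_congr_ae (g := fun ξ => ENNReal.ofReal ((1 + (2 * Real.pi * ξ) ^ 2) ^ s)
      * ‖𝓕 (fun x => (F v t x : ℂ)) ξ‖ₑ ^ 2) (hFae.mono fun ξ hξ => by simp only [hξ])]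
    refine (lintegral_mono hpt).trans ?_
    rw [lintegral_const_mul' _ _ ENNReal.ofReal_ne_top, hA, ENNReal.ofReal_mul (by positivity)]
  calc _ ≤ ENNReal.ofReal (M ^ 2 * A) ^ (1 / 2 : ℝ) := by gcongr
    _ = ENNReal.ofReal (M * √A) := by
        rw [ENNReal.ofReal_rpow_of_nonneg (by positivity) (by norm_num), ← Real.sqrt_eq_rpow,
          Real.sqrt_mul (by positivity), Real.sqrt_sq hM]
    _ ≤ _ := by
        refine ENNReal.ofReal_le_ofReal ?_
        calc M * √A = C * √A * wt 1 1 p v t := by ring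
          _ ≤ (C * √A + 1) * wt 1 1 p v t := by gcongr; linarith

theorem Tm.iterate_dt (l : ℕ) : ∀ {p : ℕ} {F : ℝ → ℝ → ℝ → ℝ}, Tm p F → ∃ F', Tm (p + l) F' ∧
    ∀ v ∈ Sp, ∀ t x, iteratedDeriv l (fun τ => F v τ x) t = F' v t x := by
  induction l with
  | zero => exact fun {p F} h => ⟨F, h, fun v _ t x => by rw [iteratedDeriv_zero]⟩
  | succ l ih =>
    intro p F h
    obtain ⟨F1, h1, hd⟩ := h.dt
    obtain ⟨F2, h2, he⟩ := ih h1
    refine ⟨F2, by rwa [show p + (l + 1) = p + 1 + l by omega], fun v hv t x => ?_⟩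
    rw [iteratedDeriv_succ', ← he v hv t]
    congr 1
    funext τ
    exact (hd v hv τ x).deriv

theorem Lam_shift (φ : ℝ → ℝ → ℝ) (e t x : ℝ) :
    Lam (fun t' x' => φ (t' + e) x') t x = Lam φ (t + e) x := by
  have h := congrFun (iteratedDeriv_comp_add_const 2 (fun τ => φ τ x) e) t
  rw [Lam, Lam, box, box, h]

/-- The bound for the error of the ansatz. -/
theorem exists_normHs_Lam_le (e : ℝ → ℝ) (s : ℝ) (l : ℕ) : ∃ C : ℝ, 0 < C ∧ ∀ v ∈ Sp, ∀ t : ℝ,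
    normHs s (fun x => iteratedDeriv l (fun τ =>
      Lam (fun t' x' => ansatz v (rv v) (t' + e v) x') τ x) t)
    ≤ ENNReal.ofReal (C * v ^ (4 + l) * (|t + e v| * v + Real.log (1 / v ^ 2)) ^ 1
        * Real.exp (-(2 * √2 * |t + e v| * v))) := by
  obtain ⟨F, hF, h⟩ := exists_Tm_Lam
  obtain ⟨F', hF', h'⟩ := hF.iterate_dt l
  obtain ⟨C, hC, hb⟩ := hF'.normHs_le s
  refine ⟨C, hC, fun v hv t => ?_⟩
  have e1 : (fun x => iteratedDeriv l (fun τ =>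
      Lam (fun t' x' => ansatz v (rv v) (t' + e v) x') τ x) t) = F' v (t + e v) := by
    funext x
    rw [← h' v hv]
    simp only [Lam_shift, h v hv]
    exact congrFun (iteratedDeriv_comp_add_const l (fun τ => F v τ x) (e v)) t
  rw [e1]
  refine (hb v hv (t + e v)).trans (le_of_eq ?_)
  rw [wt, Lg, ew]
  congr 1; ring

/-! ### Asymptotics for large times -/

/-- Mean value inequality: between `y` and `l y + m` one has `|z| ≥ |y|/2 - 1`, so `g'` is of size
`e^{-|y|/2}` there. Half of this rate absorbs the displacement, which may grow linearly in `y`.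
Decay of `g` itself is not required, so the kink is included. -/
theorem exists_comp_affine_sub_le {g g' : ℝ → ℝ} (hg' : De g') (hg : ∀ y, HasDerivAt g (g' y) y) :
    ∃ C, 0 ≤ C ∧ ∀ l m y : ℝ, |l - 1| ≤ 1 / 2 → |m| ≤ 1 →
      |g (l * y + m) - g y| ≤ C * (|l - 1| + |m|) * Real.exp (-(|y| / 4)) := by
  obtain ⟨C, hC⟩ := hg'.bounded
  have hC0 : 0 ≤ C := nonneg_of_mul_nonneg_left ((abs_nonneg _).trans (hC 0)) (Real.exp_pos _)
  refine ⟨C * Real.exp 1 * 4, by positivity, fun l m y hl hm => ?_⟩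
  have hd : l * y + m - y = (l - 1) * y + m := by ring
  have h1 : |l * y + m - y| ≤ |y| / 2 + 1 := by
    rw [hd]
    refine (abs_add_le _ _).trans ?_
    rw [abs_mul]
    nlinarith [abs_nonneg y]
  have h2 : ∀ z ∈ uIcc y (l * y + m), ‖g' z‖ ≤ C * Real.exp (1 - |y| / 2) := fun z hz => by
    have h3 : |z - y| ≤ |l * y + m - y| := abs_sub_left_of_mem_uIcc hz
    have h4 : |y| ≤ |z| + |z - y| := by
      calc |y| = |z - (z - y)| := by congr 1; ring
        _ ≤ _ := abs_sub _ _
    refine (hC z).trans ?_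
    gcongr
    linarith
  have h5 := (convex_uIcc y (l * y + m)).norm_image_sub_le_of_norm_hasDerivWithin_le
    (fun z _ => (hg z).hasDerivWithinAt) h2 left_mem_uIcc right_mem_uIcc
  have h6 : |(l - 1) * y + m| ≤ (|l - 1| + |m|) * (1 + |y|) := by
    refine (abs_add_le _ _).trans ?_
    rw [abs_mul]
    nlinarith [abs_nonneg y, abs_nonneg m, abs_nonneg (l - 1),
      mul_nonneg (abs_nonneg m) (abs_nonneg y)]
  have h7 : 1 + |y| ≤ 4 * Real.exp (|y| / 4) := by
    linarith [Real.add_one_le_exp (|y| / 4)]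
  rw [Real.norm_eq_abs, Real.norm_eq_abs, hd] at h5
  calc _ ≤ _ := h5
    _ ≤ C * Real.exp (1 - |y| / 2) * ((|l - 1| + |m|) * (4 * Real.exp (|y| / 4))) := by
        gcongr
        exact h6.trans (by gcongr)
    _ = C * 4 * (|l - 1| + |m|) * (Real.exp (1 - |y| / 2) * Real.exp (|y| / 4)) := by ring
    _ = C * 4 * (|l - 1| + |m|) * (Real.exp 1 * Real.exp (-(|y| / 4))) := by
        rw [← Real.exp_add, ← Real.exp_add]; ring_nf
    _ = _ := by ring

theorem memLp_exp_neg_abs : MemLp (fun x : ℝ => Real.exp (-(|x| / 4))) 2 volume := by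
  rw [memLp_two_iff_integrable_sq (by fun_prop)]
  refine (integrable_exp_neg_abs.comp_mul_left' (show (1 / 2 : ℝ) ≠ 0 by norm_num)).congr
    (ae_of_all _ fun x => ?_)
  simp only
  rw [← Real.exp_nat_mul, abs_mul, abs_of_pos (show (0 : ℝ) < 1 / 2 by norm_num)]
  congr 1; push_cast; ring

/-- The sum of the two weights moving with velocities `v` and `-v`. -/
def W2 (v t x : ℝ) : ℝ := Real.exp (-(|x - v * t| / 4)) + Real.exp (-(|x + v * t| / 4))

/-- Families of functions of `x` that tend to zero relative to the moving weights. -/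
def Sm (v : ℝ) (D : ℝ → ℝ → ℝ) : Prop := ∃ η : ℝ → ℝ, Tendsto η atTop (𝓝 0) ∧
  ∀ᶠ t in atTop, ∀ x, |D t x| ≤ η t * W2 v t x

theorem Sm.tendsto_eLpNorm {v : ℝ} {D : ℝ → ℝ → ℝ} (h : Sm v D) :
    Tendsto (fun t => eLpNorm (D t) 2 volume) atTop (𝓝 0) := by
  obtain ⟨η, hη, hD⟩ := h
  set w : ℝ → ℝ := fun x => Real.exp (-(|x| / 4))
  have hw : MemLp w 2 volume := memLp_exp_neg_abs
  have htr (s : ℝ) : eLpNorm (fun x => w (x + s)) 2 volume = eLpNorm w 2 volume :=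
    eLpNorm_comp_measurePreserving hw.1 (measurePreserving_add_right volume s)
  have hlim : Tendsto (fun t => ENNReal.ofReal |η t| * (eLpNorm w 2 volume + eLpNorm w 2 volume))
      atTop (𝓝 (ENNReal.ofReal |0| * (eLpNorm w 2 volume + eLpNorm w 2 volume))) :=
    ENNReal.Tendsto.mul_const (ENNReal.tendsto_ofReal hη.abs)
      (Or.inr (ENNReal.add_ne_top.2 ⟨hw.2.ne, hw.2.ne⟩))
  rw [abs_zero, ENNReal.ofReal_zero, zero_mul] at hlim
  refine tendsto_of_tendsto_of_tendsto_of_le_of_le' tendsto_const_nhds hlim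
    (Eventually.of_forall fun _ => zero_le) ?_
  filter_upwards [hD] with t ht
  calc eLpNorm (D t) 2 volume ≤ eLpNorm (fun x => η t * W2 v t x) 2 volume :=
        eLpNorm_mono_real ht
    _ = ENNReal.ofReal |η t| * eLpNorm (W2 v t) 2 volume := by
        have := eLpNorm_const_smul (η t) (W2 v t) 2 (volume : Measure ℝ)
        rw [Real.enorm_eq_ofReal_abs] at this
        exact this
    _ ≤ _ := by
        gcongr
        refine (eLpNorm_add_le (f := fun x => w (x + -(v * t))) (g := fun x => w (x + v * t))
          ?_ ?_ (by norm_num)).trans ?_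
        · exact Continuous.aestronglyMeasurable (by fun_prop)
        · exact Continuous.aestronglyMeasurable (by fun_prop)
        · rw [htr, htr]

theorem Sm.add {v : ℝ} {D D' : ℝ → ℝ → ℝ} (h : Sm v D) (h' : Sm v D') :
    Sm v fun t x => D t x + D' t x := by
  obtain ⟨η, hη, hD⟩ := h
  obtain ⟨η', hη', hD'⟩ := h'
  refine ⟨fun t => η t + η' t, by simpa using hη.add hη', ?_⟩
  filter_upwards [hD, hD'] with t h1 h2 x
  rw [add_mul]; exact (abs_add_le _ _).trans (add_le_add (h1 x) (h2 x))

theorem Sm.coef_mul {v : ℝ} {D : ℝ → ℝ → ℝ} (h : Sm v D) {c : ℝ → ℝ} {a : ℝ}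
    (hc : Tendsto c atTop (𝓝 a)) : Sm v fun t x => c t * D t x := by
  obtain ⟨η, hη, hD⟩ := h
  refine ⟨fun t => |c t| * η t, by simpa using hc.abs.mul hη, ?_⟩
  filter_upwards [hD] with t h1 x
  rw [abs_mul, mul_assoc]; exact mul_le_mul_of_nonneg_left (h1 x) (abs_nonneg _)

theorem Sm.sub {v : ℝ} {D D' : ℝ → ℝ → ℝ} (h : Sm v D) (h' : Sm v D') :
    Sm v fun t x => D t x - D' t x := by
  have := h.add (h'.coef_mul (tendsto_const_nhds (x := (-1 : ℝ))))
  simpa [sub_eq_add_neg] using this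

theorem Sm.of_eq {v : ℝ} {D D' : ℝ → ℝ → ℝ} (h : Sm v D) (e : ∀ t x, D' t x = D t x) : Sm v D' := by
  rwa [show D' = D from funext fun t => funext (e t)]

theorem W2_neg (v t x : ℝ) : W2 v t (-x) = W2 v t x := by
  rw [W2, W2, add_comm, ← abs_neg (-x + v * t), ← abs_neg (-x - v * t)]
  ring_nf

/-- The weight is symmetric in the two kinks for this purpose: estimates at the right kink transfer
to the left one by reflection. -/
theorem Sm.swap {v : ℝ} {D : ℝ → ℝ → ℝ} (h : Sm v D) : Sm v fun t x => D t (-x) := by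
  obtain ⟨η, hη, hD⟩ := h
  refine ⟨η, hη, ?_⟩
  filter_upwards [hD] with t h1 x
  rw [← W2_neg]; exact h1 _

/-- The Lorentz-contracted coordinate of the kink moving with velocity `v`. -/
def Xi (v t x : ℝ) : ℝ := (x - v * t) / √(1 - v ^ 2)

/-- The time-translated coordinate of the right kink. -/
def Xs (v e t x : ℝ) : ℝ := Xc v (t + e) x

section
variable {v : ℝ}

theorem one_sub_sq_pos (hv : v ∈ Sp) : 0 < 1 - v ^ 2 := by nlinarith [hv.1, hv.2]

theorem abs_le_abs_Xi (hv : v ∈ Sp) (t x : ℝ) : |x - v * t| ≤ |Xi v t x| := by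
  have h := one_sub_sq_pos hv
  have h1 : √(1 - v ^ 2) ≤ 1 := Real.sqrt_le_one.2 (by nlinarith [sq_nonneg v])
  rw [Xi, abs_div, abs_of_pos (Real.sqrt_pos.2 h)]
  exact le_div_self (abs_nonneg _) (Real.sqrt_pos.2 h) h1

theorem exp_Xi_le (hv : v ∈ Sp) (t x : ℝ) : Real.exp (-(|Xi v t x| / 4)) ≤ W2 v t x := by
  have h1 : Real.exp (-(|Xi v t x| / 4)) ≤ Real.exp (-(|x - v * t| / 4)) :=
    Real.exp_le_exp.2 (by linarith [abs_le_abs_Xi hv t x])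
  have h2 := Real.exp_pos (-(|x + v * t| / 4))
  unfold W2; linarith

theorem Sm_coef_Xi (hv : v ∈ Sp) {b : ℝ → ℝ} (hb : De b) {c : ℝ → ℝ}
    (hc : Tendsto c atTop (𝓝 0)) : Sm v fun t x => c t * b (Xi v t x) := by
  obtain ⟨C, hC⟩ := hb.bounded
  have hC0 : 0 ≤ C := nonneg_of_mul_nonneg_left ((abs_nonneg _).trans (hC 0)) (Real.exp_pos _)
  refine ⟨fun t => |c t| * C, by simpa using hc.abs.mul_const C, Eventually.of_forall fun t x => ?_⟩
  rw [abs_mul, mul_assoc]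
  refine mul_le_mul_of_nonneg_left ((hC _).trans ?_) (abs_nonneg _)
  refine mul_le_mul_of_nonneg_left (le_trans ?_ (exp_Xi_le hv t x)) hC0
  rw [Real.exp_le_exp]; linarith [abs_nonneg (Xi v t x)]

variable {e a : ℝ}

theorem tendsto_th (hv : v ∈ Sp) : Tendsto (th v) atTop (𝓝 1) := by
  have h1 : Tendsto (sg v) atTop (𝓝 0) := Bd_sg.tendsto_zero hv
  have h2 : Tendsto (fun t => √(1 - sg v t)) atTop (𝓝 √(1 - 0)) := (h1.const_sub 1).sqrt
  rw [sub_zero, Real.sqrt_one] at h2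
  refine h2.congr' ?_
  filter_upwards [eventually_ge_atTop 0] with t ht
  have h3 : 0 ≤ th v t := by
    have := hv.1
    rw [th_eq]
    exact div_nonneg (Real.sinh_nonneg_iff.2 (by positivity)) (Real.cosh_pos _).le
  rw [sg, sub_sub_cancel, Real.sqrt_sq h3]

theorem tendsto_ga (hv : v ∈ Sp) : Tendsto (ga v) atTop (𝓝 (1 / √(1 - v ^ 2))) := by
  have h := one_sub_sq_pos hv
  have h1 : Tendsto (fun t => 1 - v ^ 2 * th v t ^ 2) atTop (𝓝 (1 - v ^ 2 * 1 ^ 2)) :=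
    (((tendsto_th hv).pow 2).const_mul (v ^ 2)).const_sub 1
  rw [one_pow, mul_one] at h1
  exact tendsto_const_nhds.div h1.sqrt (Real.sqrt_pos.2 h).ne'

theorem tendsto_log_cosh_sub : Tendsto (fun s => Real.log (Real.cosh s) - s) atTop
    (𝓝 (-Real.log 2)) := by
  have h1 : Tendsto (fun s : ℝ => Real.log ((1 + Real.exp (-(2 * s))) / 2)) atTop
      (𝓝 (Real.log ((1 + 0) / 2))) := by
    refine Tendsto.log ?_ (by norm_num)
    refine (Tendsto.const_add 1 (Real.tendsto_exp_atBot.comp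
      (tendsto_neg_atTop_atBot.comp ?_))).div_const 2
    exact Tendsto.const_mul_atTop (by norm_num) tendsto_id
  rw [add_zero, one_div, Real.log_inv] at h1
  refine h1.congr fun s => ?_
  have h2 : (1 + Real.exp (-(2 * s))) / 2 = Real.cosh s * Real.exp (-s) := by
    rw [Real.cosh_eq, div_mul_eq_mul_div, add_mul, ← Real.exp_add, ← Real.exp_add, add_neg_cancel,
      Real.exp_zero]
    ring_nf
  rw [h2, Real.log_mul (Real.cosh_pos s).ne' (Real.exp_pos _).ne', Real.log_exp]; ring

/-- The limit of `d_v(t) - 2 v t`. -/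
def dlim (v : ℝ) : ℝ := Real.log (2 / v ^ 2) / √2

theorem tendsto_d_sub (hv : v ∈ Sp) : Tendsto (fun t => d v t - 2 * v * t) atTop (𝓝 (dlim v)) := by
  have hv0 := hv.1
  have h1 : Tendsto (fun t : ℝ => √2 * v * t) atTop atTop :=
    Tendsto.const_mul_atTop (by positivity) tendsto_id
  have h2 := (((tendsto_log_cosh_sub.comp h1).const_mul 2).const_add
    (Real.log (8 / v ^ 2))).const_mul (1 / √2)
  have e1 : dlim v = 1 / √2 * (Real.log (8 / v ^ 2) + 2 * -Real.log 2) := by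
    have e2 : Real.log (8 / v ^ 2) = Real.log (2 / v ^ 2) + 2 * Real.log 2 := by
      rw [show (8 : ℝ) / v ^ 2 = 2 / v ^ 2 * 2 ^ 2 by ring,
        Real.log_mul (by positivity) (by positivity), Real.log_pow]
      norm_num
    rw [dlim, e2]; ring
  rw [e1]
  refine h2.congr fun t => ?_
  rw [d_eq v t hv0, Function.comp_apply]
  field_simp
  ring

theorem tendsto_add_const (e : ℝ) : Tendsto (fun t : ℝ => t + e) atTop atTop :=
  tendsto_atTop_add_const_right _ e tendsto_id

/-- The drift `v t + r(t + e) - d(t + e)/2` tends to `a - v e - dlim/2`. The condition on `e` is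
that this limit vanishes, and it determines the time shift. -/
theorem exists_affine_Xs (hv : v ∈ Sp) (ha : Tendsto (rv v) atTop (𝓝 a))
    (he : v * e = a - dlim v / 2) : ∃ l m : ℝ → ℝ, Tendsto l atTop (𝓝 1) ∧ Tendsto m atTop (𝓝 0) ∧
      ∀ t x, Xs v e t x = l t * Xi v t x + m t := by
  have h := Real.sqrt_pos.2 (one_sub_sq_pos hv)
  have hs := tendsto_add_const e
  refine ⟨fun t => ga v (t + e) * √(1 - v ^ 2),
    fun t => ga v (t + e) * (v * t + rv v (t + e) - d v (t + e) / 2), ?_, ?_, fun t x => ?_⟩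
  · have := ((tendsto_ga hv).comp hs).mul_const √(1 - v ^ 2)
    rwa [one_div_mul_cancel h.ne'] at this
  · have h1 := ((((ha.comp hs).sub (((tendsto_d_sub hv).comp hs).div_const 2))).sub_const (v * e))
    rw [he, sub_self] at h1
    have h2 := ((tendsto_ga hv).comp hs).mul h1
    rw [mul_zero] at h2
    refine h2.congr fun t => ?_
    simp only [Function.comp_apply]
    rw [← he]; ring
  · rw [Xs, Xc_eq hv, Xi]; field_simp; ring

theorem Sm_comp_sub (hv : v ∈ Sp) (ha : Tendsto (rv v) atTop (𝓝 a))
    (he : v * e = a - dlim v / 2) {g g' : ℝ → ℝ} (hg' : De g') (hg : ∀ y, HasDerivAt g (g' y) y) :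
    Sm v fun t x => g (Xs v e t x) - g (Xi v t x) := by
  obtain ⟨l, m, hl, hm, hX⟩ := exists_affine_Xs hv ha he
  obtain ⟨C, hC0, hC⟩ := exists_comp_affine_sub_le hg' hg
  refine ⟨fun t => C * (|l t - 1| + |m t|), ?_, ?_⟩
  · simpa using (((hl.sub_const 1).abs).add hm.abs).const_mul C
  · have e1 : ∀ᶠ t in atTop, |l t - 1| < 1 / 2 := by
      have : Tendsto (fun t => |l t - 1|) atTop (𝓝 0) := by simpa using (hl.sub_const 1).abs
      exact this.eventually_lt_const (by norm_num)
    have e2 : ∀ᶠ t in atTop, |m t| < 1 := by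
      have : Tendsto (fun t => |m t|) atTop (𝓝 0) := by simpa using hm.abs
      exact this.eventually_lt_const (by norm_num)
    filter_upwards [e1, e2] with t h1 h2 x
    rw [hX]
    refine (hC _ _ _ h1.le h2.le).trans ?_
    gcongr
    exact exp_Xi_le hv t x

theorem Sm_coef_sub (hv : v ∈ Sp) (ha : Tendsto (rv v) atTop (𝓝 a))
    (he : v * e = a - dlim v / 2) {b : ℝ → ℝ} (hb : De b) {c : ℝ → ℝ} {c0 : ℝ}
    (hc : Tendsto c atTop (𝓝 c0)) : Sm v fun t x => c t * b (Xs v e t x) - c0 * b (Xi v t x) := by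
  obtain ⟨b', hb', hd⟩ := hb.hasDeriv
  have h1 := (Sm_comp_sub hv ha he hb' hd).coef_mul hc
  have h2 := Sm_coef_Xi hv hb (c := fun t => c t - c0) (by simpa using hc.sub_const c0)
  exact (h1.add h2).of_eq fun t x => by ring

theorem Sm_coef (hv : v ∈ Sp) (ha : Tendsto (rv v) atTop (𝓝 a))
    (he : v * e = a - dlim v / 2) {b : ℝ → ℝ} (hb : De b) {c : ℝ → ℝ}
    (hc : Tendsto c atTop (𝓝 0)) : Sm v fun t x => c t * b (Xs v e t x) := by
  exact (Sm_coef_sub hv ha he hb hc).of_eq fun t x => by ring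

theorem Bd.tendsto_shift {n p : ℕ} {c : ℝ → ℝ → ℝ} (h : Bd n 1 p c) (hv : v ∈ Sp) (e : ℝ) :
    Tendsto (fun t => c v (t + e)) atTop (𝓝 0) := (h.tendsto_zero hv).comp (tendsto_add_const e)

/-- The value of the shifted ansatz minus the outgoing kinks. -/
theorem Sm_ansatz (hv : v ∈ Sp) (ha : Tendsto (rv v) atTop (𝓝 a)) (he : v * e = a - dlim v / 2) :
    Sm v fun t x => ansatz v (rv v) (t + e) x - H01 ((x - v * t) / √(1 - v ^ 2))
      - Hm10 ((x + v * t) / √(1 - v ^ 2)) := by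
  have h1 := Sm_comp_sub hv ha he De_H' hasDerivAt_H01
  have h2 := Sm_coef hv ha he De_G (SB_ep.bd.tendsto_shift hv e)
  refine ((h1.sub h1.swap).add (h2.sub h2.swap)).of_eq fun t x => ?_
  have e1 : Xi v t (-x) = -((x + v * t) / √(1 - v ^ 2)) := by rw [Xi, ← neg_div]; congr 1; ring
  rw [e1, Hm10, ansatz, ← ep]
  simp only [Xs, Xi, Xc]
  ring

theorem Sm_ansatz_dx (hv : v ∈ Sp) (ha : Tendsto (rv v) atTop (𝓝 a)) (he : v * e = a - dlim v / 2) :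
    Sm v fun t => deriv fun x => ansatz v (rv v) (t + e) x - H01 ((x - v * t) / √(1 - v ^ 2))
      - Hm10 ((x + v * t) / √(1 - v ^ 2)) := by
  have hga := (tendsto_ga hv).comp (tendsto_add_const e)
  have h1 := Sm_coef_sub hv ha he De_H' hga
  have h3 := Sm_coef hv ha he De_G' ((SB_ep.bd.mul SB_ga.bd).tendsto_shift hv e)
  refine ((h1.add h1.swap).add (h3.add h3.swap)).of_eq fun t x => ?_
  have hX := hasDerivAt_Xc_x hv (t + e) x
  have hY := hasDerivAt_Yc_x hv (t + e) x
  have hi1 : HasDerivAt (fun x => (x - v * t) / √(1 - v ^ 2)) (1 / √(1 - v ^ 2)) x :=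
    ((hasDerivAt_id x).sub_const _).div_const _
  have hi2 : HasDerivAt (fun x => -((x + v * t) / √(1 - v ^ 2))) (-(1 / √(1 - v ^ 2))) x :=
    (((hasDerivAt_id x).add_const _).div_const _).fun_neg
  have hA := (((hasDerivAt_H01 _).comp x hX).fun_sub ((hasDerivAt_H01 _).comp x hY)).fun_add
    ((((hasDerivAt_G _).comp x hX).fun_sub ((hasDerivAt_G _).comp x hY)).const_mul (ep v (t + e)))
  have hB := (hA.fun_sub ((hasDerivAt_H01 _).comp x hi1)).fun_sub
    (((hasDerivAt_H01 _).comp x hi2).fun_neg)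
  have e1 : Xi v t (-x) = -((x + v * t) / √(1 - v ^ 2)) := by rw [Xi, ← neg_div]; congr 1; ring
  refine (HasDerivAt.deriv hB).trans ?_
  simp only [Xs, Xc_neg, e1, H', Function.comp_apply]
  simp only [Xi]
  ring

theorem hasDerivAt_ansatz_t (hv : v ∈ Sp) (t x : ℝ) : HasDerivAt (fun τ => ansatz v (rv v) τ x)
    (H' (Xc v t x) * (al v t * Xc v t x + be rv' v t)
      - H' (Yc v t x) * (al v t * Yc v t x + be rv' v t)
      + (ep' v t * (G (Xc v t x) - G (Yc v t x)) + ep v t *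
        (G' (Xc v t x) * (al v t * Xc v t x + be rv' v t)
        - G' (Yc v t x) * (al v t * Yc v t x + be rv' v t)))) t := by
  have hX := hasDerivAt_Xc_t hv t x
  have hY := hasDerivAt_Yc_t hv t x
  exact (((hasDerivAt_H01 _).comp t hX).fun_sub ((hasDerivAt_H01 _).comp t hY)).fun_add
    ((hasDerivAt_ep hv t).fun_mul
      (((hasDerivAt_G _).comp t hX).fun_sub ((hasDerivAt_G _).comp t hY)))

theorem tendsto_be (hv : v ∈ Sp) : Tendsto (be rv' v) atTop (𝓝 (-(v / √(1 - v ^ 2)))) := by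
  have h := (tendsto_ga hv).mul ((SB_rv'.bd.tendsto_zero hv).sub ((tendsto_th hv).const_mul v))
  have e1 : 1 / √(1 - v ^ 2) * (0 - v * 1) = -(v / √(1 - v ^ 2)) := by ring
  rwa [e1] at h

theorem deriv_Hm10 (z : ℝ) : deriv Hm10 z = H' (-z) := by
  have h : HasDerivAt Hm10 _ z := ((hasDerivAt_H01 (-z)).comp z (hasDerivAt_neg z)).fun_neg
  rw [h.deriv, H']; ring

theorem Sm_ansatz_dt (hv : v ∈ Sp) (ha : Tendsto (rv v) atTop (𝓝 a)) (he : v * e = a - dlim v / 2) :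
    Sm v fun t x => deriv (fun τ => ansatz v (rv v) (τ + e) x) t
      + v / √(1 - v ^ 2) * deriv H01 ((x - v * t) / √(1 - v ^ 2))
      - v / √(1 - v ^ 2) * deriv Hm10 ((x + v * t) / √(1 - v ^ 2)) := by
  have h1 := Sm_coef_sub hv ha he De_H' ((tendsto_be hv).comp (tendsto_add_const e))
  have h2 := Sm_coef hv ha he De_H'.id_mul (SB_al.bd.tendsto_shift hv e)
  have h3 := Sm_coef hv ha he De_G (SB_ep'.bd.tendsto_shift hv e)
  have h4 := Sm_coef hv ha he De_G'.id_mul ((SB_ep.bd.mul (SB_al.bd.mono le_rfl (Nat.zero_le 1)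
    le_rfl)).tendsto_shift hv e)
  have h5 := Sm_coef hv ha he De_G' ((SB_ep.bd.mul (SB_be SB_rv').bd).tendsto_shift hv e)
  have h6 := (((h1.add h2).add h3).add h4).add h5
  refine (h6.sub h6.swap).of_eq fun t x => ?_
  have e1 : Xi v t (-x) = -((x + v * t) / √(1 - v ^ 2)) := by rw [Xi, ← neg_div]; congr 1; ring
  rw [deriv_comp_add_const (fun τ => ansatz v (rv v) τ x), (hasDerivAt_ansatz_t hv (t + e) x).deriv, deriv_Hm10,
    (hasDerivAt_H01 _).deriv, ← H']
  simp only [Xs, Xc_neg, e1, Function.comp_apply]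
  rw [← Xi]
  ring

end

/-! ### Time reversal and the phase shift. -/

theorem ansatz_neg {v : ℝ} (hv : v ∈ Sp) (t x : ℝ) :
    ansatz v (rv v) (-t) x = ansatz v (rv v) t x := by
  rw [ansatz, ansatz, rv_neg hv, w0_neg, w0_neg, d_neg]

theorem tendsto_reflect (e : ℝ) : Tendsto (fun t : ℝ => -t - 2 * e) atBot atTop :=
  tendsto_atTop_add_const_right _ (-(2 * e)) tendsto_neg_atBot_atTop

theorem tendsto_normH1 {v : ℝ} {D : ℝ → ℝ → ℝ} (h : Sm v D) (h' : Sm v fun t => deriv (D t)) :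
    Tendsto (fun t => normH1 (D t)) atTop (𝓝 0) := by
  have h1 := ((ENNReal.Tendsto.pow (n := 2) h.tendsto_eLpNorm).add
    (ENNReal.Tendsto.pow (n := 2) h'.tendsto_eLpNorm)).ennrpow_const (1 / 2)
  simpa [normH1] using h1

/-- The limit of the modulation. -/
def rlim (v : ℝ) : ℝ := limUnder atTop (rv v)

theorem tendsto_rlim {v : ℝ} (hv : v ∈ Sp) : Tendsto (rv v) atTop (𝓝 (rlim v)) :=
  tendsto_nhds_limUnder (exists_tendsto_modul hv SB_fN fN_neg)

/-- The time shift `e(v)`. -/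
def eshift (v : ℝ) : ℝ := (rlim v - dlim v / 2) / v

theorem v_mul_eshift {v : ℝ} (hv : v ∈ Sp) : v * eshift v = rlim v - dlim v / 2 := by
  have := hv.1
  rw [eshift]; field_simp

theorem tendsto_scattering {v : ℝ} (hv : v ∈ Sp) :
    Tendsto (fun t => normH1 (fun x => ansatz v (rv v) (t + eshift v) x
      - H01 ((x - v * t) / √(1 - v ^ 2)) - Hm10 ((x + v * t) / √(1 - v ^ 2)))) atTop (𝓝 0) ∧
    Tendsto (fun t => eLpNorm (fun x => deriv (fun τ => ansatz v (rv v) (τ + eshift v) x) t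
      + v / √(1 - v ^ 2) * deriv H01 ((x - v * t) / √(1 - v ^ 2))
      - v / √(1 - v ^ 2) * deriv Hm10 ((x + v * t) / √(1 - v ^ 2))) 2 volume) atTop (𝓝 0) :=
  ⟨tendsto_normH1 (Sm_ansatz hv (tendsto_rlim hv) (v_mul_eshift hv))
    (Sm_ansatz_dx hv (tendsto_rlim hv) (v_mul_eshift hv)),
    (Sm_ansatz_dt hv (tendsto_rlim hv) (v_mul_eshift hv)).tendsto_eLpNorm⟩

/-- The phase `e_v`. -/
def eInf (v : ℝ) : ℝ := -(2 * (v * eshift v))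

/-- The shifted ansatz is invariant under `t ↦ -t - 2 e`. Substituting this into `x ∓ v t` reverses
the velocity and adds `±2 v e`, which is `∓e_v`. -/
theorem tendsto_scattering_neg {v : ℝ} (hv : v ∈ Sp) :
    Tendsto (fun t => normH1 (fun x => ansatz v (rv v) (t + eshift v) x
      - H01 ((x + v * t - eInf v) / √(1 - v ^ 2))
      - Hm10 ((x - v * t + eInf v) / √(1 - v ^ 2)))) atBot (𝓝 0) ∧
    Tendsto (fun t => eLpNorm (fun x => deriv (fun τ => ansatz v (rv v) (τ + eshift v) x) t
      - v / √(1 - v ^ 2) * deriv H01 ((x + v * t - eInf v) / √(1 - v ^ 2))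
      + v / √(1 - v ^ 2) * deriv Hm10 ((x - v * t + eInf v) / √(1 - v ^ 2))) 2 volume)
      atBot (𝓝 0) := by
  obtain ⟨h1, h2⟩ := tendsto_scattering hv
  set e := eshift v with he
  have hA : ∀ t x, ansatz v (rv v) (-t - 2 * e + e) x = ansatz v (rv v) (t + e) x := fun t x => by
    rw [← ansatz_neg hv, show -(-t - 2 * e + e) = t + e by ring]
  have e1 : ∀ t x : ℝ, x - v * (-t - 2 * e) = x + v * t - eInf v := fun t x => by rw [eInf]; ring
  have e2 : ∀ t x : ℝ, x + v * (-t - 2 * e) = x - v * t + eInf v := fun t x => by rw [eInf]; ring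
  have hd : ∀ t x, deriv (fun τ => ansatz v (rv v) (τ + e) x) (-t - 2 * e)
      = -deriv (fun τ => ansatz v (rv v) (τ + e) x) t := fun t x => by
    have h1 : (-t - 2 * e) + e = -(t + e) := by ring
    rw [deriv_comp_add_const (fun τ => ansatz v (rv v) τ x), deriv_comp_add_const
      (fun τ => ansatz v (rv v) τ x), h1, deriv_neg_of_even (fun τ => ansatz_neg hv τ x)]
  constructor
  · refine (h1.comp (tendsto_reflect e)).congr fun t => ?_
    simp only [Function.comp_apply, hA, e1, e2]
  · refine (h2.comp (tendsto_reflect e)).congr fun t => ?_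
    simp only [Function.comp_apply, hd, e1, e2]
    rw [← eLpNorm_neg]
    congr 1
    funext x
    simp only [Pi.neg_apply]
    ring

/-- The logarithm is exactly the contribution of `dlim`; the remaining `-2 rlim` inherits the
uniform bound on `rv`. -/
theorem abs_eInf_sub_le {v K : ℝ} (hv : v ∈ Sp)
    (hK : ∀ t, |rv v t| ≤ K * (v ^ 2 * Real.log (1 / v))) :
    |eInf v - Real.log (2 / v ^ 2) / √2| ≤ 2 * (K * (v ^ 2 * Real.log (1 / v))) := by
  have h1 : |rlim v| ≤ K * (v ^ 2 * Real.log (1 / v)) :=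
    le_of_tendsto (tendsto_rlim hv).abs (Eventually.of_forall hK)
  rw [eInf, v_mul_eshift hv, ← dlim, show -(2 * (rlim v - dlim v / 2)) - dlim v = -(2 * rlim v) by
    ring, abs_neg, abs_mul, abs_two]
  linarith

theorem tendsto_eInf {K : ℝ} (hK0 : 0 < K)
    (hK : ∀ v ∈ Sp, ∀ t, |rv v t| ≤ K * (v ^ 2 * Real.log (1 / v))) :
    Tendsto (fun v => |eInf v - Real.log (2 / v ^ 2) / √2| / (v * |Real.log v| ^ 3))
      (𝓝[>] 0) (𝓝 0) := by
  have h1 : Tendsto (fun v : ℝ => 2 * K * (4 * v)) (𝓝[>] 0) (𝓝 0) := by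
    have : Tendsto (fun v : ℝ => 2 * K * (4 * v)) (𝓝 0) (𝓝 (2 * K * (4 * 0))) :=
      Continuous.tendsto (by fun_prop) 0
    simpa using this.mono_left nhdsWithin_le_nhds
  refine tendsto_of_tendsto_of_tendsto_of_le_of_le' tendsto_const_nhds h1 ?_ ?_
  · filter_upwards [self_mem_nhdsWithin] with v hv
    have : (0 : ℝ) < v := hv
    positivity
  · filter_upwards [Ioo_mem_nhdsGT (show (0 : ℝ) < 1 / 2 by norm_num)] with v hv
    have hv0 := hv.1
    have h2 := one_le_log_Sp hv
    have h3 : Real.log (1 / v) = -Real.log v := by rw [one_div, Real.log_inv]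
    have h4 : Real.log (1 / v ^ 2) = 2 * -Real.log v := by
      rw [one_div, Real.log_inv, Real.log_pow]; push_cast; ring
    have h5 : |Real.log v| = -Real.log v := abs_of_neg (by linarith)
    have h6 := abs_eInf_sub_le hv (hK v hv)
    rw [h5]
    rw [h3] at h6
    rw [h4] at h2
    generalize -Real.log v = y at *
    have hy : 1 / 2 ≤ y := by linarith
    rw [div_le_iff₀ (by positivity)]
    refine h6.trans ?_
    -- `y = ln (1/v) ≥ 1/2` trades one logarithm for three, and the extra power of `v` makes the
    -- quotient tend to zero.
    have h7 : 1 ≤ 4 * y ^ 2 := by nlinarith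
    calc 2 * (K * (v ^ 2 * y)) = 2 * K * v ^ 2 * y * 1 := by ring
      _ ≤ 2 * K * v ^ 2 * y * (4 * y ^ 2) := by gcongr
      _ = _ := by ring

end PhiSix

end

theorem mainTheorem3 :
    ∃ (r : ℝ → ℝ → ℝ) (e eInf : ℝ → ℝ) (δ K : ℝ) (n : ℕ),
      0 < δ ∧ δ < 1 ∧ 0 < K ∧ 1 ≤ n ∧
      -- the modulation `r_v`: smooth, even, `O(v² ln (1/v))`, solution of the linear equation
      (∀ v ∈ Ioo 0 δ,
        ContDiff ℝ ∞ (r v) ∧ (∀ t, r v (-t) = r v t) ∧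
        (∀ t, |r v t| ≤ K * (v ^ 2 * Real.log (1 / v))) ∧
        (∀ t, (∫ x, deriv PhiSix.H01 x ^ 2) * iteratedDeriv 2 (r v) t
          = -32 * Real.exp (-(√2 * PhiSix.d v t)) * (∫ x, deriv PhiSix.H01 x ^ 2) * r v t
            + PhiSix.NL v t)) ∧
      -- the limits as `t → ±∞`
      (∀ v ∈ Ioo 0 δ,
        Tendsto (fun t => PhiSix.normH1 (fun x => PhiSix.ansatz v (r v) (t + e v) x
          - PhiSix.H01 ((x - v * t) / √(1 - v ^ 2))
          - PhiSix.Hm10 ((x + v * t) / √(1 - v ^ 2)))) atTop (𝓝 0) ∧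
        Tendsto (fun t => eLpNorm (fun x =>
          deriv (fun τ => PhiSix.ansatz v (r v) (τ + e v) x) t
          + v / √(1 - v ^ 2) * deriv PhiSix.H01 ((x - v * t) / √(1 - v ^ 2))
          - v / √(1 - v ^ 2) * deriv PhiSix.Hm10 ((x + v * t) / √(1 - v ^ 2))) 2 volume)
          atTop (𝓝 0) ∧
        Tendsto (fun t => PhiSix.normH1 (fun x => PhiSix.ansatz v (r v) (t + e v) x
          - PhiSix.H01 ((x + v * t - eInf v) / √(1 - v ^ 2))
          - PhiSix.Hm10 ((x - v * t + eInf v) / √(1 - v ^ 2)))) atBot (𝓝 0) ∧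
        Tendsto (fun t => eLpNorm (fun x =>
          deriv (fun τ => PhiSix.ansatz v (r v) (τ + e v) x) t
          - v / √(1 - v ^ 2) * deriv PhiSix.H01 ((x + v * t - eInf v) / √(1 - v ^ 2))
          + v / √(1 - v ^ 2) * deriv PhiSix.Hm10 ((x - v * t + eInf v) / √(1 - v ^ 2))) 2 volume)
          atBot (𝓝 0)) ∧
      -- the size of the phase shift
      Tendsto (fun v => |eInf v - Real.log (2 / v ^ 2) / √2| / (v * |Real.log v| ^ 3))
        (𝓝[>] 0) (𝓝 0) ∧
      -- the size of the error `Λ(φ₂)`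
      (∀ s : ℝ, 0 ≤ s → ∀ l : ℕ, ∃ C : ℝ, 0 < C ∧ ∀ v ∈ Ioo 0 δ, ∀ t : ℝ,
        PhiSix.normHs s (fun x => iteratedDeriv l (fun τ =>
          PhiSix.Lam (fun t' x' => PhiSix.ansatz v (r v) (t' + e v) x') τ x) t)
        ≤ ENNReal.ofReal (C * v ^ (4 + l) * (|t + e v| * v + Real.log (1 / v ^ 2)) ^ n
            * Real.exp (-(2 * √2 * |t + e v| * v)))) := by
  obtain ⟨K, hK0, hK⟩ := PhiSix.exists_abs_rv_le
  -- `δ = 1/2` is the endpoint of `Sp`, and `n = 1` is the power of `Lg` in the coefficients of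
  -- `Tm`.
  refine ⟨PhiSix.rv, PhiSix.eshift, PhiSix.eInf, 1 / 2, K, 1, by norm_num, by norm_num, hK0, le_rfl,
    fun v hv => ⟨PhiSix.SB_rv.contDiff hv, PhiSix.rv_neg hv, hK v hv, PhiSix.rv_equation hv⟩,
    fun v hv => ?_, PhiSix.tendsto_eInf hK0 hK,
    fun s _ l => PhiSix.exists_normHs_Lam_le PhiSix.eshift s l⟩
  have h1 := PhiSix.tendsto_scattering hv
  have h2 := PhiSix.tendsto_scattering_neg hv
  exact ⟨h1.1, h1.2, h2.1, h2.2⟩
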